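/- **Setting.** For integers $p,n\ge 1$ one observes $X=\theta+E\in\mathbb R^{p\times n}$, where the entries of $E$ are independent $N(0,1)$. Let $\Theta_0(p,n)$ be the set of $\theta\in\mathbb R^{p\times n}$ all of whose rows are constant. For $\rho\ge 0$ and an integer $s\ge 0$, let $\Theta_1(p,n,\rho,s)$ be the set of all $\theta\in\mathbb R^{p\times n}$ for which there are $S\subseteq\{1,\dots,p\}$ with $|S|\ge s$, a common changepoint $t^*\in\{1,\dots,n-1\}$ and reals $\mu_{j1},\mu_{j2}$ such that, for every $j\le p$, $\theta_{ji}=\mu_{j1}$ for $i\le t^*$ and $\theta_{ji}=\mu_{j2}$ for $i>t^*$, with $$\sqrt{\tfrac{t^*(n-t^*)}{n}}\,(\mu_{j1}-\mu_{j2})\ge\rho\quad\text{for } j\in S,\qquad \mu_{j1}=\mu_{j2}\quad\text{for } j\notin S.$$ For a Borel test $\psi:\mathbb R^{p\times n}\to\{0,1\}$ let $$\mathcal R(\psi,p,n,\rho,s)=\sup_{\theta\in\Theta_0(p,n)}\mathbb E_\theta\psi(X)+\sup_{\theta\in\Theta_1(p,n,\rho,s)}\mathbb E_\theta\{1-\psi(X)\},\qquad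 \mathcal R(p,n,\rho,s)=\inf_\psi\mathcal R(\psi,p,n,\rho,s).$$ For $a>0$ and $\beta\in(0,1)$ define $\rho^*(a,\beta)=\rho^*_p(a,\beta)\ge 0$ by $$\rho^*(a,\beta)^2=\begin{cases}p^{a-(1-2\beta)}, & a\le 1-2\beta,\\ (a-(1-2\beta))\log p, & 1-2\beta<a\le 1-4\beta/3,\\ 2\bigl(\sqrt{1-a}-\sqrt{1-a-\beta}\bigr)^2\log p, & 1-4\beta/3<a\le 1-\beta,\\ p^{a-(1-\beta)}, & a>1-\beta.\end{cases}$$ **Penalized Berk–Jones test.** For $1\le t\le n-1$ put $$Y_{jt}=\sqrt{\tfrac{t(n-t)}{n}}\Bigl(\tfrac1t\sum_{i\le t}X_{ji}-\tfrac1{n-t}\sum_{i>t}X_{ji}\Bigr),\qquad \bar S_t(q)=\tfrac1p\#\{j\le p: Y_{jt}>\bar\Phi^{-1}(q)\},$$ where $\bar\Phi$ is the standard normal upper tail function, and $K(x,q)=x\log\frac xq+(1-x)\log\frac{1-x}{1-q}$ (with $0\log 0=0$). With $\delta=1/\log\log n$, let $\mathcal T$ be the grid of all $\lfloor(1+\delta)^k\rfloor$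 and $\lfloor n-(1+\delta)^k\rfloor$ with integers $0\le k\le\log_{1+\delta}(n/2)$. For a constant $\gamma>0$ let $\psi_{\mathrm{PBJ}}(X)=1$ if $$\max_{t\in\mathcal T}\ \sup_{q\in(0,1)}pK(\bar S_t(q),q)-2\log|\mathcal T|>2(2+\gamma)\log p,$$ and $\psi_{\mathrm{PBJ}}(X)=0$ otherwise. This test uses only $p$, $n$, $X$ and $\gamma$, and none of $a,\beta,\beta_1,\rho,s$. **Theorem.** Let $a>0$, $\beta,\beta_1\in(0,1)$, and let $n=n(p)$, $s=s(p)$ be sequences of natural numbers with $\dfrac{\log\log\log n}{a\log p}\to1$ and $\dfrac{s}{p^{1-\beta}}\to1$ as $p\to\infty$. Put $\rho^*=\rho^*(a,\beta_1)$. 1. (Lower bound) If $\beta>\beta_1$, then $\mathcal R(p,n,\rho^*,s)\not\to0$ as $p\to\infty$. 2. (Upper bound) If $\beta<\beta_1$, then $\mathcal R(p,n,\rho^*,s)\to0$ as $p\to\infty$. Moreover, for every fixed $\gamma>0$, $\psi_{\mathrm{PBJ}}$ is a Borel test and $\mathcal R(\psi_{\mathrm{PBJ}},p,n,\rho^*,s)\to0$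 as $p\to\infty$. -/

import Mathlib

open MeasureTheory ProbabilityTheory Filter Topology

namespace Changepoint

noncomputable section

/-- Real `p × n` matrices: used both for mean matrices and for observations. -/
abbrev Mat (p n : ℕ) : Type := Fin p → Fin n → ℝ

/-- The law of `X = θ + E`, where the entries of `E` are independent standard Gaussians. -/
def obsLaw {p n : ℕ} (θ : Mat p n) : Measure (Mat p n) :=
  Measure.pi fun j => Measure.pi fun i => gaussianReal (θ j i) 1

/-- The null parameter space: every row is constant. -/
def nullSpace (p n : ℕ) : Set (Mat p n) :=
  {θ | ∃ μ : Fin p → ℝ, ∀ j i, θ j i = μ j}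

/-- The one-sided alternative: at a common changepoint `t ∈ {1, …, n - 1}`, the means of at least
`s` rows (those in `S`) decrease by a normalised amount at least `ρ`; the other rows are constant.
The columns are numbered from `0`, so that the first `t` columns are those with `i < t`. -/
def altSpace (p n : ℕ) (ρ : ℝ) (s : ℕ) : Set (Mat p n) :=
  {θ | ∃ (S : Finset (Fin p)) (μ₁ μ₂ : Fin p → ℝ) (t : ℕ),
    s ≤ S.card ∧ 1 ≤ t ∧ t < n ∧
    (∀ j, ∀ i : Fin n, θ j i = if (i : ℕ) < t then μ₁ j else μ₂ j) ∧
    (∀ j ∈ S, ρ ≤ √((t : ℝ) * ((n : ℝ) - t) / n) * (μ₁ j - μ₂ j)) ∧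
    (∀ j, j ∉ S → μ₁ j = μ₂ j)}

/-- Borel measurable tests with values in `{0, 1}`. -/
def IsTest {p n : ℕ} (ψ : Mat p n → ℝ) : Prop :=
  Measurable ψ ∧ ∀ X, ψ X = 0 ∨ ψ X = 1

/-- The worst-case testing error of `ψ`: the sum of the suprema of the Type I and II errors. -/
def worstCaseError {p n : ℕ} (ψ : Mat p n → ℝ) (ρ : ℝ) (s : ℕ) : ℝ :=
  (⨆ θ : nullSpace p n, ∫ X, ψ X ∂obsLaw θ.1) +
    ⨆ θ : altSpace p n ρ s, ∫ X, (1 - ψ X) ∂obsLaw θ.1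

/-- The minimax testing error. -/
def minimaxError (p n : ℕ) (ρ : ℝ) (s : ℕ) : ℝ :=
  ⨅ ψ : {ψ : Mat p n → ℝ // IsTest ψ}, worstCaseError ψ.1 ρ s

/-- The square of the one-sided detection boundary. -/
def boundarySq (a β : ℝ) (p : ℕ) : ℝ :=
  if a ≤ 1 - 2 * β then (p : ℝ) ^ (a - (1 - 2 * β))
  else if a ≤ 1 - 4 * β / 3 then (a - (1 - 2 * β)) * Real.log p
  else if a ≤ 1 - β then 2 * (√(1 - a) - √(1 - a - β)) ^ 2 * Real.log p
  else (p : ℝ) ^ (a - (1 - β))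

/-- The one-sided detection boundary. -/
def boundary (a β : ℝ) (p : ℕ) : ℝ := √(boundarySq a β p)

/-- The asymptotic regime `log log log n ∼ a log p`, `s ∼ p ^ (1 - β)` as `p → ∞`, where
`x_p ∼ y_p` means `x_p / y_p → 1`. -/
def Regime (a β : ℝ) (n s : ℕ → ℕ) : Prop :=
  Tendsto (fun p : ℕ => Real.log (Real.log (Real.log (n p))) / (a * Real.log p)) atTop (𝓝 1) ∧
    Tendsto (fun p : ℕ => (s p : ℝ) / (p : ℝ) ^ (1 - β)) atTop (𝓝 1)

/-! ### The penalised Berk-Jones test -/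

/-- The normalised contrast of row `j` at the candidate changepoint `t`. -/
def contrast {p n : ℕ} (X : Mat p n) (t : ℕ) (j : Fin p) : ℝ :=
  √((t : ℝ) * ((n : ℝ) - t) / n) *
    (1 / (t : ℝ) * (∑ i ∈ Finset.univ.filter (fun i : Fin n => (i : ℕ) < t), X j i) -
      1 / ((n : ℝ) - t) * (∑ i ∈ Finset.univ.filter (fun i : Fin n => t ≤ (i : ℕ)), X j i))

/-- The upper tail function of the standard normal distribution. -/
def normalTail (x : ℝ) : ℝ := 1 - cdf (gaussianReal 0 1) x

/-- The inverse of `normalTail` on `(0, 1)`, as a generalised inverse. -/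
def normalTailInv (q : ℝ) : ℝ := sInf {x : ℝ | normalTail x ≤ q}

open Classical in
/-- The fraction of the rows whose contrast at `t` exceeds the upper `q`-quantile. -/
def exceedFrac {p n : ℕ} (X : Mat p n) (t : ℕ) (q : ℝ) : ℝ :=
  1 / (p : ℝ) * ∑ j : Fin p, if normalTailInv q < contrast X t j then 1 else 0

/-- The Kullback-Leibler divergence between Bernoulli laws with parameters `x` and `t`
(with the convention `0 log 0 = 0`). -/
def bernKL (x t : ℝ) : ℝ :=
  x * Real.log (x / t) + (1 - x) * Real.log ((1 - x) / (1 - t))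

/-- The ratio `1 + δ` of the geometric grid, with `δ = 1 / log log n`. -/
def gridBase (n : ℕ) : ℝ := 1 + 1 / Real.log (Real.log n)

/-- The symmetric geometric grid of candidate changepoints: the numbers `⌊b ^ k⌋` and
`⌊n - b ^ k⌋` for `b = 1 + δ` and integers `0 ≤ k ≤ log_b (n / 2)`. -/
def grid (n : ℕ) : Finset ℕ :=
  (Finset.range (⌊Real.logb (gridBase n) ((n : ℝ) / 2)⌋₊ + 1)).image
      (fun k => ⌊gridBase n ^ k⌋₊) ∪
    (Finset.range (⌊Real.logb (gridBase n) ((n : ℝ) / 2)⌋₊ + 1)).image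
      (fun k => ⌊(n : ℝ) - gridBase n ^ k⌋₊)

/-- The penalised Berk-Jones statistic. -/
def pbjStat {p n : ℕ} (X : Mat p n) : EReal :=
  (⨆ t ∈ grid n, ⨆ q ∈ Set.Ioo (0 : ℝ) 1,
      (((p : ℝ) * bernKL (exceedFrac X t q) q : ℝ) : EReal)) -
    ((2 * Real.log (grid n).card : ℝ) : EReal)

open Classical in
/-- The penalised Berk-Jones test. It depends on the dimensions `p`, `n`, the data and the fixed
constant `γ > 0` only. -/
def pbjTest (γ : ℝ) {p n : ℕ} (X : Mat p n) : ℝ :=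
  if ((2 * (2 + γ) * Real.log p : ℝ) : EReal) < pbjStat X then 1 else 0

end

end Changepoint

/-!
Everything is driven by the identity `log T ≈ p ^ a`, up to factors `p ^ o(1)`, where `T` is the
number of candidate changepoints that are separated enough to be nearly independent: their number
is of order `log n`, up to lower order terms, and `log log n = p ^ (a + o(1))`.

**Lower bound.** Take as candidates the powers `R ^ (k + 1)` of `R = p ^ m`, `m` large, and let each
row carry the signal independently with probability `ε = 4 * s / p`. Up to a negligible error
(`integral_obsLaw_add_ge`), the step at `R ^ (k + 1)` may be replaced by a block supported on the
columns between `R ^ k` and `R ^ (k + 1)`. These supports are disjoint, so the mixture likelihood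
ratios `L k` of the blocks are independent (`indepFun_mixLik`), and every test has error close to one
as soon as the average of the `L k` is close to one in `L¹`. By truncation and Chebyshev
(`integral_abs_average_sub_one_le`) this holds if, for some `θ ∈ (0, 1]`, the moment of order
`1 + θ` of `L k` is much smaller than `T ^ (θ / 2)`. That moment is the `p`-th power of the moment
for one row, which is at most `1 + ε ^ 2 * (exp (ρ ^ 2) - 1)` for `θ = 1`, and at most
`1 + 2 * ε ^ (1 + θ) * exp (θ * (1 + θ) * ρ ^ 2 / 2)` in general. In each of the four regimes of the
boundary a suitable `θ`, which in the sparsest regime tends to zero, gives the claim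
(`exists_moment_bound`, `le_minimaxError`, `eventually_le_minimaxError`).

**Upper bound.** The contrasts of the rows at a fixed time are independent standard Gaussians,
shifted by the contrasts of the mean (`map_contrast_obsLaw`).

For the Type I error, fix a grid point and the number `k` of exceedances. The levels `q` for which
`k` exceedances cause a rejection form two families, below and above `k / p`. Along each of them the
exceedance events are monotone, so the Chernoff bound for a single level also bounds the
probability of their union (`measure_exists_level_le`). A union bound over `k ≤ p` and over the grid
is then paid for by the threshold (`typeI_le`).

For the Type II error, some grid point retains any given fraction `κ < 1` of the signal
(`exists_grid_contrast_ge`), while the penalty is only of order `log log n`, that is `p ^ a`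
(`log_card_grid_le`). At a level `q = normalTail z` the signal rows add
`D = s * (normalTail (z - κ * ρ) - q)` to the expected number `p * q` of exceedances; at least half
of this excess is present with high probability, and it causes a rejection when
`p * poissonKL (q + D / (2 * p)) q` exceeds the threshold (`typeII_le`). It remains to choose `z`:
zero in the dense regime, `√(2 * u * log p)` for a suitable `u` in the two intermediate regimes, where
`D ^ 2 / (p * q + D)` exceeds `p ^ a` by a power of `p` (`eventually_rejection`), and half of the
signal in the sparsest regime, where the logarithmic factor in the divergence, of order `ρ ^ 2`, is
decisive (`eventually_rejection_very_sparse`).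
-/

namespace Changepoint

noncomputable section

/-! ### Gaussian product measures and change of measure -/

lemma pi_withDensity {ι : Type*} [Fintype ι] {Ω : ι → Type*} [∀ i, MeasurableSpace (Ω i)]
    (μ : ∀ i, Measure (Ω i)) [∀ i, IsProbabilityMeasure (μ i)] (f : ∀ i, Ω i → ENNReal)
    (hf : ∀ i, Measurable (f i)) [∀ i, SigmaFinite ((μ i).withDensity (f i))] :
    Measure.pi (fun i => (μ i).withDensity (f i)) =
      (Measure.pi μ).withDensity (fun x => ∏ i, f i (x i)) := by
  refine Measure.pi_eq fun s hs => ?_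
  have hind : iIndepFun (fun i (x : ∀ i, Ω i) => (s i).indicator (f i) (x i)) (Measure.pi μ) :=
    iIndepFun_pi (X := fun i => (s i).indicator (f i))
      (fun i => ((hf i).indicator (hs i)).aemeasurable)
  have hmeas : ∀ i, Measurable (fun x : ∀ i, Ω i => (s i).indicator (f i) (x i)) :=
    fun i => ((hf i).indicator (hs i)).comp (measurable_pi_apply i)
  rw [withDensity_apply _ (MeasurableSet.univ_pi hs), ← lintegral_indicator (MeasurableSet.univ_pi hs)]
  have : ∀ x : ∀ i, Ω i, (Set.univ.pi s).indicator (fun x => ∏ i, f i (x i)) x =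
      ∏ i, (s i).indicator (f i) (x i) := by
    intro x
    by_cases hx : x ∈ Set.univ.pi s
    · rw [Set.indicator_of_mem hx]
      exact Finset.prod_congr rfl fun i _ => (Set.indicator_of_mem (hx i trivial) _).symm
    · rw [Set.indicator_of_notMem hx]
      simp only [Set.mem_pi, Set.mem_univ, true_imp_iff, not_forall] at hx
      obtain ⟨i, hi⟩ := hx
      exact (Finset.prod_eq_zero (Finset.mem_univ i) (Set.indicator_of_notMem hi _)).symm
  simp_rw [this]
  rw [lintegral_prod_eq_prod_lintegral_of_indepFun _ _ hind hmeas]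
  refine Finset.prod_congr rfl fun i _ => ?_
  rw [withDensity_apply _ (hs i), ← lintegral_indicator (hs i),
    ← (measurePreserving_eval μ i).lintegral_comp ((hf i).indicator (hs i))]

lemma gaussianReal_shift (m d : ℝ) :
    (gaussianReal m 1).withDensity (fun x => ENNReal.ofReal (Real.exp (d * (x - m) - d ^ 2 / 2))) =
      gaussianReal (m + d) 1 := by
  rw [gaussianReal_of_var_ne_zero _ one_ne_zero, gaussianReal_of_var_ne_zero _ one_ne_zero,
    ← withDensity_mul _ (measurable_gaussianPDF _ _) (by fun_prop)]
  congr 1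
  ext x
  simp only [Pi.mul_apply, gaussianPDF]
  rw [← ENNReal.ofReal_mul (gaussianPDFReal_nonneg _ _ _)]
  congr 1
  simp only [gaussianPDFReal, mul_assoc, ← Real.exp_add]
  congr 2
  push_cast
  ring_nf

instance {p n : ℕ} (θ : Mat p n) : IsProbabilityMeasure (obsLaw θ) := by
  unfold obsLaw; infer_instance

/-- The likelihood ratio of `obsLaw (θ + d)` with respect to `obsLaw θ`. -/
def likRatio {p n : ℕ} (θ d : Mat p n) (X : Mat p n) : ℝ :=
  ∏ j, ∏ i, Real.exp (d j i * (X j i - θ j i) - d j i ^ 2 / 2)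

lemma likRatio_nonneg {p n : ℕ} (θ d X : Mat p n) : 0 ≤ likRatio θ d X :=
  Finset.prod_nonneg fun _ _ => Finset.prod_nonneg fun _ _ => (Real.exp_pos _).le

lemma measurable_likRatio {p n : ℕ} (θ d : Mat p n) : Measurable (likRatio θ d) := by
  unfold likRatio; fun_prop

lemma obsLaw_add {p n : ℕ} (θ d : Mat p n) :
    obsLaw (θ + d) = (obsLaw θ).withDensity (fun X => ENNReal.ofReal (likRatio θ d X)) := by
  have hrow : ∀ j, Measure.pi (fun i => gaussianReal (θ j i + d j i) 1) =
      (Measure.pi fun i => gaussianReal (θ j i) 1).withDensity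
        (fun x => ∏ i, ENNReal.ofReal (Real.exp (d j i * (x i - θ j i) - d j i ^ 2 / 2))) := by
    intro j
    have h : ∀ i, SigmaFinite ((gaussianReal (θ j i) 1).withDensity
        (fun x => ENNReal.ofReal (Real.exp (d j i * (x - θ j i) - d j i ^ 2 / 2)))) := by
      intro i; rw [gaussianReal_shift]; infer_instance
    rw [← pi_withDensity (fun i => gaussianReal (θ j i) 1)
      (fun i x => ENNReal.ofReal (Real.exp (d j i * (x - θ j i) - d j i ^ 2 / 2)))
      (fun i => by fun_prop)]
    simp_rw [gaussianReal_shift]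
  have h : ∀ j, SigmaFinite ((Measure.pi fun i => gaussianReal (θ j i) 1).withDensity
      (fun x => ∏ i, ENNReal.ofReal (Real.exp (d j i * (x i - θ j i) - d j i ^ 2 / 2)))) := by
    intro j; rw [← hrow]; infer_instance
  have h2 := pi_withDensity (fun j => Measure.pi fun i => gaussianReal (θ j i) 1)
    (fun j x => ∏ i, ENNReal.ofReal (Real.exp (d j i * (x i - θ j i) - d j i ^ 2 / 2)))
    (fun j => by fun_prop)
  unfold obsLaw
  simp only [Pi.add_apply, hrow]
  rw [h2]
  congr 1
  ext X
  unfold likRatio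
  rw [ENNReal.ofReal_prod_of_nonneg
    (fun _ _ => Finset.prod_nonneg fun _ _ => (Real.exp_pos _).le)]
  refine Finset.prod_congr rfl fun j _ => ?_
  rw [ENNReal.ofReal_prod_of_nonneg (fun _ _ => (Real.exp_pos _).le)]

lemma integral_obsLaw_add {p n : ℕ} (θ d : Mat p n) (f : Mat p n → ℝ) :
    ∫ X, f X ∂obsLaw (θ + d) = ∫ X, f X * likRatio θ d X ∂obsLaw θ := by
  rw [obsLaw_add, integral_withDensity_eq_integral_toReal_smul
    (measurable_likRatio θ d).ennreal_ofReal (ae_of_all _ fun _ => ENNReal.ofReal_lt_top)]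
  simp [ENNReal.toReal_ofReal (likRatio_nonneg θ d _), mul_comm]

lemma integrable_likRatio {p n : ℕ} (θ d : Mat p n) : Integrable (likRatio θ d) (obsLaw θ) := by
  unfold likRatio obsLaw
  refine Integrable.fintype_prod_dep (f := fun j (x : Fin n → ℝ) =>
    ∏ i, Real.exp (d j i * (x i - θ j i) - d j i ^ 2 / 2)) fun j => ?_
  refine Integrable.fintype_prod_dep (f := fun i (x : ℝ) =>
    Real.exp (d j i * (x - θ j i) - d j i ^ 2 / 2)) fun i => ?_
  have := (integrable_exp_mul_gaussianReal (μ := θ j i) (v := 1) (d j i)).mul_const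
    (Real.exp (- d j i * θ j i - d j i ^ 2 / 2))
  refine this.congr (ae_of_all _ fun x => ?_)
  simp only
  rw [← Real.exp_add]; ring_nf

lemma integral_likRatio {p n : ℕ} (θ d : Mat p n) : ∫ X, likRatio θ d X ∂obsLaw θ = 1 := by
  have := integral_obsLaw_add θ d (fun _ => 1)
  simpa using this.symm

/-- The sum of the squares of the entries of a matrix. -/
def sqNorm {p n : ℕ} (d : Mat p n) : ℝ := ∑ j, ∑ i, d j i ^ 2

lemma likRatio_sq {p n : ℕ} (θ d X : Mat p n) :
    likRatio θ d X ^ 2 = Real.exp (sqNorm d) * likRatio θ (d + d) X := by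
  unfold likRatio sqNorm
  simp only [← Real.exp_sum, ← Real.exp_nat_mul, ← Real.exp_add]
  congr 1
  push_cast
  simp only [Finset.mul_sum, ← Finset.sum_add_distrib, Pi.add_apply]
  refine Finset.sum_congr rfl fun j _ => Finset.sum_congr rfl fun i _ => ?_
  ring

lemma integral_abs_le_sqrt {Ω : Type*} [MeasurableSpace Ω] {P : Measure Ω} [IsProbabilityMeasure P]
    {g : Ω → ℝ} (hg : Integrable g P) (hg2 : Integrable (fun x => g x ^ 2) P) :
    ∫ x, |g x| ∂P ≤ √(∫ x, g x ^ 2 ∂P) := by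
  refine Real.le_sqrt_of_sq_le ?_
  set I := ∫ x, |g x| ∂P
  have h : 0 ≤ ∫ x, (|g x| - I) ^ 2 ∂P := integral_nonneg fun _ => sq_nonneg _
  have h2 : (fun x => (|g x| - I) ^ 2) = fun x => g x ^ 2 - 2 * I * |g x| + I ^ 2 := by
    ext x; rw [← sq_abs (g x)]; ring
  have hi : Integrable (fun x => g x ^ 2 - 2 * I * |g x|) P := hg2.sub (hg.abs.const_mul _)
  rw [h2, integral_add hi (integrable_const _), integral_sub hg2 (hg.abs.const_mul _),
    integral_const_mul] at h
  simp only [integral_const, probReal_univ, smul_eq_mul, one_mul] at h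
  nlinarith

/-- Shifting the mean by `d` changes the expectation of a test by at most the square root of the
chi-square divergence. -/
lemma integral_obsLaw_add_ge {p n : ℕ} (θ d : Mat p n) (f : Mat p n → ℝ) (hf : Measurable f)
    (h0 : ∀ X, 0 ≤ f X) (h1 : ∀ X, f X ≤ 1) :
    ∫ X, f X ∂obsLaw θ - √(Real.exp (sqNorm d) - 1) ≤ ∫ X, f X ∂obsLaw (θ + d) := by
  have hL := integrable_likRatio θ d
  have hfi : Integrable f (obsLaw θ) :=
    Integrable.of_bound hf.aestronglyMeasurable 1
      (ae_of_all _ fun X => by rw [Real.norm_eq_abs, abs_le]; constructor <;> linarith [h0 X, h1 X])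
  have hfL : Integrable (fun X => f X * likRatio θ d X) (obsLaw θ) :=
    hL.bdd_mul (c := 1) hf.aestronglyMeasurable
      (ae_of_all _ fun X => by rw [Real.norm_eq_abs, abs_le]; constructor <;> linarith [h0 X, h1 X])
  have hsq : Integrable (fun X => (likRatio θ d X - 1) ^ 2) (obsLaw θ) := by
    have : (fun X => (likRatio θ d X - 1) ^ 2) = fun X =>
        Real.exp (sqNorm d) * likRatio θ (d + d) X - 2 * likRatio θ d X + 1 := by
      ext X; rw [← likRatio_sq]; ring
    rw [this]
    exact (((integrable_likRatio θ (d + d)).const_mul _).sub (hL.const_mul 2)).add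
      (integrable_const 1)
  have hsqv : ∫ X, (likRatio θ d X - 1) ^ 2 ∂obsLaw θ = Real.exp (sqNorm d) - 1 := by
    have : (fun X => (likRatio θ d X - 1) ^ 2) = fun X =>
        Real.exp (sqNorm d) * likRatio θ (d + d) X - 2 * likRatio θ d X + 1 := by
      ext X; rw [← likRatio_sq]; ring
    rw [this, integral_add, integral_sub, integral_const_mul, integral_const_mul,
      integral_likRatio, integral_likRatio]
    · simp; ring
    · exact (integrable_likRatio θ (d + d)).const_mul _
    · exact hL.const_mul 2
    · exact ((integrable_likRatio θ (d + d)).const_mul _).sub (hL.const_mul 2)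
    · exact integrable_const 1
  set D := Real.exp (sqNorm d) - 1
  have habs : Integrable (fun X => |likRatio θ d X - 1|) (obsLaw θ) :=
    (hL.sub (integrable_const 1)).abs
  have hI : ∫ X, |likRatio θ d X - 1| ∂obsLaw θ ≤ √D := by
    have := integral_abs_le_sqrt (hL.sub (integrable_const 1)) hsq
    simpa only [Pi.sub_apply, hsqv] using this
  rw [integral_obsLaw_add]
  have h3 : ∫ X, f X ∂obsLaw θ - ∫ X, f X * likRatio θ d X ∂obsLaw θ ≤
      ∫ X, |likRatio θ d X - 1| ∂obsLaw θ := by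
    rw [← integral_sub hfi hfL]
    refine integral_mono (hfi.sub hfL) habs fun X => ?_
    have : f X - f X * likRatio θ d X = f X * (1 - likRatio θ d X) := by ring
    simp only [this]
    calc f X * (1 - likRatio θ d X) ≤ f X * |likRatio θ d X - 1| := by
          gcongr
          · exact h0 X
          · rw [abs_sub_comm]; exact le_abs_self _
      _ ≤ 1 * |likRatio θ d X - 1| := by gcongr; exact h1 X
      _ = _ := one_mul _
  linarith

/-! ### Averages of independent likelihood ratios -/

/-- A weak law of large numbers in `L¹` for the average of `T` nonnegative, pairwise independent
variables of mean one with a bounded moment of order `1 + θ`: truncate at `M`, and apply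
Chebyshev to the truncated variables. -/
lemma integral_abs_average_sub_one_le {Ω : Type*} [MeasurableSpace Ω] {P : Measure Ω}
    [IsProbabilityMeasure P] {T : ℕ} (hT : 0 < T) {L : Fin T → Ω → ℝ}
    (hm : ∀ k, Measurable (L k)) (h0 : ∀ k x, 0 ≤ L k x) (hi : ∀ k, Integrable (L k) P)
    (h1 : ∀ k, ∫ x, L k x ∂P = 1) (hind : ∀ k l, k ≠ l → IndepFun (L k) (L l) P)
    {θ B M : ℝ} (hθ : 0 < θ) (hM : 0 < M)
    (hi2 : ∀ k, Integrable (fun x => L k x ^ (1 + θ)) P)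
    (hB : ∀ k, ∫ x, L k x ^ (1 + θ) ∂P ≤ B) :
    ∫ x, |1 / (T : ℝ) * ∑ k, L k x - 1| ∂P ≤ 2 * (M ^ (-θ) * B) + √(M / T) := by
  have hTr : (0 : ℝ) < T := by exact_mod_cast hT
  set U : Fin T → Ω → ℝ := fun k x => min (L k x) M with hU
  have hUm : ∀ k, Measurable (U k) := fun k => (hm k).min measurable_const
  have hU0 : ∀ k x, 0 ≤ U k x := fun k x => le_min (h0 k x) hM.le
  have hUM : ∀ k x, U k x ≤ M := fun k x => min_le_right _ _
  have hUL : ∀ k x, U k x ≤ L k x := fun k x => min_le_left _ _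
  have hUmem : ∀ k, MemLp (U k) 2 P := fun k =>
    MemLp.of_bound (hUm k).aestronglyMeasurable M (ae_of_all _ fun x => by
      rw [Real.norm_eq_abs, abs_of_nonneg (hU0 k x)]; exact hUM k x)
  have hUi : ∀ k, Integrable (U k) P := fun k => (hUmem k).integrable (by norm_num)
  have hcut : ∀ k, ∫ x, (L k x - U k x) ∂P ≤ M ^ (-θ) * B := by
    intro k
    calc ∫ x, (L k x - U k x) ∂P ≤ ∫ x, M ^ (-θ) * L k x ^ (1 + θ) ∂P := by
          refine integral_mono ((hi k).sub (hUi k)) ((hi2 k).const_mul _) fun x => ?_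
          simp only [hU]
          rcases le_or_gt (L k x) M with h | h
          · rw [min_eq_left h, sub_self]
            exact mul_nonneg (Real.rpow_nonneg hM.le _) (Real.rpow_nonneg (h0 k x) _)
          · have hL : 0 < L k x := hM.trans h
            rw [Real.rpow_add hL, Real.rpow_one]
            have h2 : 1 ≤ M ^ (-θ) * L k x ^ θ := by
              rw [Real.rpow_neg hM.le, ← div_eq_inv_mul, one_le_div (Real.rpow_pos_of_pos hM _)]
              exact Real.rpow_le_rpow hM.le h.le hθ.le
            have h3 : 0 ≤ min (L k x) M := hU0 k x
            nlinarith
      _ = M ^ (-θ) * ∫ x, L k x ^ (1 + θ) ∂P := integral_const_mul _ _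
      _ ≤ M ^ (-θ) * B := by
          have := hB k
          gcongr
  set m : ℝ := ∫ x, 1 / (T : ℝ) * ∑ k, U k x ∂P with hmdef
  have hmv : m = 1 / (T : ℝ) * ∑ k, ∫ x, U k x ∂P := by
    rw [hmdef, integral_const_mul, integral_finsetSum _ (fun k _ => hUi k)]
  have hm1 : m ≤ 1 ∧ 1 - m ≤ M ^ (-θ) * B := by
    have e : 1 - m = 1 / (T : ℝ) * ∑ k, ∫ x, (L k x - U k x) ∂P := by
      have h : ∀ k, ∫ x, (L k x - U k x) ∂P = 1 - ∫ x, U k x ∂P := fun k => by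
        rw [integral_sub (hi k) (hUi k), h1]
      simp only [h, Finset.sum_sub_distrib, hmv]
      simp only [Finset.sum_const, Finset.card_univ, Fintype.card_fin, nsmul_eq_mul, mul_one]
      field_simp
    have e0 : 0 ≤ 1 - m := by
      rw [e]
      exact mul_nonneg (by positivity) (Finset.sum_nonneg fun k _ =>
        integral_nonneg fun x => sub_nonneg.2 (hUL k x))
    refine ⟨by linarith, ?_⟩
    rw [e]
    calc 1 / (T : ℝ) * ∑ k, ∫ x, (L k x - U k x) ∂P
        ≤ 1 / (T : ℝ) * ∑ k : Fin T, M ^ (-θ) * B := by gcongr; exact hcut _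
      _ = M ^ (-θ) * B := by
        simp only [Finset.sum_const, Finset.card_univ, Fintype.card_fin, nsmul_eq_mul]
        field_simp
  have hSmem : MemLp (fun x => 1 / (T : ℝ) * ∑ k, U k x) 2 P :=
    (memLp_finsetSum _ fun k _ => hUmem k).const_mul _
  have hvar : ∫ x, (1 / (T : ℝ) * ∑ k, U k x - m) ^ 2 ∂P ≤ M / T := by
    have e1 : ∫ x, (1 / (T : ℝ) * ∑ k, U k x - m) ^ 2 ∂P =
        Var[fun x => 1 / (T : ℝ) * ∑ k, U k x; P] := by
      rw [variance_eq_integral hSmem.aestronglyMeasurable.aemeasurable]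
    have e2 : (fun x => ∑ k, U k x) = ∑ k, U k := by ext x; simp
    rw [e1, variance_const_mul, e2, IndepFun.variance_sum (fun k _ => hUmem k)]
    · have hv : ∀ k, Var[U k; P] ≤ M := by
        intro k
        refine (variance_le_expectation_sq (hUm k).aestronglyMeasurable).trans ?_
        calc ∫ x, (U k ^ 2) x ∂P ≤ ∫ x, M * L k x ∂P := by
              refine integral_mono (hUmem k).integrable_sq ((hi k).const_mul _) fun x => ?_
              simp only [Pi.pow_apply, sq]
              exact mul_le_mul (hUM k x) (hUL k x) (hU0 k x) hM.le
          _ = M := by rw [integral_const_mul, h1, mul_one]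
      calc (1 / (T : ℝ)) ^ 2 * ∑ k, Var[U k; P] ≤ (1 / (T : ℝ)) ^ 2 * ∑ k : Fin T, M := by
            gcongr; exact hv _
        _ = M / T := by
          simp only [Finset.sum_const, Finset.card_univ, Fintype.card_fin, nsmul_eq_mul]
          field_simp
    · intro k _ l _ hkl
      exact (hind k l hkl).comp (measurable_id.min measurable_const)
        (measurable_id.min measurable_const)
  have hSi : Integrable (fun x => 1 / (T : ℝ) * ∑ k, U k x) P := hSmem.integrable (by norm_num)
  have hLi : Integrable (fun x => 1 / (T : ℝ) * ∑ k, L k x) P :=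
    (integrable_finsetSum _ fun k _ => hi k).const_mul _
  have hfl : ∫ x, |1 / (T : ℝ) * ∑ k, U k x - m| ∂P ≤ √(M / T) := by
    have hs : MemLp (fun x => 1 / (T : ℝ) * ∑ k, U k x - m) 2 P := hSmem.sub (memLp_const m)
    exact (integral_abs_le_sqrt (hs.integrable (by norm_num)) hs.integrable_sq).trans
      (Real.sqrt_le_sqrt hvar)
  have hdiff : ∫ x, (1 / (T : ℝ) * ∑ k, L k x - 1 / (T : ℝ) * ∑ k, U k x) ∂P = 1 - m := by
    rw [integral_sub hLi hSi, ← hmdef, integral_const_mul,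
      integral_finsetSum _ (fun k _ => hi k)]
    simp only [h1, Finset.sum_const, Finset.card_univ, Fintype.card_fin, nsmul_eq_mul, mul_one]
    field_simp
  have habsi : Integrable (fun x => |1 / (T : ℝ) * ∑ k, U k x - m|) P :=
    (hSi.sub (integrable_const m)).abs
  have hdi : Integrable (fun x => 1 / (T : ℝ) * ∑ k, L k x - 1 / (T : ℝ) * ∑ k, U k x) P :=
    hLi.sub hSi
  have hsumi : Integrable (fun x => (1 / (T : ℝ) * ∑ k, L k x - 1 / (T : ℝ) * ∑ k, U k x) +
      |1 / (T : ℝ) * ∑ k, U k x - m|) P := hdi.add habsi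
  calc ∫ x, |1 / (T : ℝ) * ∑ k, L k x - 1| ∂P
      ≤ ∫ x, (((1 / (T : ℝ) * ∑ k, L k x - 1 / (T : ℝ) * ∑ k, U k x) +
          |1 / (T : ℝ) * ∑ k, U k x - m|) + (1 - m)) ∂P := by
        refine integral_mono (hLi.sub (integrable_const 1)).abs
          (hsumi.add (integrable_const _))
          fun x => ?_
        have hge : 1 / (T : ℝ) * ∑ k, U k x ≤ 1 / (T : ℝ) * ∑ k, L k x := by
          gcongr; exact hUL _ _
        simp only
        rw [abs_le]
        constructor <;>
        rcases abs_cases (1 / (T : ℝ) * ∑ k, U k x - m) with h | h <;> linarith [hm1.1]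
    _ = (1 - m) + ∫ x, |1 / (T : ℝ) * ∑ k, U k x - m| ∂P + (1 - m) := by
        rw [integral_add hsumi (integrable_const _), integral_add hdi habsi, hdiff]
        simp
    _ ≤ _ := by linarith [hm1.2]

/-! ### The likelihood ratio of a sparse mixture -/

/-- The likelihood ratio of the law of a row with mean `v` with respect to that of a centred
row. -/
def rowLik {n : ℕ} (v x : Fin n → ℝ) : ℝ := Real.exp (∑ i, (v i * x i - v i ^ 2 / 2))

/-- The law of a centred row. -/
def rowNull (n : ℕ) : Measure (Fin n → ℝ) := Measure.pi fun _ => gaussianReal 0 1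

instance (n : ℕ) : IsProbabilityMeasure (rowNull n) := by unfold rowNull; infer_instance

lemma measurable_rowLik {n : ℕ} (v : Fin n → ℝ) : Measurable (rowLik v) := by
  unfold rowLik; fun_prop

lemma rowLik_pos {n : ℕ} (v x : Fin n → ℝ) : 0 < rowLik v x := Real.exp_pos _

lemma integrable_rowLik {n : ℕ} (v : Fin n → ℝ) : Integrable (rowLik v) (rowNull n) := by
  unfold rowLik rowNull
  simp only [Real.exp_sum]
  refine Integrable.fintype_prod_dep (f := fun i (x : ℝ) =>
    Real.exp (v i * x - v i ^ 2 / 2)) fun i => ?_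
  simp only [Real.exp_sub]
  exact (integrable_exp_mul_gaussianReal _).div_const _

lemma integral_rowLik {n : ℕ} (v : Fin n → ℝ) : ∫ x, rowLik v x ∂rowNull n = 1 := by
  unfold rowLik rowNull
  simp only [Real.exp_sum]
  rw [integral_fintype_prod_eq_prod (fun i (x : ℝ) => Real.exp (v i * x - v i ^ 2 / 2))]
  refine Finset.prod_eq_one fun i _ => ?_
  simp only [Real.exp_sub]
  rw [integral_div]
  have := congrFun (mgf_fun_id_gaussianReal (μ := 0) (v := 1)) (v i)
  rw [mgf] at this
  rw [this]
  simp

lemma rowLik_rpow {n : ℕ} (v x : Fin n → ℝ) (c : ℝ) :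
    rowLik v x ^ c = Real.exp (c * (c - 1) * (∑ i, v i ^ 2) / 2) * rowLik (c • v) x := by
  unfold rowLik
  rw [← Real.exp_mul, ← Real.exp_add]
  congr 1
  rw [mul_div_assoc, Finset.sum_div, Finset.mul_sum, Finset.sum_mul, ← Finset.sum_add_distrib]
  refine Finset.sum_congr rfl fun i _ => ?_
  simp only [Pi.smul_apply, smul_eq_mul]
  ring

lemma integrable_rowLik_rpow {n : ℕ} (v : Fin n → ℝ) (c : ℝ) :
    Integrable (fun x => rowLik v x ^ c) (rowNull n) := by
  simp only [rowLik_rpow]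
  exact (integrable_rowLik _).const_mul _

lemma integral_rowLik_rpow {n : ℕ} (v : Fin n → ℝ) (c : ℝ) :
    ∫ x, rowLik v x ^ c ∂rowNull n = Real.exp (c * (c - 1) * (∑ i, v i ^ 2) / 2) := by
  simp only [rowLik_rpow]
  rw [integral_const_mul, integral_rowLik, mul_one]

/-- The likelihood ratio of a row whose mean is `v` with probability `ε`, and zero otherwise. -/
def rowMix {n : ℕ} (ε : ℝ) (v x : Fin n → ℝ) : ℝ := (1 - ε) + ε * rowLik v x

lemma measurable_rowMix {n : ℕ} (ε : ℝ) (v : Fin n → ℝ) : Measurable (rowMix ε v) := by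
  unfold rowMix; have := measurable_rowLik v; fun_prop

lemma rowMix_nonneg {n : ℕ} {ε : ℝ} (hε : ε ∈ Set.Icc (0 : ℝ) 1) (v x : Fin n → ℝ) :
    0 ≤ rowMix ε v x := by
  unfold rowMix
  have := mul_nonneg hε.1 (rowLik_pos v x).le
  linarith [hε.2]

lemma integrable_rowMix {n : ℕ} (ε : ℝ) (v : Fin n → ℝ) : Integrable (rowMix ε v) (rowNull n) :=
  (integrable_const _).add ((integrable_rowLik v).const_mul _)

lemma integral_rowMix {n : ℕ} (ε : ℝ) (v : Fin n → ℝ) : ∫ x, rowMix ε v x ∂rowNull n = 1 := by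
  unfold rowMix
  rw [integral_add (integrable_const _) ((integrable_rowLik v).const_mul _), integral_const_mul,
    integral_rowLik]
  simp

lemma one_add_rpow_le {θ x : ℝ} (hθ : 0 < θ) (hθ1 : θ ≤ 1) (hx : -1 ≤ x) :
    (1 + x) ^ (1 + θ) ≤ 1 + (1 + θ) * x + |x| ^ (1 + θ) := by
  have hb : (1 + x) ^ θ ≤ 1 + θ * x := rpow_one_add_le_one_add_mul_self hx hθ.le hθ1
  have hspl : ∀ y : ℝ, 0 ≤ y → y ^ (1 + θ) = y * y ^ θ := fun y hy => by
    rw [Real.rpow_add' hy (by linarith), Real.rpow_one]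
  rw [hspl _ (by linarith), hspl _ (abs_nonneg x)]
  rcases le_or_gt 0 x with h | h
  · rw [abs_of_nonneg h]
    have := Real.rpow_add_le_add_rpow (zero_le_one) h hθ.le hθ1
    rw [Real.one_rpow] at this
    nlinarith
  · rw [abs_of_neg h]
    have := Real.rpow_add_le_add_rpow (show 0 ≤ 1 + x by linarith) (show 0 ≤ -x by linarith)
      hθ.le hθ1
    rw [show 1 + x + -x = 1 by ring, Real.one_rpow] at this
    nlinarith

lemma rowMix_rpow_le {n : ℕ} {ε θ : ℝ} (hε : ε ∈ Set.Icc (0 : ℝ) 1) (hθ : 0 < θ) (hθ1 : θ ≤ 1)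
    (v x : Fin n → ℝ) :
    rowMix ε v x ^ (1 + θ) ≤ 1 + (1 + θ) * (ε * (rowLik v x - 1)) +
      ε ^ (1 + θ) * (rowLik v x ^ (1 + θ) + 1) := by
  have hw := rowLik_pos v x
  have e : rowMix ε v x = 1 + ε * (rowLik v x - 1) := by unfold rowMix; ring
  rw [e]
  refine (one_add_rpow_le hθ hθ1 ?_).trans ?_
  · have := rowMix_nonneg hε v x
    linarith
  · gcongr
    rw [abs_mul, abs_of_nonneg hε.1, Real.mul_rpow hε.1 (abs_nonneg _)]
    refine mul_le_mul_of_nonneg_left ?_ (Real.rpow_nonneg hε.1 _)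
    rcases le_total (rowLik v x) 1 with h | h
    · have : |rowLik v x - 1| ^ (1 + θ) ≤ 1 :=
        Real.rpow_le_one (abs_nonneg _) (abs_le.2 ⟨by linarith, by linarith⟩) (by linarith)
      have := Real.rpow_nonneg hw.le (1 + θ)
      linarith
    · have : |rowLik v x - 1| ^ (1 + θ) ≤ rowLik v x ^ (1 + θ) :=
        Real.rpow_le_rpow (abs_nonneg _) (abs_le.2 ⟨by linarith, by linarith⟩) (by linarith)
      linarith

lemma integrable_rowMix_rpow {n : ℕ} {ε θ : ℝ} (hε : ε ∈ Set.Icc (0 : ℝ) 1) (hθ : 0 < θ)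
    (hθ1 : θ ≤ 1) (v : Fin n → ℝ) :
    Integrable (fun x => rowMix ε v x ^ (1 + θ)) (rowNull n) := by
  have h : Integrable (fun x => 1 + (1 + θ) * (ε * (rowLik v x - 1)) +
      ε ^ (1 + θ) * (rowLik v x ^ (1 + θ) + 1)) (rowNull n) :=
    ((integrable_const _).add ((((integrable_rowLik v).sub (integrable_const 1)).const_mul
      _).const_mul _)).add (((integrable_rowLik_rpow v _).add (integrable_const _)).const_mul _)
  refine h.mono' ((measurable_rowMix ε v).pow_const _).aestronglyMeasurable
    (ae_of_all _ fun x => ?_)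
  rw [Real.norm_eq_abs, abs_of_nonneg (Real.rpow_nonneg (rowMix_nonneg hε v x) _)]
  exact rowMix_rpow_le hε hθ hθ1 v x

lemma integral_rowMix_rpow_le {n : ℕ} {ε θ ρ : ℝ} (hε : ε ∈ Set.Icc (0 : ℝ) 1) (hθ : 0 < θ)
    (hθ1 : θ ≤ 1) (v : Fin n → ℝ) (hv : ∑ i, v i ^ 2 ≤ ρ ^ 2) :
    ∫ x, rowMix ε v x ^ (1 + θ) ∂rowNull n ≤
      1 + 2 * ε ^ (1 + θ) * Real.exp (θ * (1 + θ) * ρ ^ 2 / 2) := by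
  have hi1 : Integrable (fun x => (1 + θ) * (ε * (rowLik v x - 1))) (rowNull n) :=
    (((integrable_rowLik v).sub (integrable_const 1)).const_mul _).const_mul _
  have hi2 : Integrable (fun x => ε ^ (1 + θ) * (rowLik v x ^ (1 + θ) + 1)) (rowNull n) :=
    ((integrable_rowLik_rpow v _).add (integrable_const _)).const_mul _
  have hi3 : Integrable (fun x => 1 + (1 + θ) * (ε * (rowLik v x - 1))) (rowNull n) :=
    (integrable_const _).add hi1
  calc ∫ x, rowMix ε v x ^ (1 + θ) ∂rowNull n
      ≤ ∫ x, (1 + (1 + θ) * (ε * (rowLik v x - 1)) +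
          ε ^ (1 + θ) * (rowLik v x ^ (1 + θ) + 1)) ∂rowNull n :=
        integral_mono (integrable_rowMix_rpow hε hθ hθ1 v)
          (hi3.add hi2) (rowMix_rpow_le hε hθ hθ1 v)
    _ = 1 + ε ^ (1 + θ) * (Real.exp ((1 + θ) * (1 + θ - 1) * (∑ i, v i ^ 2) / 2) + 1) := by
        rw [integral_add hi3 hi2, integral_add (integrable_const _) hi1,
          integral_const_mul, integral_const_mul, integral_const_mul,
          integral_sub (integrable_rowLik v) (integrable_const 1), integral_rowLik,
          integral_add (integrable_rowLik_rpow v _) (integrable_const _), integral_rowLik_rpow]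
        simp
    _ ≤ 1 + ε ^ (1 + θ) * (Real.exp (θ * (1 + θ) * ρ ^ 2 / 2) +
          Real.exp (θ * (1 + θ) * ρ ^ 2 / 2)) := by
        have hp := Real.rpow_nonneg hε.1 (1 + θ)
        rw [show (1 + θ) * (1 + θ - 1) = θ * (1 + θ) by ring]
        have h1 : 1 ≤ Real.exp (θ * (1 + θ) * ρ ^ 2 / 2) := Real.one_le_exp (by positivity)
        have h2 : Real.exp (θ * (1 + θ) * (∑ i, v i ^ 2) / 2) ≤
            Real.exp (θ * (1 + θ) * ρ ^ 2 / 2) := by gcongr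
        gcongr
    _ = _ := by ring

lemma integral_rowMix_sq_le {n : ℕ} {ε ρ : ℝ} (v : Fin n → ℝ)
    (hv : ∑ i, v i ^ 2 ≤ ρ ^ 2) :
    ∫ x, rowMix ε v x ^ (1 + (1 : ℝ)) ∂rowNull n ≤ 1 + ε ^ 2 * (Real.exp (ρ ^ 2) - 1) := by
  have e : ∀ x, rowMix ε v x ^ (1 + (1 : ℝ)) =
      (1 - ε) ^ 2 + 2 * (1 - ε) * ε * rowLik v x + ε ^ 2 * rowLik v x ^ (2 : ℝ) := by
    intro x
    rw [show (1 : ℝ) + 1 = (2 : ℕ) by norm_num, Real.rpow_natCast,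
      show (2 : ℝ) = (2 : ℕ) by norm_num, Real.rpow_natCast]
    unfold rowMix; push_cast; ring
  simp only [e]
  have hi : Integrable (fun x => (1 - ε) ^ 2 + 2 * (1 - ε) * ε * rowLik v x) (rowNull n) :=
    (integrable_const _).add ((integrable_rowLik v).const_mul _)
  rw [integral_add hi
      ((integrable_rowLik_rpow v _).const_mul _), integral_add (integrable_const _)
      ((integrable_rowLik v).const_mul _), integral_const_mul, integral_const_mul,
      integral_rowLik, integral_rowLik_rpow]
  have h : Real.exp (2 * (2 - 1) * (∑ i, v i ^ 2) / 2) ≤ Real.exp (ρ ^ 2) := by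
    apply Real.exp_le_exp.2; linarith
  have := mul_le_mul_of_nonneg_left h (sq_nonneg ε)
  simp only [integral_const, probReal_univ, smul_eq_mul, one_mul]
  linarith

/-- The likelihood ratio, with respect to a centred observation, of the law under which each row
independently has mean `v` with probability `ε`, and mean zero otherwise. -/
def mixLik {p n : ℕ} (ε : ℝ) (v : Fin n → ℝ) (X : Mat p n) : ℝ := ∏ j, rowMix ε v (X j)

lemma obsLaw_zero (p n : ℕ) : obsLaw (0 : Mat p n) = Measure.pi fun _ => rowNull n := rfl

lemma measurable_mixLik {p n : ℕ} (ε : ℝ) (v : Fin n → ℝ) :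
    Measurable (mixLik ε v : Mat p n → ℝ) := by
  unfold mixLik; have := measurable_rowMix ε v; fun_prop

lemma mixLik_nonneg {p n : ℕ} {ε : ℝ} (hε : ε ∈ Set.Icc (0 : ℝ) 1) (v : Fin n → ℝ)
    (X : Mat p n) : 0 ≤ mixLik ε v X :=
  Finset.prod_nonneg fun j _ => rowMix_nonneg hε v (X j)

lemma integrable_mixLik {p n : ℕ} (ε : ℝ) (v : Fin n → ℝ) :
    Integrable (mixLik ε v) (obsLaw (0 : Mat p n)) := by
  rw [obsLaw_zero]
  exact Integrable.fintype_prod_dep (f := fun _ => rowMix ε v) fun _ => integrable_rowMix ε v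

lemma integral_mixLik {p n : ℕ} (ε : ℝ) (v : Fin n → ℝ) :
    ∫ X, mixLik ε v X ∂obsLaw (0 : Mat p n) = 1 := by
  rw [obsLaw_zero]
  unfold mixLik
  rw [integral_fintype_prod_eq_prod (fun _ => rowMix ε v)]
  simp [integral_rowMix]

lemma mixLik_rpow {p n : ℕ} {ε : ℝ} (hε : ε ∈ Set.Icc (0 : ℝ) 1) (v : Fin n → ℝ) (c : ℝ)
    (X : Mat p n) : mixLik ε v X ^ c = ∏ j, rowMix ε v (X j) ^ c :=
  (Real.finsetProd_rpow _ _ (fun j _ => rowMix_nonneg hε v (X j)) _).symm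

lemma integrable_mixLik_rpow {p n : ℕ} {ε θ : ℝ} (hε : ε ∈ Set.Icc (0 : ℝ) 1) (hθ : 0 < θ)
    (hθ1 : θ ≤ 1) (v : Fin n → ℝ) :
    Integrable (fun X => mixLik ε v X ^ (1 + θ)) (obsLaw (0 : Mat p n)) := by
  simp only [mixLik_rpow hε]
  rw [obsLaw_zero]
  exact Integrable.fintype_prod_dep (f := fun _ x => rowMix ε v x ^ (1 + θ))
    fun _ => integrable_rowMix_rpow hε hθ hθ1 v

lemma integral_mixLik_rpow_le {p n : ℕ} {ε c G : ℝ} (hε : ε ∈ Set.Icc (0 : ℝ) 1) (v : Fin n → ℝ)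
    (hG : ∫ x, rowMix ε v x ^ c ∂rowNull n ≤ G) :
    ∫ X, mixLik ε v X ^ c ∂obsLaw (0 : Mat p n) ≤ G ^ p := by
  simp only [mixLik_rpow hε]
  rw [obsLaw_zero, integral_fintype_prod_eq_prod (fun _ x => rowMix ε v x ^ c)]
  rw [Finset.prod_const, Finset.card_univ, Fintype.card_fin]
  exact pow_le_pow_left₀
    (integral_nonneg fun x => Real.rpow_nonneg (rowMix_nonneg hε v x) _) hG p

/-- Under a centred observation all the entries are jointly independent, so mixture likelihood
ratios in directions with disjoint supports are independent. -/
lemma indepFun_mixLik {p n : ℕ} (ε : ℝ) (v w : Fin n → ℝ) (hvw : ∀ i, v i = 0 ∨ w i = 0) :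
    IndepFun (mixLik ε v) (mixLik ε w) (obsLaw (0 : Mat p n)) := by
  have hind : iIndepFun (fun (q : Fin p × Fin n) (X : Mat p n) => X q.1 q.2)
      (obsLaw (0 : Mat p n)) := by
    have := iIndepFun_uncurry_infinitePi' (X := fun (_ : Fin p) (_ : Fin n) (x : ℝ) => x)
      (fun (_ : Fin p) (_ : Fin n) => gaussianReal 0 1) (fun _ _ => measurable_id)
    simp only [Measure.infinitePi_eq_pi] at this
    exact this
  have key : ∀ u : Fin n → ℝ, ∀ S : Finset (Fin p × Fin n), (∀ q, q ∈ S ↔ u q.2 ≠ 0) →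
      ∃ φ : (S → ℝ) → ℝ, Measurable φ ∧
        (mixLik ε u : Mat p n → ℝ) = φ ∘ fun X (q : S) => X q.1.1 q.1.2 := by
    intro u S hS
    refine ⟨fun y => ∏ j, ((1 - ε) + ε * Real.exp (∑ i, if h : (j, i) ∈ S then
      u i * y ⟨(j, i), h⟩ - u i ^ 2 / 2 else 0)), ?_, ?_⟩
    · refine Finset.measurable_prod _ fun j _ => measurable_const.add (measurable_const.mul
        (Real.measurable_exp.comp (Finset.measurable_sum _ fun i _ => ?_)))
      split_ifs with h
      · fun_prop
      · fun_prop
    · ext X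
      simp only [mixLik, rowMix, rowLik, Function.comp]
      refine Finset.prod_congr rfl fun j _ => ?_
      congr 3
      refine Finset.sum_congr rfl fun i _ => ?_
      split_ifs with h
      · rfl
      · have : u i = 0 := by
          by_contra h0
          exact h ((hS (j, i)).2 h0)
        simp [this]
  classical
  obtain ⟨φ, hφ, eφ⟩ := key v (Finset.univ.filter fun q => v q.2 ≠ 0) (by simp)
  obtain ⟨χ, hχ, eχ⟩ := key w (Finset.univ.filter fun q => w q.2 ≠ 0) (by simp)
  rw [eφ, eχ]
  refine (hind.indepFun_finset _ _ ?_ fun q => by fun_prop).comp hφ hχ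
  rw [Finset.disjoint_left]
  intro q hq hq'
  simp only [Finset.mem_filter, Finset.mem_univ, true_and] at hq hq'
  rcases hvw q.2 with h | h
  · exact hq h
  · exact hq' h

/-- The mean matrix whose rows in `S` equal `v` and whose other rows vanish. -/
def sparseMean {p n : ℕ} (S : Finset (Fin p)) (v : Fin n → ℝ) : Mat p n :=
  fun j i => if j ∈ S then v i else 0

/-- The probability that a random subset which contains each of the `p` indices independently
with probability `ε` equals `S`. -/
def subsetWeight {p : ℕ} (ε : ℝ) (S : Finset (Fin p)) : ℝ :=
  (∏ _j ∈ S, ε) * ∏ _j ∈ Finset.univ \ S, (1 - ε)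

lemma subsetWeight_nonneg {p : ℕ} {ε : ℝ} (hε : ε ∈ Set.Icc (0 : ℝ) 1) (S : Finset (Fin p)) :
    0 ≤ subsetWeight ε S :=
  mul_nonneg (Finset.prod_nonneg fun _ _ => hε.1)
    (Finset.prod_nonneg fun _ _ => by linarith [hε.2])

lemma sum_subsetWeight {p : ℕ} (ε : ℝ) :
    ∑ S ∈ (Finset.univ : Finset (Fin p)).powerset, subsetWeight ε S = 1 := by
  unfold subsetWeight
  rw [← Finset.prod_add]
  simp

/-- A Chernoff bound for the lower tail of the binomial distribution. -/
lemma sum_subsetWeight_card_lt_le {p : ℕ} {ε : ℝ} (hε : ε ∈ Set.Icc (0 : ℝ) 1) (s : ℕ) :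
    ∑ S ∈ (Finset.univ : Finset (Fin p)).powerset with S.card < s, subsetWeight ε S ≤
      Real.exp (s - p * ε / 2) := by
  set x := Real.exp (-1) with hx
  have hx0 : 0 < x := Real.exp_pos _
  have hx2 : x ≤ 1 / 2 := by
    rw [hx, Real.exp_neg, inv_le_comm₀ (Real.exp_pos _) (by norm_num)]
    have := Real.add_one_le_exp (1 : ℝ)
    norm_num at this ⊢
    exact this
  calc ∑ S ∈ (Finset.univ : Finset (Fin p)).powerset with S.card < s, subsetWeight ε S
      ≤ ∑ S ∈ (Finset.univ : Finset (Fin p)).powerset with S.card < s,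
          Real.exp s * ((∏ _j ∈ S, ε * x) * ∏ _j ∈ Finset.univ \ S, (1 - ε)) := by
        refine Finset.sum_le_sum fun S hS => ?_
        have hc : S.card < s := (Finset.mem_filter.1 hS).2
        have hw := subsetWeight_nonneg hε S
        have h1 : 1 ≤ Real.exp s * x ^ S.card := by
          rw [hx, ← Real.exp_nat_mul, ← Real.exp_add]
          apply Real.one_le_exp
          have : (S.card : ℝ) ≤ s := by exact_mod_cast hc.le
          linarith
        calc subsetWeight ε S ≤ (Real.exp s * x ^ S.card) * subsetWeight ε S :=
              le_mul_of_one_le_left hw h1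
          _ = _ := by
              unfold subsetWeight
              rw [Finset.prod_mul_distrib (s := S) (f := fun _ => ε) (g := fun _ => x),
                Finset.prod_const x]
              ring
    _ ≤ ∑ S ∈ (Finset.univ : Finset (Fin p)).powerset,
          Real.exp s * ((∏ _j ∈ S, ε * x) * ∏ _j ∈ Finset.univ \ S, (1 - ε)) := by
        refine Finset.sum_le_sum_of_subset_of_nonneg (Finset.filter_subset _ _) fun S _ _ => ?_
        have h1 : 0 ≤ 1 - ε := by linarith [hε.2]
        have h2 := hε.1
        positivity
    _ = Real.exp s * (ε * x + (1 - ε)) ^ p := by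
        rw [← Finset.mul_sum, ← Finset.prod_add]
        simp
    _ ≤ Real.exp s * Real.exp (-(ε / 2)) ^ p := by
        have h1 : 0 ≤ 1 - ε := by linarith [hε.2]
        have h2 := hε.1
        gcongr
        have := Real.add_one_le_exp (-(ε / 2))
        nlinarith
    _ = _ := by
        rw [← Real.exp_nat_mul, ← Real.exp_add]; congr 1; ring

lemma mixLik_eq_sum {p n : ℕ} (ε : ℝ) (v : Fin n → ℝ) (X : Mat p n) :
    mixLik ε v X = ∑ S ∈ (Finset.univ : Finset (Fin p)).powerset,
      subsetWeight ε S * likRatio 0 (sparseMean S v) X := by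
  unfold mixLik rowMix
  simp only [add_comm (1 - ε)]
  rw [Finset.prod_add]
  refine Finset.sum_congr rfl fun S hS => ?_
  unfold subsetWeight
  rw [Finset.prod_mul_distrib]
  have : likRatio 0 (sparseMean S v) X = ∏ j ∈ S, rowLik v (X j) := by
    unfold likRatio sparseMean rowLik
    rw [← Finset.prod_subset (Finset.subset_univ S)]
    · refine Finset.prod_congr rfl fun j hj => ?_
      rw [Real.exp_sum]
      simp [hj]
    · intro j _ hj
      simp [hj]
  rw [this]
  ring

lemma integral_mul_mixLik {p n : ℕ} (ε : ℝ) (v : Fin n → ℝ) (f : Mat p n → ℝ) (hf : Measurable f)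
    (h0 : ∀ X, 0 ≤ f X) (h1 : ∀ X, f X ≤ 1) :
    ∫ X, f X * mixLik ε v X ∂obsLaw (0 : Mat p n) =
      ∑ S ∈ (Finset.univ : Finset (Fin p)).powerset,
        subsetWeight ε S * ∫ X, f X ∂obsLaw (sparseMean S v) := by
  simp only [mixLik_eq_sum, Finset.mul_sum]
  rw [integral_finsetSum]
  · refine Finset.sum_congr rfl fun S _ => ?_
    have := integral_obsLaw_add (0 : Mat p n) (sparseMean S v) f
    rw [zero_add] at this
    rw [this, ← integral_const_mul]
    congr 1; ext X; ring
  · intro S _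
    have : Integrable (fun X => f X * likRatio 0 (sparseMean S v) X) (obsLaw (0 : Mat p n)) :=
      (integrable_likRatio _ _).bdd_mul (c := 1) hf.aestronglyMeasurable
        (ae_of_all _ fun X => by
          rw [Real.norm_eq_abs, abs_le]; constructor <;> linarith [h0 X, h1 X])
    refine (this.const_mul (subsetWeight ε S)).congr (ae_of_all _ fun X => ?_)
    simp only; ring

/-! ### A lower bound for the minimax error -/

lemma integral_mem_Icc {Ω : Type*} [MeasurableSpace Ω] {P : Measure Ω} [IsProbabilityMeasure P]
    {f : Ω → ℝ} (h0 : ∀ X, 0 ≤ f X) (h1 : ∀ X, f X ≤ 1) :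
    ∫ X, f X ∂P ∈ Set.Icc (0 : ℝ) 1 := by
  refine ⟨integral_nonneg h0, ?_⟩
  calc ∫ X, f X ∂P ≤ ∫ _, (1 : ℝ) ∂P :=
        integral_mono_of_nonneg (ae_of_all _ h0) (integrable_const 1) (ae_of_all _ h1)
    _ = 1 := by simp

lemma IsTest.nonneg {p n : ℕ} {ψ : Mat p n → ℝ} (h : IsTest ψ) (X : Mat p n) : 0 ≤ ψ X := by
  rcases h.2 X with h | h <;> rw [h]; exact zero_le_one

lemma IsTest.le_one {p n : ℕ} {ψ : Mat p n → ℝ} (h : IsTest ψ) (X : Mat p n) : ψ X ≤ 1 := by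
  rcases h.2 X with h | h <;> rw [h]; exact zero_le_one

lemma sup_null_ge {p n : ℕ} {ψ : Mat p n → ℝ} (h : IsTest ψ) :
    ∫ X, ψ X ∂obsLaw (0 : Mat p n) ≤ ⨆ θ : nullSpace p n, ∫ X, ψ X ∂obsLaw θ.1 :=
  le_ciSup (f := fun θ : nullSpace p n => ∫ X, ψ X ∂obsLaw θ.1)
    ⟨1, by rintro _ ⟨θ, rfl⟩; exact (integral_mem_Icc h.nonneg h.le_one).2⟩
    ⟨0, fun _ => 0, fun _ _ => rfl⟩

lemma sup_alt_ge {p n : ℕ} {ψ : Mat p n → ℝ} (h : IsTest ψ) {ρ : ℝ} {s : ℕ} {θ : Mat p n}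
    (hθ : θ ∈ altSpace p n ρ s) :
    ∫ X, (1 - ψ X) ∂obsLaw θ ≤ ⨆ θ : altSpace p n ρ s, ∫ X, (1 - ψ X) ∂obsLaw θ.1 :=
  le_ciSup (f := fun θ : altSpace p n ρ s => ∫ X, (1 - ψ X) ∂obsLaw θ.1)
    ⟨1, by
      rintro _ ⟨θ, rfl⟩
      exact (integral_mem_Icc (fun X => by linarith [h.le_one X])
        (fun X => by linarith [h.nonneg X])).2⟩ ⟨θ, hθ⟩

lemma worstCaseError_nonneg {p n : ℕ} {ψ : Mat p n → ℝ} (h : IsTest ψ) (ρ : ℝ) (s : ℕ) :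
    0 ≤ worstCaseError ψ ρ s :=
  add_nonneg (Real.iSup_nonneg fun _ => integral_nonneg h.nonneg)
    (Real.iSup_nonneg fun _ => integral_nonneg fun X => by
      simp only [Pi.zero_apply]; linarith [h.le_one X])

/-- The level of the step placed at the changepoint `R ^ (k + 1)`, of normalised size `ρ`. -/
def stepLevel (n R : ℕ) (ρ : ℝ) (k : ℕ) : ℝ :=
  ρ / √(((R ^ (k + 1) : ℕ) : ℝ) * ((n : ℝ) - (R ^ (k + 1) : ℕ)) / n)

/-- The step of height `stepLevel n R ρ k` with changepoint `R ^ (k + 1)`. -/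
def step (n R : ℕ) (ρ : ℝ) (k : ℕ) : Fin n → ℝ :=
  fun i => if (i : ℕ) < R ^ (k + 1) then stepLevel n R ρ k else 0

/-- The step with changepoint `R ^ (k + 1)`, with its first `R ^ k` entries deleted. For large `R`
this deletes a small part of the Euclidean norm, and the supports for different `k` are
disjoint. -/
def block (n R : ℕ) (ρ : ℝ) (k : ℕ) : Fin n → ℝ :=
  fun i => if R ^ k ≤ (i : ℕ) ∧ (i : ℕ) < R ^ (k + 1) then stepLevel n R ρ k else 0

lemma sum_interval_sq {n u w : ℕ} (hw : w ≤ n) (huw : u ≤ w) (c : ℝ) :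
    ∑ i : Fin n, (if u ≤ (i : ℕ) ∧ (i : ℕ) < w then c else 0) ^ 2 = (w - u) * c ^ 2 := by
  rw [Fin.sum_univ_eq_sum_range (fun i => (if u ≤ i ∧ i < w then c else 0) ^ 2) n]
  have : ∀ i, (if u ≤ i ∧ i < w then c else 0) ^ 2 = if u ≤ i ∧ i < w then c ^ 2 else 0 := by
    intro i; split_ifs <;> simp
  simp only [this]
  rw [← Finset.sum_filter]
  have e : (Finset.range n).filter (fun i => u ≤ i ∧ i < w) = Finset.Ico u w := by
    ext i; simp only [Finset.mem_filter, Finset.mem_range, Finset.mem_Ico]; omega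
  rw [e, Finset.sum_const, Nat.card_Ico, nsmul_eq_mul, Nat.cast_sub huw]

lemma stepLevel_sq {n R k : ℕ} (hR : 2 ≤ R) (hn : R ^ (k + 2) ≤ n) (ρ : ℝ) :
    stepLevel n R ρ k ^ 2 * (R ^ (k + 1) : ℕ) = ρ ^ 2 * (n / (n - (R ^ (k + 1) : ℕ))) ∧
      (R : ℝ) * (R ^ (k + 1) : ℕ) ≤ n ∧ (0 : ℝ) < (R ^ (k + 1) : ℕ) := by
  have hRr : (2 : ℝ) ≤ R := by exact_mod_cast hR
  have ht : (0 : ℝ) < (R ^ (k + 1) : ℕ) := by positivity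
  have h1 : (R : ℝ) * (R ^ (k + 1) : ℕ) ≤ n := by
    have : R * R ^ (k + 1) ≤ n := by rw [← pow_succ']; exact hn
    exact_mod_cast this
  have h2 : (0 : ℝ) < n - (R ^ (k + 1) : ℕ) := by nlinarith
  have h3 : (0 : ℝ) < n := by linarith
  refine ⟨?_, h1, ht⟩
  unfold stepLevel
  rw [div_pow, Real.sq_sqrt (by positivity)]
  field_simp

lemma sum_block_sq_le {n R k : ℕ} (hR : 2 ≤ R) (hn : R ^ (k + 2) ≤ n) (ρ : ℝ) :
    ∑ i, block n R ρ k i ^ 2 ≤ ρ ^ 2 := by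
  obtain ⟨h1, h2, h3⟩ := stepLevel_sq hR hn ρ
  have hRr : (2 : ℝ) ≤ R := by exact_mod_cast hR
  have h4 : (0 : ℝ) < n - (R ^ (k + 1) : ℕ) := by nlinarith
  have hle : R ^ (k + 1) ≤ n := (Nat.pow_le_pow_right (by omega) (by omega)).trans hn
  unfold block
  rw [sum_interval_sq hle (Nat.pow_le_pow_right (by omega) (by omega))]
  have e : ((R ^ (k + 1) : ℕ) : ℝ) - (R ^ k : ℕ) = (R ^ (k + 1) : ℕ) * (1 - 1 / R) := by
    push_cast; rw [pow_succ]; field_simp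
  rw [e, show ((R ^ (k + 1) : ℕ) : ℝ) * (1 - 1 / R) * stepLevel n R ρ k ^ 2 =
    stepLevel n R ρ k ^ 2 * (R ^ (k + 1) : ℕ) * (1 - 1 / R) by ring, h1, mul_assoc]
  refine mul_le_of_le_one_right (sq_nonneg _) ?_
  rw [div_mul_eq_mul_div, div_le_one h4, mul_sub, mul_one, mul_one_div, sub_le_sub_iff_left,
    le_div_iff₀ (by positivity)]
  linarith

lemma sqNorm_step_sub_block_le {p n R k : ℕ} (hR : 2 ≤ R) (hn : R ^ (k + 2) ≤ n) (ρ : ℝ)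
    (S : Finset (Fin p)) :
    sqNorm (sparseMean S (step n R ρ k - block n R ρ k)) ≤ p * (2 * ρ ^ 2 / R) := by
  obtain ⟨h1, h2, h3⟩ := stepLevel_sq hR hn ρ
  have hRr : (2 : ℝ) ≤ R := by exact_mod_cast hR
  have h4 : (0 : ℝ) < n - (R ^ (k + 1) : ℕ) := by nlinarith
  have hle : R ^ k ≤ n := (Nat.pow_le_pow_right (by omega) (by omega)).trans hn
  have hrow : ∑ i, (step n R ρ k - block n R ρ k) i ^ 2 ≤ 2 * ρ ^ 2 / R := by
    have e : ∀ i : Fin n, (step n R ρ k - block n R ρ k) i =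
        if 0 ≤ (i : ℕ) ∧ (i : ℕ) < R ^ k then stepLevel n R ρ k else 0 := by
      intro i
      have : R ^ k ≤ R ^ (k + 1) := Nat.pow_le_pow_right (by omega) (by omega)
      simp only [Pi.sub_apply, step, block]
      split_ifs <;> first | omega | simp
    simp only [e]
    rw [sum_interval_sq hle (Nat.zero_le _)]
    have e2 : ((R ^ k : ℕ) : ℝ) - (0 : ℕ) = (R ^ (k + 1) : ℕ) / R := by
      push_cast; rw [pow_succ]; field_simp; ring
    rw [e2, show ((R ^ (k + 1) : ℕ) : ℝ) / R * stepLevel n R ρ k ^ 2 =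
      stepLevel n R ρ k ^ 2 * (R ^ (k + 1) : ℕ) / R by ring, h1]
    refine div_le_div_of_nonneg_right ?_ (by positivity)
    rw [mul_comm]
    refine mul_le_mul_of_nonneg_right ?_ (sq_nonneg _)
    rw [div_le_iff₀ h4]
    nlinarith
  unfold sqNorm
  calc ∑ j, ∑ i, sparseMean S (step n R ρ k - block n R ρ k) j i ^ 2
      ≤ ∑ _j : Fin p, 2 * ρ ^ 2 / R := by
        refine Finset.sum_le_sum fun j _ => ?_
        by_cases hj : j ∈ S
        · simpa [sparseMean, hj] using hrow
        · simp only [sparseMean, hj, if_false]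
          simp only [ne_eq, OfNat.ofNat_ne_zero, not_false_eq_true, zero_pow,
            Finset.sum_const_zero]
          positivity
    _ = _ := by simp

lemma sparseMean_step_mem_altSpace {p n R k : ℕ} (hR : 2 ≤ R) (hn : R ^ (k + 2) ≤ n) {ρ : ℝ}
    {s : ℕ} {S : Finset (Fin p)} (hS : s ≤ S.card) :
    sparseMean S (step n R ρ k) ∈ altSpace p n ρ s := by
  obtain ⟨-, h2, h3⟩ := stepLevel_sq hR hn ρ
  have hRr : (2 : ℝ) ≤ R := by exact_mod_cast hR
  have h4 : (0 : ℝ) < n - (R ^ (k + 1) : ℕ) := by nlinarith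
  have h5 : (0 : ℝ) < n := by linarith
  refine ⟨S, fun j => if j ∈ S then stepLevel n R ρ k else 0, fun _ => 0, R ^ (k + 1), hS,
    Nat.one_le_pow _ _ (by omega), ?_, ?_, ?_, ?_⟩
  · have : ((R ^ (k + 1) : ℕ) : ℝ) < n := by linarith
    exact_mod_cast this
  · intro j i
    simp only [sparseMean, step]
    split_ifs <;> rfl
  · intro j hj
    simp only [hj, if_true, sub_zero, stepLevel]
    rw [mul_div_cancel₀]
    exact (Real.sqrt_pos.2 (by positivity)).ne'
  · intro j hj
    simp [hj]

/-- The second-moment-type lower bound: the average over the blocks of the mixture likelihood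
ratios is close to one in `L¹`, and replacing blocks by steps changes little. -/
lemma le_minimaxError {p n R T s : ℕ} {ε θ ρ G : ℝ} (hR : 2 ≤ R) (hT : 0 < T)
    (hn : R ^ (T + 1) ≤ n) (hε : ε ∈ Set.Icc (0 : ℝ) 1) (hθ : 0 < θ) (hθ1 : θ ≤ 1)
    (hG : ∀ v : Fin n → ℝ, ∑ i, v i ^ 2 ≤ ρ ^ 2 →
      ∫ x, rowMix ε v x ^ (1 + θ) ∂rowNull n ≤ G) :
    1 - (2 * ((√T) ^ (-θ) * G ^ p) + √(√T / T)) - √(Real.exp (p * (2 * ρ ^ 2 / R)) - 1) -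
      Real.exp (s - p * ε / 2) ≤ minimaxError p n ρ s := by
  have hnk : ∀ k : Fin T, R ^ ((k : ℕ) + 2) ≤ n := fun k =>
    (Nat.pow_le_pow_right (by omega) (by have := k.2; omega)).trans hn
  set P := obsLaw (0 : Mat p n)
  set L : Fin T → Mat p n → ℝ := fun k => mixLik ε (block n R ρ k) with hLdef
  have hdisj : ∀ k l : Fin T, k ≠ l → ∀ i, block n R ρ k i = 0 ∨ block n R ρ l i = 0 := by
    have aux : ∀ k l : Fin T, k < l → ∀ i, block n R ρ k i = 0 ∨ block n R ρ l i = 0 := by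
      intro k l hkl i
      have : R ^ ((k : ℕ) + 1) ≤ R ^ (l : ℕ) := Nat.pow_le_pow_right (by omega) hkl
      unfold block
      by_cases h : (i : ℕ) < R ^ ((k : ℕ) + 1)
      · right; rw [if_neg]; omega
      · left; rw [if_neg]; omega
    intro k l hkl i
    rcases lt_or_gt_of_ne hkl with h | h
    · exact aux k l h i
    · exact (aux l k h i).symm
  have hTr : (0 : ℝ) < T := by exact_mod_cast hT
  have hL1 := integral_abs_average_sub_one_le (P := P) hT (L := L) (θ := θ) (B := G ^ p) (M := √T)
    (fun k => measurable_mixLik _ _) (fun k => mixLik_nonneg hε _)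
    (fun k => integrable_mixLik _ _) (fun k => integral_mixLik _ _)
    (fun k l hkl => indepFun_mixLik _ _ _ (hdisj k l hkl)) hθ (Real.sqrt_pos.2 hTr)
    (fun k => integrable_mixLik_rpow hε hθ hθ1 _)
    (fun k => integral_mixLik_rpow_le hε _ (hG _ (sum_block_sq_le hR (hnk k) ρ)))
  unfold minimaxError
  have : Nonempty {ψ : Mat p n → ℝ // IsTest ψ} :=
    ⟨⟨fun _ => 0, measurable_const, fun _ => Or.inl rfl⟩⟩
  refine le_ciInf fun ⟨ψ, hψ⟩ => ?_
  set f : Mat p n → ℝ := fun X => 1 - ψ X with hf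
  have hf0 : ∀ X, 0 ≤ f X := fun X => by simp only [hf]; linarith [hψ.le_one X]
  have hf1 : ∀ X, f X ≤ 1 := fun X => by simp only [hf]; linarith [hψ.nonneg X]
  have hfm : Measurable f := measurable_const.sub hψ.1
  set A := ⨆ θ : altSpace p n ρ s, ∫ X, (1 - ψ X) ∂obsLaw θ.1 with hA
  have hA0 : 0 ≤ A := Real.iSup_nonneg fun _ => integral_nonneg hf0
  set D := √(Real.exp (p * (2 * ρ ^ 2 / R)) - 1) with hD
  have hblock : ∀ k : Fin T, ∀ S : Finset (Fin p), s ≤ S.card →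
      ∫ X, f X ∂obsLaw (sparseMean S (block n R ρ k)) ≤ A + D := by
    intro k S hS
    have h1 := integral_obsLaw_add_ge (sparseMean S (block n R ρ k))
      (sparseMean S (step n R ρ k - block n R ρ k)) f hfm hf0 hf1
    have e : sparseMean S (block n R ρ k) + sparseMean S (step n R ρ k - block n R ρ k) =
        sparseMean S (step n R ρ k) := by
      ext j i
      simp only [sparseMean, Pi.add_apply, Pi.sub_apply]
      split_ifs <;> ring
    rw [e] at h1
    have h2 : ∫ X, f X ∂obsLaw (sparseMean S (step n R ρ k)) ≤ A :=
      sup_alt_ge hψ (sparseMean_step_mem_altSpace hR (hnk k) hS)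
    have h3 : √(Real.exp (sqNorm (sparseMean S (step n R ρ k - block n R ρ k))) - 1) ≤ D := by
      rw [hD]
      have := sqNorm_step_sub_block_le hR (hnk k) ρ S
      gcongr
    linarith
  have hmix : ∀ k, ∫ X, f X * L k X ∂P ≤ A + D + Real.exp (s - p * ε / 2) := by
    intro k
    rw [hLdef]
    simp only
    rw [integral_mul_mixLik _ _ _ hfm hf0 hf1]
    calc ∑ S ∈ (Finset.univ : Finset (Fin p)).powerset,
          subsetWeight ε S * ∫ X, f X ∂obsLaw (sparseMean S (block n R ρ k))
        ≤ ∑ S ∈ (Finset.univ : Finset (Fin p)).powerset,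
          (subsetWeight ε S * (A + D) + if S.card < s then subsetWeight ε S else 0) := by
          refine Finset.sum_le_sum fun S _ => ?_
          have hw := subsetWeight_nonneg hε S
          have hAD : 0 ≤ A + D := add_nonneg hA0 (Real.sqrt_nonneg _)
          split_ifs with h
          · have := (integral_mem_Icc (P := obsLaw (sparseMean S (block n R ρ k))) hf0 hf1).2
            have h1 := mul_le_mul_of_nonneg_left this hw
            have h2 := mul_nonneg hw hAD
            linarith
          · rw [add_zero]
            exact mul_le_mul_of_nonneg_left (hblock k S (not_lt.1 h)) hw
      _ = (A + D) + ∑ S ∈ (Finset.univ : Finset (Fin p)).powerset with S.card < s,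
            subsetWeight ε S := by
          rw [Finset.sum_add_distrib, ← Finset.sum_mul, sum_subsetWeight, one_mul,
            Finset.sum_filter]
      _ ≤ _ := by
          have := sum_subsetWeight_card_lt_le (p := p) hε s
          gcongr
  have hfLi : ∀ k, Integrable (fun X => f X * L k X) P := fun k =>
    (integrable_mixLik _ _).bdd_mul (c := 1) hfm.aestronglyMeasurable
      (ae_of_all _ fun X => by
        rw [Real.norm_eq_abs, abs_le]; constructor <;> linarith [hf0 X, hf1 X])
  have havg : ∫ X, f X * (1 / (T : ℝ) * ∑ k, L k X) ∂P ≤ A + D + Real.exp (s - p * ε / 2) := by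
    have e : (fun X => f X * (1 / (T : ℝ) * ∑ k, L k X)) =
        fun X => 1 / (T : ℝ) * ∑ k, f X * L k X := by
      ext X; rw [← Finset.mul_sum]; ring
    rw [e, integral_const_mul, integral_finsetSum _ fun k _ => hfLi k]
    calc 1 / (T : ℝ) * ∑ k, ∫ X, f X * L k X ∂P
        ≤ 1 / (T : ℝ) * ∑ _k : Fin T, (A + D + Real.exp (s - p * ε / 2)) := by
          gcongr; exact hmix _
      _ = _ := by
        simp only [Finset.sum_const, Finset.card_univ, Fintype.card_fin, nsmul_eq_mul]
        field_simp
  have hψi : Integrable ψ P := Integrable.of_bound hψ.1.aestronglyMeasurable 1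
    (ae_of_all _ fun X => by
      rw [Real.norm_eq_abs, abs_le]; constructor <;> linarith [hψ.nonneg X, hψ.le_one X])
  have hLi : Integrable (fun X => 1 / (T : ℝ) * ∑ k, L k X) P :=
    (integrable_finsetSum _ fun k _ => integrable_mixLik _ _).const_mul _
  have hfai : Integrable (fun X => f X * (1 / (T : ℝ) * ∑ k, L k X)) P :=
    hLi.bdd_mul (c := 1) hfm.aestronglyMeasurable
      (ae_of_all _ fun X => by
        rw [Real.norm_eq_abs, abs_le]; constructor <;> linarith [hf0 X, hf1 X])
  have habs : Integrable (fun X => |1 / (T : ℝ) * ∑ k, L k X - 1|) P :=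
    (hLi.sub (integrable_const 1)).abs
  have hone : 1 - ∫ X, |1 / (T : ℝ) * ∑ k, L k X - 1| ∂P ≤
      ∫ X, ψ X ∂P + ∫ X, f X * (1 / (T : ℝ) * ∑ k, L k X) ∂P := by
    rw [← integral_add hψi hfai]
    have : 1 - ∫ X, |1 / (T : ℝ) * ∑ k, L k X - 1| ∂P =
        ∫ X, (1 - |1 / (T : ℝ) * ∑ k, L k X - 1|) ∂P := by
      rw [integral_sub (integrable_const _) habs]; simp
    rw [this]
    refine integral_mono ((integrable_const _).sub habs) (hψi.add hfai) fun X => ?_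
    simp only
    set a := 1 / (T : ℝ) * ∑ k, L k X
    have h1 := hψ.nonneg X
    have h2 := hψ.le_one X
    rcases hψ.2 X with h | h <;> simp only [hf, h] <;> rcases abs_cases (a - 1) with h | h <;>
      linarith
  have hnull := sup_null_ge hψ
  show _ ≤ worstCaseError ψ ρ s
  unfold worstCaseError
  rw [← hA]
  linarith

/-! ### The asymptotic regime -/

lemma eventually_mul_rpow_le {x y : ℝ} (hxy : x < y) (C : ℝ) {c : ℝ} (hc : 0 < c) :
    ∀ᶠ p : ℕ in atTop, C * (p : ℝ) ^ x ≤ c * (p : ℝ) ^ y := by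
  have h := (tendsto_rpow_atTop (sub_pos.2 hxy)).comp tendsto_natCast_atTop_atTop
  filter_upwards [h.eventually_ge_atTop (C / c), eventually_gt_atTop 0] with p hp hp0
  have hp0' : (0 : ℝ) < p := by exact_mod_cast hp0
  simp only [Function.comp] at hp
  rw [div_le_iff₀ hc] at hp
  calc C * (p : ℝ) ^ x ≤ (p : ℝ) ^ (y - x) * c * (p : ℝ) ^ x := by gcongr
    _ = c * ((p : ℝ) ^ (y - x) * (p : ℝ) ^ x) := by ring
    _ = c * (p : ℝ) ^ y := by rw [← Real.rpow_add hp0', sub_add_cancel]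

lemma eventually_le_rpow {y : ℝ} (hy : 0 < y) (C : ℝ) {c : ℝ} (hc : 0 < c) :
    ∀ᶠ p : ℕ in atTop, C ≤ c * (p : ℝ) ^ y := by
  have := eventually_mul_rpow_le hy C hc
  simpa using this

lemma eventually_mul_log_le_rpow {y : ℝ} (hy : 0 < y) (C : ℝ) {c : ℝ} (hc : 0 < c) :
    ∀ᶠ p : ℕ in atTop, C * Real.log p ≤ c * (p : ℝ) ^ y := by
  have hC : 0 < c / (|C| + 1) := by positivity
  have h := ((isLittleO_log_rpow_atTop hy).def hC)
  have h2 := tendsto_natCast_atTop_atTop.eventually h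
  filter_upwards [h2, eventually_ge_atTop 1] with p hp hp1
  have hp1' : (1 : ℝ) ≤ p := by exact_mod_cast hp1
  have hl : 0 ≤ Real.log p := Real.log_nonneg hp1'
  rw [Real.norm_of_nonneg hl, Real.norm_of_nonneg (by positivity)] at hp
  calc C * Real.log p ≤ (|C| + 1) * Real.log p := by
        gcongr; linarith [le_abs_self C]
    _ ≤ (|C| + 1) * (c / (|C| + 1) * (p : ℝ) ^ y) := by gcongr
    _ = c * (p : ℝ) ^ y := by field_simp

/-- A natural number whose threefold iterated logarithm is positive exceeds one, and its logarithm
exceeds one, although the logarithms of zero and of negative numbers have junk values. -/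
lemma log_log_pos {n : ℕ} (h : 0 < Real.log (Real.log (Real.log n))) :
    0 < Real.log (Real.log n) ∧ 0 < Real.log n ∧ 2 ≤ n := by
  have hn2 : 2 ≤ n := by
    by_contra hn
    have : n = 0 ∨ n = 1 := by omega
    rcases this with rfl | rfl <;> simp at h
  have hlog : Real.log 2 ≤ Real.log n := by
    apply Real.log_le_log (by norm_num); exact_mod_cast hn2
  have hl2 := Real.log_two_gt_d9
  have hpos : 0 < Real.log n := by linarith
  refine ⟨?_, hpos, hn2⟩
  by_contra hL
  push Not at hL
  have h1 : -1 ≤ Real.log (Real.log n) := by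
    rw [Real.le_log_iff_exp_le hpos, Real.exp_neg]
    have : (2 : ℝ) ≤ Real.exp 1 := by linarith [Real.add_one_le_exp (1 : ℝ)]
    have : (Real.exp 1)⁻¹ ≤ 2⁻¹ := by gcongr
    linarith
  have := Real.log_nonpos (abs_nonneg (Real.log (Real.log n)))
    (abs_le.2 ⟨h1, by linarith⟩)
  rw [Real.log_abs] at this
  linarith

lemma Regime.eventually_log_log {a β : ℝ} {n s : ℕ → ℕ} (h : Regime a β n s) (ha : 0 < a)
    {η : ℝ} (hη : 0 < η) :
    ∀ᶠ p : ℕ in atTop, (p : ℝ) ^ (a - η) ≤ Real.log (Real.log (n p)) ∧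
      Real.log (Real.log (n p)) ≤ (p : ℝ) ^ (a + η) ∧ 0 < Real.log (Real.log (n p)) ∧
      0 < Real.log (n p) ∧ 2 ≤ n p := by
  have hδ : 0 < min (η / a) (1 / 2) := by positivity
  have h1 := h.1.eventually (Metric.ball_mem_nhds 1 hδ)
  filter_upwards [h1, eventually_ge_atTop 2] with p hp hp2
  have hp2' : (2 : ℝ) ≤ p := by exact_mod_cast hp2
  have hlp : 0 < Real.log p := Real.log_pos (by linarith)
  have hal : 0 < a * Real.log p := by positivity
  rw [Real.dist_eq, abs_lt, lt_sub_iff_add_lt, sub_lt_iff_lt_add, lt_div_iff₀ hal,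
    div_lt_iff₀ hal] at hp
  have hm1 := min_le_left (η / a) (1 / 2)
  have hm2 := min_le_right (η / a) (1 / 2)
  have e1 : η / a * (a * Real.log p) = η * Real.log p := by field_simp
  have e2 : min (η / a) (1 / 2) * (a * Real.log p) ≤ η * Real.log p := by
    rw [← e1]; gcongr
  have e3 : min (η / a) (1 / 2) * (a * Real.log p) ≤ 1 / 2 * (a * Real.log p) := by gcongr
  have hpos : 0 < Real.log (Real.log (Real.log (n p))) := by nlinarith [hp.1]
  obtain ⟨hL, hl, hn⟩ := log_log_pos hpos
  have hp0 : (0 : ℝ) < p := by linarith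
  refine ⟨?_, ?_, hL, hl, hn⟩
  · rw [← Real.log_le_log_iff (by positivity) hL, Real.log_rpow hp0]
    nlinarith [hp.1]
  · rw [← Real.log_le_log_iff hL (by positivity), Real.log_rpow hp0]
    nlinarith [hp.2]

lemma Regime.eventually_sparsity {a β : ℝ} {n s : ℕ → ℕ} (h : Regime a β n s) :
    ∀ᶠ p : ℕ in atTop, (p : ℝ) ^ (1 - β) / 2 ≤ s p ∧ (s p : ℝ) ≤ 2 * (p : ℝ) ^ (1 - β) := by
  have h1 := h.2.eventually (Metric.ball_mem_nhds 1 (by norm_num : (0 : ℝ) < 1 / 2))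
  filter_upwards [h1, eventually_ge_atTop 1] with p hp hp1
  have hp0 : (0 : ℝ) < p := by exact_mod_cast hp1
  have hpp : 0 < (p : ℝ) ^ (1 - β) := by positivity
  rw [Real.dist_eq, abs_lt, lt_sub_iff_add_lt, sub_lt_iff_lt_add, lt_div_iff₀ hpp,
    div_lt_iff₀ hpp] at hp
  constructor <;> linarith [hp.1, hp.2]

lemma boundarySq_nonneg {a β : ℝ} {p : ℕ} (hp : 1 ≤ p) : 0 ≤ boundarySq a β p := by
  have hlp : 0 ≤ Real.log p := Real.log_nonneg (by exact_mod_cast hp)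
  unfold boundarySq
  split_ifs with h1 h2 h3
  · positivity
  · exact mul_nonneg (by linarith) hlp
  · positivity
  · positivity

lemma boundary_sq {a β : ℝ} {p : ℕ} (hp : 1 ≤ p) : boundary a β p ^ 2 = boundarySq a β p :=
  Real.sq_sqrt (boundarySq_nonneg hp)

lemma boundarySq_le {a β : ℝ} (ha : 0 < a) (hβ : β ∈ Set.Ioo (0 : ℝ) 1) {p : ℕ} (hp : 1 ≤ p) :
    boundarySq a β p ≤ 2 * (p : ℝ) ^ (a + 1) := by
  have hp' : (1 : ℝ) ≤ p := by exact_mod_cast hp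
  have hp0 : (0 : ℝ) < p := by linarith
  have hlp : 0 ≤ Real.log p := Real.log_nonneg hp'
  have hlog : Real.log p ≤ (p : ℝ) ^ (a + 1) :=
    ((Real.log_le_sub_one_of_pos hp0).trans (by linarith)).trans
      (Real.self_le_rpow_of_one_le hp' (by linarith))
  have hpow : ∀ x, x ≤ a + 1 → (p : ℝ) ^ x ≤ 2 * (p : ℝ) ^ (a + 1) := fun x hx => by
    have := Real.rpow_le_rpow_of_exponent_le hp' hx
    have := Real.rpow_nonneg hp0.le x
    linarith
  unfold boundarySq
  obtain ⟨hb0, hb1⟩ := hβ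
  split_ifs with h1 h2 h3
  · exact hpow _ (by linarith)
  · refine mul_le_mul (by linarith) hlog hlp (by norm_num)
  · refine mul_le_mul ?_ hlog hlp (by norm_num)
    have h4 : √(1 - a - β) ≤ √(1 - a) := Real.sqrt_le_sqrt (by linarith)
    have h5 : √(1 - a) ≤ 1 := Real.sqrt_le_one.2 (by linarith)
    have h6 := Real.sqrt_nonneg (1 - a - β)
    have : (√(1 - a) - √(1 - a - β)) ^ 2 ≤ 1 := by
      rw [sq_le_one_iff_abs_le_one, abs_le]; constructor <;> linarith
    linarith
  · exact hpow _ (by linarith)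

/-! ### Moments of the likelihood ratio at the detection boundary -/

/-- At the boundary for `β₁`, and for a row-wise signal probability at most `p ^ (-β')` with
`β₁ < β'`, the moment of order `1 + θ` of the likelihood ratio of `p` rows is smaller than
`T ^ (θ / 2)` for a suitable `θ ∈ (0, 1]`, where `T` is the number of candidate changepoints,
`log T ≈ p ^ a`. In the two sparsest regimes `θ = 1` fails: the best `θ` is, up to a
perturbation, `√(1 - a - β₁) / (√(1 - a) - √(1 - a - β₁))` if `a ≤ 1 - β₁`, and the reciprocal of
the squared boundary, which tends to zero, if `a > 1 - β₁`. -/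
lemma exists_moment_bound {a β₁ β' : ℝ} (ha : 0 < a) (hβ₁ : 0 < β₁) (hβ : β₁ < β') (hβ' : β' < 1) :
    ∃ η > 0, ∀ᶠ p : ℕ in atTop, ∀ ε ∈ Set.Icc (0 : ℝ) 1, ε ≤ (p : ℝ) ^ (-β') →
      ∃ θ G : ℝ, 0 < θ ∧ θ ≤ 1 ∧
        (∀ (n : ℕ) (v : Fin n → ℝ), ∑ i, v i ^ 2 ≤ boundary a β₁ p ^ 2 →
          ∫ x, rowMix ε v x ^ (1 + θ) ∂rowNull n ≤ G) ∧
        p * (G - 1) + 5 ≤ θ * (p : ℝ) ^ (a - η) / 4 := by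
  by_cases h1 : a ≤ 1 - 2 * β₁
  · refine ⟨min (β' - β₁) (a / 2), by simp [sub_pos, hβ, ha], ?_⟩
    set η := min (β' - β₁) (a / 2)
    have hη1 : η ≤ β' - β₁ := min_le_left _ _
    have hη2 : η ≤ a / 2 := min_le_right _ _
    have hη0 : 0 < η := by simp [η, sub_pos, hβ, ha]
    filter_upwards [eventually_mul_rpow_le (show a - 2 * (β' - β₁) < a - η by linarith) 2
      (show (0 : ℝ) < 1 / 8 by norm_num), eventually_le_rpow (show 0 < a - η by linarith) 5
      (show (0 : ℝ) < 1 / 8 by norm_num), eventually_ge_atTop 1] with p hp1 hp2 hp ε hε hεp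
    have hp' : (1 : ℝ) ≤ p := by exact_mod_cast hp
    have hp0 : (0 : ℝ) < p := by linarith
    refine ⟨1, _, one_pos, le_rfl, fun n v hv => integral_rowMix_sq_le v hv, ?_⟩
    have hρ : boundary a β₁ p ^ 2 = (p : ℝ) ^ (a - (1 - 2 * β₁)) := by
      rw [boundary_sq hp, boundarySq, if_pos h1]
    rw [hρ]
    set x := (p : ℝ) ^ (a - (1 - 2 * β₁)) with hx
    have hx0 : 0 ≤ x := by positivity
    have hx1 : x ≤ 1 := Real.rpow_le_one_of_one_le_of_nonpos hp' (by linarith)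
    have hexp : Real.exp x - 1 ≤ 2 * x := by
      have := Real.abs_exp_sub_one_le (x := x) (by rwa [abs_of_nonneg hx0])
      rw [abs_of_nonneg hx0] at this
      exact (le_abs_self _).trans this
    have hε2 : ε ^ 2 ≤ (p : ℝ) ^ (-2 * β') := by
      calc ε ^ 2 ≤ ((p : ℝ) ^ (-β')) ^ 2 := pow_le_pow_left₀ hε.1 hεp 2
        _ = _ := by rw [← Real.rpow_natCast, ← Real.rpow_mul hp0.le]; congr 1; push_cast; ring
    have : (p : ℝ) * (ε ^ 2 * (Real.exp x - 1)) ≤ 2 * (p : ℝ) ^ (a - 2 * (β' - β₁)) := by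
      have hexp0 : 0 ≤ Real.exp x - 1 := sub_nonneg.2 (Real.one_le_exp hx0)
      calc (p : ℝ) * (ε ^ 2 * (Real.exp x - 1)) ≤ p * ((p : ℝ) ^ (-2 * β') * (2 * x)) := by
            gcongr
        _ = 2 * ((p : ℝ) ^ (1 : ℝ) * (p : ℝ) ^ (-2 * β') * x) := by rw [Real.rpow_one]; ring
        _ = _ := by
          rw [hx, ← Real.rpow_add hp0, ← Real.rpow_add hp0]; congr 2; ring
    rw [add_sub_cancel_left]
    linarith
  by_cases h2 : a ≤ 1 - 4 * β₁ / 3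
  · refine ⟨min (β' - β₁) (a / 2), by simp [sub_pos, hβ, ha], ?_⟩
    set η := min (β' - β₁) (a / 2)
    have hη1 : η ≤ β' - β₁ := min_le_left _ _
    have hη2 : η ≤ a / 2 := min_le_right _ _
    have hη0 : 0 < η := by simp [η, sub_pos, hβ, ha]
    filter_upwards [eventually_mul_rpow_le (show a - 2 * (β' - β₁) < a - η by linarith) 1
      (show (0 : ℝ) < 1 / 8 by norm_num), eventually_le_rpow (show 0 < a - η by linarith) 5
      (show (0 : ℝ) < 1 / 8 by norm_num), eventually_ge_atTop 1] with p hp1 hp2 hp ε hε hεp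
    have hp' : (1 : ℝ) ≤ p := by exact_mod_cast hp
    have hp0 : (0 : ℝ) < p := by linarith
    refine ⟨1, _, one_pos, le_rfl, fun n v hv => integral_rowMix_sq_le v hv, ?_⟩
    have hρ : Real.exp (boundary a β₁ p ^ 2) = (p : ℝ) ^ (a - (1 - 2 * β₁)) := by
      rw [boundary_sq hp, boundarySq, if_neg h1, if_pos h2, Real.rpow_def_of_pos hp0, mul_comm]
    rw [hρ]
    have hε2 : ε ^ 2 ≤ (p : ℝ) ^ (-2 * β') := by
      calc ε ^ 2 ≤ ((p : ℝ) ^ (-β')) ^ 2 := pow_le_pow_left₀ hε.1 hεp 2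
        _ = _ := by rw [← Real.rpow_natCast, ← Real.rpow_mul hp0.le]; congr 1; push_cast; ring
    have : (p : ℝ) * (ε ^ 2 * ((p : ℝ) ^ (a - (1 - 2 * β₁)) - 1)) ≤
        (p : ℝ) ^ (a - 2 * (β' - β₁)) := by
      calc (p : ℝ) * (ε ^ 2 * ((p : ℝ) ^ (a - (1 - 2 * β₁)) - 1))
          ≤ p * (ε ^ 2 * (p : ℝ) ^ (a - (1 - 2 * β₁))) := by gcongr; linarith
        _ ≤ p * ((p : ℝ) ^ (-2 * β') * (p : ℝ) ^ (a - (1 - 2 * β₁))) := by gcongr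
        _ = (p : ℝ) ^ (1 : ℝ) * (p : ℝ) ^ (-2 * β') * (p : ℝ) ^ (a - (1 - 2 * β₁)) := by
          rw [Real.rpow_one]; ring
        _ = _ := by
          rw [← Real.rpow_add hp0, ← Real.rpow_add hp0]; congr 1; ring
    rw [add_sub_cancel_left]
    linarith
  by_cases h3 : a ≤ 1 - β₁
  · set A := √(1 - a) with hA
    set B := √(1 - a - β₁) with hB
    have hA2 : A ^ 2 = 1 - a := Real.sq_sqrt (by linarith)
    have hB2 : B ^ 2 = 1 - a - β₁ := Real.sq_sqrt (by linarith)
    have hB0 : 0 ≤ B := Real.sqrt_nonneg _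
    have hAB : 2 * B < A := by
      rw [hA]
      apply Real.lt_sqrt_of_sq_lt
      rw [mul_pow, hB2]; linarith
    set r := (A - B) ^ 2 with hr
    -- The exponent of `p` in the moment bound, as a function of `θ`, at its minimiser.
    set θ₀ := B / (A - B) with hθ₀
    have hd : 0 < A - B := by linarith
    have hθ₀0 : 0 ≤ θ₀ := by positivity
    have hθ₀1 : θ₀ < 1 := by rw [hθ₀, div_lt_one hd]; linarith
    have hval : 1 - (1 + θ₀) * β' + θ₀ * (1 + θ₀) * r < a := by
      have e1 : 1 - (1 + θ₀) * β₁ + θ₀ * (1 + θ₀) * r = a := by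
        have hβ₁e : β₁ = A ^ 2 - B ^ 2 := by rw [hA2, hB2]; ring
        have hae : a = 1 - A ^ 2 := by rw [hA2]; ring
        rw [hβ₁e, hae, hr, hθ₀]
        field_simp
        ring
      have : (1 + θ₀) * β₁ < (1 + θ₀) * β' := by gcongr
      linarith
    have hcont : Continuous fun θ : ℝ => 1 - (1 + θ) * β' + θ * (1 + θ) * r := by fun_prop
    obtain ⟨θ, hθa, hθb⟩ : ∃ θ, 1 - (1 + θ) * β' + θ * (1 + θ) * r < a ∧ θ ∈ Set.Ioo θ₀ 1 := by
      have e1 : ∀ᶠ θ in 𝓝[>] θ₀, 1 - (1 + θ) * β' + θ * (1 + θ) * r < a :=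
        (hcont.continuousAt.eventually_lt_const hval).filter_mono nhdsWithin_le_nhds
      exact (e1.and (Ioo_mem_nhdsGT hθ₀1)).exists
    have hθ0 : 0 < θ := hθ₀0.trans_lt hθb.1
    set κ := 1 - (1 + θ) * β' + θ * (1 + θ) * r with hκ
    refine ⟨min ((a - κ) / 2) (a / 2), by simp [sub_pos, hθa, ha], ?_⟩
    set η := min ((a - κ) / 2) (a / 2)
    have hη1 : η ≤ (a - κ) / 2 := min_le_left _ _
    have hη2 : η ≤ a / 2 := min_le_right _ _
    filter_upwards [eventually_mul_rpow_le (show κ < a - η by linarith) 2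
      (show (0 : ℝ) < θ / 8 by positivity), eventually_le_rpow (show 0 < a - η by linarith) 5
      (show (0 : ℝ) < θ / 8 by positivity), eventually_ge_atTop 1] with p hp1 hp2 hp ε hε hεp
    have hp' : (1 : ℝ) ≤ p := by exact_mod_cast hp
    have hp0 : (0 : ℝ) < p := by linarith
    refine ⟨θ, _, hθ0, hθb.2.le, fun n v hv => integral_rowMix_rpow_le hε hθ0 hθb.2.le v hv, ?_⟩
    have hρ : Real.exp (θ * (1 + θ) * boundary a β₁ p ^ 2 / 2) = (p : ℝ) ^ (θ * (1 + θ) * r) := by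
      rw [boundary_sq hp, boundarySq, if_neg h1, if_neg h2, if_pos h3, Real.rpow_def_of_pos hp0]
      congr 1
      ring
    rw [hρ]
    have hε2 : ε ^ (1 + θ) ≤ (p : ℝ) ^ (-(1 + θ) * β') := by
      calc ε ^ (1 + θ) ≤ ((p : ℝ) ^ (-β')) ^ (1 + θ) :=
            Real.rpow_le_rpow hε.1 hεp (by linarith)
        _ = _ := by rw [← Real.rpow_mul hp0.le]; congr 1; ring
    have : (p : ℝ) * (2 * ε ^ (1 + θ) * (p : ℝ) ^ (θ * (1 + θ) * r)) ≤ 2 * (p : ℝ) ^ κ := by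
      calc (p : ℝ) * (2 * ε ^ (1 + θ) * (p : ℝ) ^ (θ * (1 + θ) * r))
          ≤ p * (2 * (p : ℝ) ^ (-(1 + θ) * β') * (p : ℝ) ^ (θ * (1 + θ) * r)) := by gcongr
        _ = 2 * ((p : ℝ) ^ (1 : ℝ) * (p : ℝ) ^ (-(1 + θ) * β') * (p : ℝ) ^ (θ * (1 + θ) * r)) := by
          rw [Real.rpow_one]; ring
        _ = _ := by
          rw [← Real.rpow_add hp0, ← Real.rpow_add hp0, hκ]; congr 2; ring
    rw [add_sub_cancel_left]
    linarith
  · push Not at h3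
    refine ⟨min ((β' - β₁) / 2) ((1 - β₁) / 2), by
      have : β₁ < 1 := by linarith
      simp [sub_pos, hβ, this], ?_⟩
    set η := min ((β' - β₁) / 2) ((1 - β₁) / 2)
    have hη1 : η ≤ (β' - β₁) / 2 := min_le_left _ _
    have hη2 : η ≤ (1 - β₁) / 2 := min_le_right _ _
    filter_upwards [eventually_mul_rpow_le (show 1 - β' < 1 - β₁ - η by linarith)
      (2 * Real.exp 1) (show (0 : ℝ) < 1 / 8 by norm_num),
      eventually_le_rpow (show 0 < 1 - β₁ - η by linarith) 5
      (show (0 : ℝ) < 1 / 8 by norm_num), eventually_ge_atTop 1] with p hp1 hp2 hp ε hε hεp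
    have hp' : (1 : ℝ) ≤ p := by exact_mod_cast hp
    have hp0 : (0 : ℝ) < p := by linarith
    have hρ : boundary a β₁ p ^ 2 = (p : ℝ) ^ (a - (1 - β₁)) := by
      rw [boundary_sq hp, boundarySq, if_neg h1, if_neg h2, if_neg (not_le.2 h3)]
    set θ := (p : ℝ) ^ (-(a - (1 - β₁))) with hθ
    have hθ0 : 0 < θ := by positivity
    have hθ1 : θ ≤ 1 := Real.rpow_le_one_of_one_le_of_nonpos hp' (by linarith)
    refine ⟨θ, _, hθ0, hθ1, fun n v hv => integral_rowMix_rpow_le hε hθ0 hθ1 v hv, ?_⟩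
    have hmul : θ * boundary a β₁ p ^ 2 = 1 := by
      rw [hρ, hθ, ← Real.rpow_add hp0, neg_add_cancel, Real.rpow_zero]
    have hexp : Real.exp (θ * (1 + θ) * boundary a β₁ p ^ 2 / 2) ≤ Real.exp 1 := by
      apply Real.exp_le_exp.2
      rw [show θ * (1 + θ) * boundary a β₁ p ^ 2 / 2 =
        θ * boundary a β₁ p ^ 2 * (1 + θ) / 2 by ring, hmul]
      linarith
    have hε2 : ε ^ (1 + θ) ≤ (p : ℝ) ^ (-β') := by
      rcases hε.1.eq_or_lt with h | h
      · rw [← h, Real.zero_rpow (by linarith)]; positivity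
      · calc ε ^ (1 + θ) ≤ ε ^ (1 : ℝ) :=
              Real.rpow_le_rpow_of_exponent_ge h hε.2 (by linarith)
          _ ≤ _ := by rwa [Real.rpow_one]
    have : (p : ℝ) * (2 * ε ^ (1 + θ) * Real.exp (θ * (1 + θ) * boundary a β₁ p ^ 2 / 2)) ≤
        2 * Real.exp 1 * (p : ℝ) ^ (1 - β') := by
      calc (p : ℝ) * (2 * ε ^ (1 + θ) * Real.exp (θ * (1 + θ) * boundary a β₁ p ^ 2 / 2))
          ≤ p * (2 * (p : ℝ) ^ (-β') * Real.exp 1) := by gcongr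
        _ = 2 * Real.exp 1 * ((p : ℝ) ^ (1 : ℝ) * (p : ℝ) ^ (-β')) := by rw [Real.rpow_one]; ring
        _ = _ := by rw [← Real.rpow_add hp0]; rfl
    have e : θ * (p : ℝ) ^ (a - η) = (p : ℝ) ^ (1 - β₁ - η) := by
      rw [hθ, ← Real.rpow_add hp0]; congr 1; ring
    rw [add_sub_cancel_left, e]
    linarith

/-- Among the powers of `R` below `n` there are at least `√(log n)` admissible changepoints, as
soon as `log R` is small compared with `√(log n)`. -/
lemma exp_half_log_log_le {n R : ℕ} (hR : 2 ≤ R) (hL0 : 0 < Real.log (Real.log n))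
    (hl0 : 0 < Real.log n) (hn : 2 ≤ n)
    (hRL : 3 * Real.log R ≤ Real.exp (Real.log (Real.log n) / 2)) :
    Real.exp (Real.log (Real.log n) / 2) ≤ (Nat.log R n - 1 : ℕ) := by
  set L := Real.log (Real.log n)
  set T := Nat.log R n - 1 with hT
  have hexpL : Real.exp L = Real.log n := Real.exp_log hl0
  have hnlt : n < R ^ (Nat.log R n + 1) := Nat.lt_pow_succ_log_self (by omega) _
  have hE1 : 1 ≤ Real.exp (L / 2) := Real.one_le_exp (by linarith)
  have hEE : Real.exp L = Real.exp (L / 2) * Real.exp (L / 2) := by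
    rw [← Real.exp_add]; congr 1; ring
  have hlR : 0 < Real.log R := Real.log_pos (by exact_mod_cast hR)
  have h1 : Real.log n < (T + 2) * Real.log R := by
    have h2 : Real.log n < Real.log ((R ^ (Nat.log R n + 1) : ℕ) : ℝ) := by
      apply Real.log_lt_log
      · have : 0 < n := by omega
        exact_mod_cast this
      · exact_mod_cast hnlt
    rw [Nat.cast_pow, Real.log_pow] at h2
    have h3 : ((Nat.log R n + 1 : ℕ) : ℝ) ≤ T + 2 := by
      have : Nat.log R n + 1 ≤ T + 2 := by omega
      exact_mod_cast this
    nlinarith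
  rw [← hexpL, hEE] at h1
  have h6 : Real.exp (L / 2) * 3 * Real.log R < (T + 2) * Real.log R := by
    rw [mul_assoc]
    exact (mul_le_mul_of_nonneg_left hRL (Real.exp_pos _).le).trans_lt h1
  have h7 : Real.exp (L / 2) * 3 < T + 2 := lt_of_mul_lt_mul_right h6 hlR.le
  linarith

lemma rpow_mul_pow_le_exp {p : ℕ} {T θ G L x : ℝ} (hT : 0 < T) (hTL : Real.exp (L / 2) ≤ T)
    (hθ : 0 < θ) (hG : 0 ≤ G) (hxL : x ≤ L) (h : p * (G - 1) + 5 ≤ θ * x / 4) :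
    (√T) ^ (-θ) * G ^ p ≤ Real.exp (-5) := by
  have hlogT : L / 2 ≤ Real.log T := by rwa [Real.le_log_iff_exp_le hT]
  have e1 : (√T) ^ (-θ) = Real.exp (-(θ * Real.log T / 2)) := by
    rw [Real.rpow_def_of_pos (Real.sqrt_pos.2 hT), Real.log_sqrt hT.le]
    congr 1; ring
  have e2 : G ^ p ≤ Real.exp (p * (G - 1)) := by
    rw [Real.exp_nat_mul]
    exact pow_le_pow_left₀ hG (by linarith [Real.add_one_le_exp (G - 1)]) p
  rw [e1]
  calc Real.exp (-(θ * Real.log T / 2)) * G ^ p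
      ≤ Real.exp (-(θ * Real.log T / 2)) * Real.exp (p * (G - 1)) := by gcongr
    _ = Real.exp (-(θ * Real.log T / 2) + p * (G - 1)) := (Real.exp_add _ _).symm
    _ ≤ Real.exp (-5) := by
      apply Real.exp_le_exp.2
      have h1 : θ * x ≤ θ * L := by gcongr
      have h2 : θ * (L / 2) ≤ θ * Real.log T := by gcongr
      linarith

lemma sqrt_exp_sub_one_le {x : ℝ} (hx0 : 0 ≤ x) (hx1 : x ≤ 1 / 32) :
    √(Real.exp x - 1) ≤ 1 / 4 := by
  rw [Real.sqrt_le_left (by norm_num)]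
  have := Real.abs_exp_sub_one_le (x := x) (by rw [abs_of_nonneg hx0]; linarith)
  rw [abs_of_nonneg hx0] at this
  have := (le_abs_self _).trans this
  linarith

lemma sqrt_sqrt_div_le {T L : ℝ} (hT : 0 < T) (hTL : Real.exp (L / 2) ≤ T) (hL : 24 ≤ L) :
    √(√T / T) ≤ 1 / 8 := by
  rw [Real.sqrt_le_left (by norm_num), Real.sqrt_div_self,
    inv_le_comm₀ (Real.sqrt_pos.2 hT) (by norm_num)]
  have h1 : Real.exp (L / 4) ≤ √T := by
    apply Real.le_sqrt_of_sq_le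
    rw [← Real.exp_nat_mul]
    refine le_trans (le_of_eq ?_) hTL
    congr 1; push_cast; ring
  have h2 : Real.exp 6 ≤ Real.exp (L / 4) := by gcongr; linarith
  have h3 : (2 : ℝ) ^ 6 ≤ Real.exp 6 := by
    rw [show (6 : ℝ) = (6 : ℕ) * 1 by norm_num, Real.exp_nat_mul]
    exact pow_le_pow_left₀ (by norm_num) (by linarith [Real.add_one_le_exp (1 : ℝ)]) 6
  norm_num at h3 ⊢
  linarith

lemma mul_boundarySq_div_le {a β : ℝ} (ha : 0 < a) (hβ : β ∈ Set.Ioo (0 : ℝ) 1) {p m : ℕ}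
    (hp : 128 ≤ p) (hm : a + 3 ≤ m) :
    p * (2 * boundarySq a β p / (p ^ m : ℕ)) ∈ Set.Icc (0 : ℝ) (1 / 32) := by
  have hp' : (128 : ℝ) ≤ p := by exact_mod_cast hp
  have hp0 : (0 : ℝ) < p := by linarith
  have h1 := boundarySq_le ha hβ (show 1 ≤ p by omega)
  have h0 := boundarySq_nonneg (a := a) (β := β) (show 1 ≤ p by omega)
  refine ⟨by positivity, ?_⟩
  have hRr : (p : ℝ) ^ (a + 3) ≤ (p ^ m : ℕ) := by
    push_cast; rw [← Real.rpow_natCast]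
    exact Real.rpow_le_rpow_of_exponent_le (by linarith) hm
  have hRpos : (0 : ℝ) < (p ^ m : ℕ) := by positivity
  rw [mul_div_assoc', div_le_iff₀ hRpos]
  have e : (p : ℝ) ^ (a + 3) = p * p * (p : ℝ) ^ (a + 1) := by
    rw [show a + 3 = 1 + (1 + (a + 1)) by ring, Real.rpow_add hp0, Real.rpow_add hp0,
      Real.rpow_one, mul_assoc]
  have h2 : 0 ≤ p * (p : ℝ) ^ (a + 1) := by positivity
  have h3 : p * (2 * boundarySq a β p) ≤ p * (2 * (2 * (p : ℝ) ^ (a + 1))) := by gcongr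
  nlinarith

/-- Below the boundary the minimax error stays bounded away from zero. -/
lemma eventually_le_minimaxError {a β₁ β : ℝ} (ha : 0 < a) (hβ₁ : β₁ ∈ Set.Ioo (0 : ℝ) 1)
    (hβ : β ∈ Set.Ioo (0 : ℝ) 1) {n s : ℕ → ℕ} (hreg : Regime a β n s) (hlt : β₁ < β) :
    ∀ᶠ p : ℕ in atTop, 1 / 8 ≤ minimaxError p (n p) (boundary a β₁ p) (s p) := by
  set β' := (β₁ + β) / 2 with hβ'
  obtain ⟨η, hη, hmom⟩ := exists_moment_bound ha hβ₁.1 (show β₁ < β' by linarith)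
    (show β' < 1 by linarith [hβ.2])
  -- The candidate changepoints are the powers of `p ^ m`. The squared boundary is of order at most
  -- `p ^ (a + 1)`, so this spacing makes the difference of steps and blocks negligible, even when
  -- summed over the rows.
  set m : ℕ := ⌈a⌉₊ + 3 with hm
  have ham : a + 3 ≤ m := by rw [hm]; push_cast; linarith [Nat.le_ceil a]
  have h8 := eventually_mul_rpow_le (show -β < 0 by linarith [hβ.1]) 8 one_pos
  simp only [Real.rpow_zero, one_mul] at h8
  filter_upwards [hmom, hreg.eventually_log_log ha hη,
    hreg.eventually_log_log ha (show 0 < a / 2 by linarith), hreg.eventually_sparsity,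
    eventually_mul_rpow_le (show -β < -β' by linarith) 8 one_pos, h8,
    eventually_le_rpow (show 0 < 1 - β by linarith [hβ.2]) 10 one_pos,
    eventually_mul_log_le_rpow (show 0 < a / 2 by linarith) (3 * m)
      (show (0 : ℝ) < 1 / 2 by norm_num),
    eventually_le_rpow (show 0 < a / 2 by linarith) 24 one_pos, eventually_ge_atTop 128]
    with p hp1 hp2 hp3 hp4 hp5 hp6 hp7 hp8 hp9 hp
  have hp0 : (0 : ℝ) < p := by
    have : 0 < p := by omega
    exact_mod_cast this
  obtain ⟨hL1, -, hL0, hl0, hn2⟩ := hp2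
  have hL2 := hp3.1
  rw [show a - a / 2 = a / 2 by ring] at hL2
  -- With this probability of a signal, the mean number of signals is four times `s`.
  set ε : ℝ := 4 * s p / p with hε
  have hpε : p * ε = 4 * s p := by rw [hε]; field_simp
  have hεle : ε ≤ 8 * (p : ℝ) ^ (-β) := by
    rw [hε, div_le_iff₀ hp0]
    have : (p : ℝ) ^ (-β) * p = (p : ℝ) ^ (1 - β) := by
      nth_rewrite 2 [← Real.rpow_one (p : ℝ)]
      rw [← Real.rpow_add hp0]; congr 1; ring
    rw [mul_assoc, this]
    linarith [hp4.2]
  have hεmem : ε ∈ Set.Icc (0 : ℝ) 1 := ⟨by positivity, hεle.trans hp6⟩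
  rw [one_mul] at hp5 hp7 hp9
  obtain ⟨θ, G, hθ0, hθ1, hG, hGb⟩ := hp1 ε hεmem (hεle.trans hp5)
  have hR2 : 2 ≤ p ^ m := (show 2 ≤ p by omega).trans (Nat.le_self_pow (by omega) p)
  have hTbig : Real.exp (Real.log (Real.log (n p)) / 2) ≤ (Nat.log (p ^ m) (n p) - 1 : ℕ) := by
    refine exp_half_log_log_le hR2 hL0 hl0 hn2 ?_
    rw [Nat.cast_pow, Real.log_pow, ← mul_assoc]
    linarith [Real.add_one_le_exp (Real.log (Real.log (n p)) / 2)]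
  have hTr := (Real.exp_pos _).trans_le hTbig
  have hT0 : 0 < Nat.log (p ^ m) (n p) - 1 := by exact_mod_cast hTr
  have hTn : (p ^ m) ^ (Nat.log (p ^ m) (n p) - 1 + 1) ≤ n p := by
    rw [Nat.sub_add_cancel (by omega)]; exact Nat.pow_log_le_self _ (by omega)
  refine le_trans ?_ (le_minimaxError (p := p) (s := s p) hR2 hT0 hTn hεmem hθ0 hθ1 (hG (n p)))
  have hG0 : 0 ≤ G := le_trans (integral_nonneg fun x =>
    Real.rpow_nonneg (rowMix_nonneg hεmem _ x) _) (hG (n p) 0 (by simp; positivity))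
  have hb1 := rpow_mul_pow_le_exp hTr hTbig hθ0 hG0 hL1 hGb
  have he5 : Real.exp (-5 : ℝ) ≤ 1 / 6 := by
    rw [Real.exp_neg, inv_le_comm₀ (Real.exp_pos _) (by norm_num)]
    linarith [Real.add_one_le_exp (5 : ℝ)]
  have hb2 := sqrt_sqrt_div_le hTr hTbig (hp9.trans hL2)
  have hb3 : √(Real.exp (p * (2 * boundary a β₁ p ^ 2 / (p ^ m : ℕ))) - 1) ≤ 1 / 4 := by
    rw [boundary_sq (by omega)]
    have := mul_boundarySq_div_le ha hβ₁ hp ham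
    exact sqrt_exp_sub_one_le this.1 this.2
  have hb4 : Real.exp (s p - p * ε / 2) ≤ 1 / 6 := by
    rw [hpε, show (s p : ℝ) - 4 * s p / 2 = -(s p) by ring, Real.exp_neg,
      inv_le_comm₀ (Real.exp_pos _) (by norm_num)]
    linarith [Real.add_one_le_exp (s p : ℝ), hp4.1]
  linarith

/-! ### The normal tail function -/

lemma normalTail_eq_real (x : ℝ) : normalTail x = (gaussianReal 0 1).real (Set.Ioi x) := by
  rw [normalTail, cdf_eq_real, ← Set.compl_Iic, probReal_compl_eq_one_sub measurableSet_Iic]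

lemma normalTail_sub {u v : ℝ} (h : u ≤ v) :
    normalTail u - normalTail v = (gaussianReal 0 1).real (Set.Ioc u v) := by
  rw [normalTail_eq_real, normalTail_eq_real, ← Set.Ioc_union_Ioi_eq_Ioi h,
    measureReal_union (Set.Ioc_disjoint_Ioi le_rfl) measurableSet_Ioi]
  ring

/-- A lower bound for the mass of an interval by its length times the density. -/
lemma normalTail_sub_ge {u v w : ℝ} (h : u ≤ v) (hw : ∀ x ∈ Set.Icc u v, |x| ≤ w) :
    (v - u) * (Real.exp (-w ^ 2 / 2) / 3) ≤ normalTail u - normalTail v := by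
  rw [normalTail_sub h, measureReal_def, gaussianReal_apply_eq_integral _ one_ne_zero,
    ENNReal.toReal_ofReal (integral_nonneg fun x => gaussianPDFReal_nonneg _ _ _)]
  have hc : ∫ _ in Set.Ioc u v, Real.exp (-w ^ 2 / 2) / 3 = (v - u) * (Real.exp (-w ^ 2 / 2) / 3) := by
    rw [setIntegral_const, measureReal_def, Real.volume_Ioc, ENNReal.toReal_ofReal (by linarith),
      smul_eq_mul]
  rw [← hc]
  refine setIntegral_mono_on ?_ (integrable_gaussianPDFReal 0 1).integrableOn measurableSet_Ioc
    fun x hx => ?_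
  · exact integrableOn_const (by simp)
  · have hxw := hw x ⟨hx.1.le, hx.2⟩
    have hsq : x ^ 2 ≤ w ^ 2 := sq_le_sq' (by linarith [neg_abs_le x]) ((le_abs_self x).trans hxw)
    have h3 : √(2 * Real.pi * 1) ≤ 3 := by
      rw [Real.sqrt_le_left (by norm_num)]
      linarith [Real.pi_lt_d2]
    have h0 : 0 < √(2 * Real.pi * 1) := Real.sqrt_pos.2 (by positivity)
    simp only [gaussianPDFReal, NNReal.coe_one, sub_zero]
    calc Real.exp (-w ^ 2 / 2) / 3 ≤ Real.exp (-x ^ 2 / (2 * 1)) / √(2 * Real.pi * 1) := by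
          refine div_le_div₀ (Real.exp_pos _).le (Real.exp_le_exp.2 (by linarith)) h0 h3
      _ = _ := div_eq_inv_mul _ _

lemma normalTail_strictAnti : StrictAnti normalTail := by
  intro u v h
  have := normalTail_sub_ge (w := max |u| |v|) h.le fun x hx => abs_le_max_abs_abs hx.1 hx.2
  have : 0 < (v - u) * (Real.exp (-(max |u| |v|) ^ 2 / 2) / 3) :=
    mul_pos (by linarith) (by positivity)
  linarith

lemma normalTail_ge {z : ℝ} (hz : 0 ≤ z) : Real.exp (-(z + 1) ^ 2 / 2) / 3 ≤ normalTail z := by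
  have h := normalTail_sub_ge (u := z) (v := z + 1) (w := z + 1) (by linarith) fun x hx =>
    abs_le.2 ⟨by linarith [hx.1], hx.2⟩
  have h1 : 0 ≤ normalTail (z + 1) := by rw [normalTail_eq_real]; positivity
  rw [add_sub_cancel_left, one_mul] at h
  linarith

lemma normalTail_le_exp {z : ℝ} (hz : 0 ≤ z) : normalTail z ≤ Real.exp (-z ^ 2 / 2) := by
  rw [normalTail_eq_real]
  have h := measure_ge_le_exp_mul_mgf (μ := gaussianReal 0 1) (X := fun x => x) z hz
    (integrable_exp_mul_gaussianReal z)
  rw [congrFun mgf_fun_id_gaussianReal z, ← Real.exp_add] at h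
  refine le_trans (measureReal_mono fun x (hx : z < x) => hx.le) (h.trans (le_of_eq ?_))
  congr 1; simp; ring

lemma normalTail_mem_Ioo (z : ℝ) : normalTail z ∈ Set.Ioo (0 : ℝ) 1 := by
  have h : ∀ x, normalTail x ∈ Set.Icc (0 : ℝ) 1 := fun x => by
    rw [normalTail_eq_real]; exact ⟨measureReal_nonneg, measureReal_le_one⟩
  exact ⟨(h (z + 1)).1.trans_lt (normalTail_strictAnti (by linarith)),
    (normalTail_strictAnti (by linarith : z - 1 < z)).trans_le (h _).2⟩

lemma continuous_normalTail : Continuous normalTail := by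
  refine continuous_iff_continuousAt.2 fun x => ?_
  rw [Metric.continuousAt_iff]
  have hbd : ∀ y z, y ≤ z → normalTail y - normalTail z ≤ z - y := by
    intro y z h
    rw [normalTail_sub h, measureReal_def, gaussianReal_apply_eq_integral _ one_ne_zero,
      ENNReal.toReal_ofReal (integral_nonneg fun x => gaussianPDFReal_nonneg _ _ _)]
    have hc : ∫ _ in Set.Ioc y z, (1 : ℝ) = z - y := by
      rw [setIntegral_const, measureReal_def, Real.volume_Ioc,
        ENNReal.toReal_ofReal (by linarith), smul_eq_mul, mul_one]
    rw [← hc]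
    refine setIntegral_mono_on (integrable_gaussianPDFReal 0 1).integrableOn
      (integrableOn_const (by simp)) measurableSet_Ioc fun x _ => ?_
    simp only [gaussianPDFReal, NNReal.coe_one, sub_zero]
    have h1 : 1 ≤ √(2 * Real.pi * 1) := by
      rw [Real.one_le_sqrt]; linarith [Real.pi_gt_three]
    exact mul_le_one₀ (inv_le_one_of_one_le₀ h1) (Real.exp_pos _).le
      (Real.exp_le_one_iff.2 (by have := sq_nonneg x; linarith))
  intro ε hε
  refine ⟨ε, hε, fun {y} hy => ?_⟩
  rw [Real.dist_eq] at hy ⊢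
  rcases le_total x y with h | h
  · rw [abs_of_nonneg (by linarith)] at hy
    have h2 := normalTail_strictAnti.antitone h
    rw [abs_of_nonpos (by linarith)]
    linarith [hbd x y h]
  · rw [abs_of_nonpos (by linarith)] at hy
    have h2 := normalTail_strictAnti.antitone h
    rw [abs_of_nonneg (by linarith)]
    linarith [hbd y x h]

lemma exists_normalTail_eq {q : ℝ} (hq : q ∈ Set.Ioo (0 : ℝ) 1) : ∃ z, normalTail z = q := by
  have hbot : Tendsto normalTail atBot (𝓝 (1 - 0)) :=
    tendsto_const_nhds.sub (tendsto_cdf_atBot _)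
  have htop : Tendsto normalTail atTop (𝓝 (1 - 1)) :=
    tendsto_const_nhds.sub (tendsto_cdf_atTop _)
  rw [sub_zero] at hbot
  rw [sub_self] at htop
  obtain ⟨u, hu⟩ := (hbot.eventually_const_lt hq.2).exists
  obtain ⟨v, hv⟩ := (htop.eventually_lt_const hq.1).exists
  exact mem_range_of_exists_le_of_exists_ge continuous_normalTail ⟨v, hv.le⟩ ⟨u, hu.le⟩

lemma normalTailInv_normalTail (z : ℝ) : normalTailInv (normalTail z) = z := by
  have : {x : ℝ | normalTail x ≤ normalTail z} = Set.Ici z := by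
    ext x
    exact normalTail_strictAnti.le_iff_ge
  rw [normalTailInv, this, csInf_Ici]

lemma normalTail_normalTailInv {q : ℝ} (hq : q ∈ Set.Ioo (0 : ℝ) 1) :
    normalTail (normalTailInv q) = q := by
  obtain ⟨z, rfl⟩ := exists_normalTail_eq hq
  rw [normalTailInv_normalTail]

lemma normalTailInv_lt_iff {q : ℝ} (hq : q ∈ Set.Ioo (0 : ℝ) 1) (y : ℝ) :
    normalTailInv q < y ↔ normalTail y < q := by
  obtain ⟨z, rfl⟩ := exists_normalTail_eq hq
  rw [normalTailInv_normalTail, normalTail_strictAnti.lt_iff_gt]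

lemma gaussianReal_real_Ioi (m z : ℝ) :
    (gaussianReal m 1).real (Set.Ioi z) = normalTail (z - m) := by
  have h := gaussianReal_map_add_const (μ := 0) (v := 1) m
  rw [zero_add] at h
  rw [← h, map_measureReal_apply (by fun_prop) measurableSet_Ioi, normalTail_eq_real]
  congr 1
  ext x
  simp [sub_lt_iff_lt_add]

/-! ### The joint law of the contrasts -/

lemma map_linear_pi_gaussianReal {n : ℕ} (w m : Fin n → ℝ) (hw : ∑ i, w i ^ 2 = 1) :
    (Measure.pi fun i => gaussianReal (m i) 1).map (fun x => ∑ i, w i * x i) =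
      gaussianReal (∑ i, w i * m i) 1 := by
  have hmeas : Measurable fun x : Fin n → ℝ => ∑ i, w i * x i := by fun_prop
  have := Measure.isProbabilityMeasure_map (μ := Measure.pi fun i => gaussianReal (m i) 1)
    hmeas.aemeasurable
  refine Measure.ext_of_charFun ?_
  ext t
  rw [charFun_gaussianReal, charFun_apply_real, integral_map hmeas.aemeasurable (by fun_prop)]
  have e : ∀ x : Fin n → ℝ, Complex.exp (t * (∑ i, w i * x i : ℝ) * Complex.I) =
      ∏ i, Complex.exp ((t * w i : ℝ) * x i * Complex.I) := by
    intro x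
    rw [← Complex.exp_sum]
    congr 1
    push_cast
    rw [Finset.mul_sum, Finset.sum_mul]
    exact Finset.sum_congr rfl fun i _ => by ring
  simp_rw [e]
  rw [integral_fintype_prod_eq_prod (fun i (x : ℝ) =>
    Complex.exp ((t * w i : ℝ) * x * Complex.I))]
  have e2 : ∀ i, ∫ x : ℝ, Complex.exp ((t * w i : ℝ) * x * Complex.I) ∂gaussianReal (m i) 1 =
      Complex.exp ((t * w i : ℝ) * m i * Complex.I - (1 : NNReal) * (t * w i : ℝ) ^ 2 / 2) := by
    intro i
    rw [← charFun_gaussianReal, charFun_apply_real]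
  simp_rw [e2]
  rw [← Complex.exp_sum]
  congr 1
  rw [Finset.sum_sub_distrib]
  congr 1
  · push_cast
    rw [Finset.mul_sum, Finset.sum_mul]
    exact Finset.sum_congr rfl fun i _ => by ring
  · have hw' : ∑ i, (w i : ℂ) ^ 2 = 1 := by exact_mod_cast hw
    calc ∑ i, ((1 : NNReal) : ℂ) * ((t * w i : ℝ) : ℂ) ^ 2 / 2
        = (∑ i, (w i : ℂ) ^ 2) * ((t : ℂ) ^ 2 / 2) := by
          rw [Finset.sum_mul]
          refine Finset.sum_congr rfl fun i _ => ?_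
          push_cast; ring
      _ = _ := by rw [hw']; push_cast; ring

/-- The coefficients of the linear statistic `contrast`. -/
def contrastWeight (n t : ℕ) (i : Fin n) : ℝ :=
  √((t : ℝ) * ((n : ℝ) - t) / n) * if (i : ℕ) < t then 1 / (t : ℝ) else -(1 / ((n : ℝ) - t))

lemma contrast_eq_sum {p n : ℕ} (X : Mat p n) (t : ℕ) (j : Fin p) :
    contrast X t j = ∑ i, contrastWeight n t i * X j i := by
  unfold contrast contrastWeight
  rw [Finset.mul_sum, Finset.mul_sum, Finset.sum_filter, Finset.sum_filter,
    ← Finset.sum_sub_distrib, Finset.mul_sum]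
  refine Finset.sum_congr rfl fun i _ => ?_
  by_cases h : (i : ℕ) < t
  · simp [h, not_le.2 h]; ring
  · simp [h, not_lt.1 h]; ring

lemma sum_step {n t : ℕ} (ht : t ≤ n) (c d : ℝ) :
    ∑ i : Fin n, (if (i : ℕ) < t then c else d) = t * c + (n - t) * d := by
  rw [Fin.sum_univ_eq_sum_range (fun i => if i < t then c else d) n, Finset.sum_ite]
  have e1 : (Finset.range n).filter (fun i => i < t) = Finset.range t := by
    ext i; simp only [Finset.mem_filter, Finset.mem_range]; omega
  have e2 : (Finset.range n).filter (fun i => ¬ i < t) = Finset.Ico t n := by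
    ext i; simp only [Finset.mem_filter, Finset.mem_range, Finset.mem_Ico]; omega
  rw [e1, e2, Finset.sum_const, Finset.sum_const, Finset.card_range, Nat.card_Ico, nsmul_eq_mul,
    nsmul_eq_mul, Nat.cast_sub ht]

lemma sum_contrastWeight_sq {n t : ℕ} (ht : 1 ≤ t) (htn : t < n) :
    ∑ i, contrastWeight n t i ^ 2 = 1 := by
  have h1 : (0 : ℝ) < t := by exact_mod_cast ht
  have h2 : (0 : ℝ) < n - t := by rw [sub_pos]; exact_mod_cast htn
  have h3 : (0 : ℝ) < n := by linarith
  have e : ∀ i : Fin n, contrastWeight n t i ^ 2 = (t : ℝ) * ((n : ℝ) - t) / n *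
      if (i : ℕ) < t then (1 / (t : ℝ)) ^ 2 else (1 / ((n : ℝ) - t)) ^ 2 := by
    intro i
    unfold contrastWeight
    rw [mul_pow, Real.sq_sqrt (by positivity)]
    split_ifs <;> ring
  simp only [e]
  rw [← Finset.mul_sum, sum_step htn.le]
  field_simp
  ring

/-- The contrasts of the rows at a fixed time are independent normal variables of variance one;
their means are the contrasts of the mean matrix. -/
lemma map_contrast_obsLaw {p n t : ℕ} (θ : Mat p n) (ht : 1 ≤ t) (htn : t < n) :
    (obsLaw θ).map (fun X => contrast X t) =
      Measure.pi fun j => gaussianReal (contrast θ t j) 1 := by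
  have e : (fun X : Mat p n => contrast X t) =
      fun X j => (fun x : Fin n → ℝ => ∑ i, contrastWeight n t i * x i) (X j) := by
    ext X j; exact contrast_eq_sum X t j
  have hrow : ∀ j, (Measure.pi fun i => gaussianReal (θ j i) 1).map
      (fun x : Fin n → ℝ => ∑ i, contrastWeight n t i * x i) =
      gaussianReal (contrast θ t j) 1 := fun j => by
    rw [map_linear_pi_gaussianReal _ _ (sum_contrastWeight_sq ht htn), contrast_eq_sum]
  have hm : Measurable fun x : Fin n → ℝ => ∑ i, contrastWeight n t i * x i := by fun_prop
  have h := Measure.pi_map_pi (μ := fun j => Measure.pi fun i => gaussianReal (θ j i) 1)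
    (f := fun _ x => ∑ i, contrastWeight n t i * x i)
    (hμ := fun j => by rw [hrow]; infer_instance) (fun j => hm.aemeasurable)
  rw [e, obsLaw, h]
  simp_rw [hrow]

lemma measurable_contrast {p n : ℕ} (t : ℕ) (j : Fin p) :
    Measurable fun X : Mat p n => contrast X t j := by
  simp only [contrast_eq_sum]; fun_prop

lemma contrast_of_rows_const {p n t : ℕ} (ht : 1 ≤ t) (htn : t < n) (X : Mat p n) (j : Fin p)
    (μ : ℝ) (h : ∀ i, X j i = μ) : contrast X t j = 0 := by
  have h1 : (0 : ℝ) < t := by exact_mod_cast ht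
  have h2 : (0 : ℝ) < n - t := by rw [sub_pos]; exact_mod_cast htn
  rw [contrast_eq_sum]
  simp only [h, contrastWeight]
  rw [← Finset.sum_mul, ← Finset.mul_sum, sum_step htn.le]
  field_simp
  ring

/-- The contrast, at a time `t` past the changepoint `t₀`, of a row with a step at `t₀`. -/
lemma contrast_of_step {p n t t₀ : ℕ} (ht₀ : t₀ ≤ t) (ht : 1 ≤ t) (htn : t < n) (X : Mat p n)
    (j : Fin p) (μ₁ μ₂ : ℝ) (h : ∀ i : Fin n, X j i = if (i : ℕ) < t₀ then μ₁ else μ₂) :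
    contrast X t j = √((t : ℝ) * ((n : ℝ) - t) / n) * (t₀ / t) * (μ₁ - μ₂) := by
  have h1 : (0 : ℝ) < t := by exact_mod_cast ht
  have h2 : (0 : ℝ) < n - t := by rw [sub_pos]; exact_mod_cast htn
  rw [contrast_eq_sum]
  have e : ∀ i : Fin n, contrastWeight n t i * X j i = √((t : ℝ) * ((n : ℝ) - t) / n) *
      ((if (i : ℕ) < t₀ then 1 / (t : ℝ) * (μ₁ - μ₂) else 0) +
        if (i : ℕ) < t then 1 / (t : ℝ) * μ₂ else -(1 / ((n : ℝ) - t)) * μ₂) := by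
    intro i
    rw [h, contrastWeight]
    split_ifs with h3 h4 h4
    · ring
    · ring
    · omega
    · ring
  simp only [e]
  rw [← Finset.mul_sum, Finset.sum_add_distrib, sum_step (by omega), sum_step htn.le]
  field_simp
  ring

/-! ### Tail bounds for the number of exceedances -/

open Classical in
/-- The number of coordinates which exceed `z`. -/
def exceedCount {p : ℕ} (z : ℝ) (y : Fin p → ℝ) : ℕ := (Finset.univ.filter fun j => z < y j).card

lemma exceedCount_le {p : ℕ} (z : ℝ) (y : Fin p → ℝ) : exceedCount z y ≤ p :=
  (Finset.card_le_univ _).trans_eq (Fintype.card_fin p)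

lemma exceedCount_anti {p : ℕ} {z z' : ℝ} (h : z ≤ z') (y : Fin p → ℝ) :
    exceedCount z' y ≤ exceedCount z y := by
  classical
  exact Finset.card_le_card fun j hj => by
    simp only [Finset.mem_filter, Finset.mem_univ, true_and] at hj ⊢
    exact h.trans_lt hj

lemma exceedFrac_eq {p n : ℕ} (X : Mat p n) (t : ℕ) (q : ℝ) :
    exceedFrac X t q = (exceedCount (normalTailInv q) (contrast X t) : ℝ) / p := by
  classical
  unfold exceedFrac exceedCount
  rw [Finset.sum_boole, one_div, ← div_eq_inv_mul]

open Classical in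
lemma prod_ite_exceed {p : ℕ} (z : ℝ) (y : Fin p → ℝ) (b c : ℝ) :
    ∏ j, (if z < y j then b else c) = b ^ exceedCount z y * c ^ (p - exceedCount z y) := by
  rw [Finset.prod_ite, Finset.prod_const, Finset.prod_const]
  congr 2
  have := Finset.card_filter_add_card_filter_not (s := (Finset.univ : Finset (Fin p)))
    (fun j => z < y j)
  rw [Finset.card_univ, Fintype.card_fin] at this
  unfold exceedCount
  omega

lemma measurable_exceedCount {p : ℕ} (z : ℝ) :
    Measurable (exceedCount z : (Fin p → ℝ) → ℕ) := by
  classical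
  unfold exceedCount
  simp only [Finset.card_filter]
  refine Finset.measurable_sum _ fun j _ => ?_
  exact Measurable.ite (measurableSet_lt measurable_const (measurable_pi_apply j))
    measurable_const measurable_const

/-- The generating function of the number of exceedances, for independent coordinates. -/
lemma integral_pow_exceedCount {p : ℕ} (ν : Fin p → Measure ℝ) [∀ j, IsProbabilityMeasure (ν j)]
    (z b c : ℝ) :
    Integrable (fun y => b ^ exceedCount z y * c ^ (p - exceedCount z y)) (Measure.pi ν) ∧
    ∫ y, b ^ exceedCount z y * c ^ (p - exceedCount z y) ∂Measure.pi ν =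
      ∏ j, (b * (ν j).real (Set.Ioi z) + c * (1 - (ν j).real (Set.Ioi z))) := by
  classical
  simp only [← prod_ite_exceed]
  have hite : ∀ x : ℝ, (if z < x then b else c) =
      (Set.Ioi z).indicator (fun _ => b) x + (Set.Ioi z)ᶜ.indicator (fun _ => c) x := by
    intro x
    by_cases h : z < x <;> simp [-Set.compl_Ioi, h]
  have hi1 : ∀ j, Integrable ((Set.Ioi z).indicator (fun _ => b)) (ν j) := fun j =>
    (integrable_const b).indicator measurableSet_Ioi
  have hi2 : ∀ j, Integrable ((Set.Ioi z)ᶜ.indicator (fun _ => c)) (ν j) := fun j =>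
    (integrable_const c).indicator measurableSet_Ioi.compl
  constructor
  · refine Integrable.fintype_prod_dep (f := fun _ (x : ℝ) => if z < x then b else c) fun j => ?_
    simp only [hite]
    exact (hi1 j).add (hi2 j)
  · rw [integral_fintype_prod_eq_prod (fun _ (x : ℝ) => if z < x then b else c)]
    refine Finset.prod_congr rfl fun j _ => ?_
    simp only [hite]
    rw [integral_add (hi1 j) (hi2 j), integral_indicator measurableSet_Ioi,
      integral_indicator measurableSet_Ioi.compl, setIntegral_const, setIntegral_const,
      probReal_compl_eq_one_sub measurableSet_Ioi, smul_eq_mul, smul_eq_mul]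
    ring

lemma exp_mul_bernKL {p k : ℕ} (hp : 0 < p) (hk : k ≤ p) {q : ℝ} (hq : q ∈ Set.Ioo (0 : ℝ) 1) :
    Real.exp (p * bernKL (k / p) q) =
      ((k / p : ℝ) / q) ^ k * ((1 - (k / p : ℝ)) / (1 - q)) ^ (p - k) := by
  have hp0 : (0 : ℝ) < p := by exact_mod_cast hp
  have hkp : (k : ℝ) ≤ p := by exact_mod_cast hk
  have hq1 : 0 < 1 - q := by linarith [hq.2]
  have aux : ∀ (x : ℝ) (m : ℕ), (0 < x ∨ m = 0) → Real.exp (m * Real.log x) = x ^ m := by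
    rintro x m (h | h)
    · rw [Real.exp_nat_mul, Real.exp_log h]
    · simp [h]
  rw [← aux _ k, ← aux _ (p - k), ← Real.exp_add]
  · congr 1
    unfold bernKL
    rw [Nat.cast_sub hk]
    field_simp
  · rcases hk.lt_or_eq with h | h
    · left
      have : (k : ℝ) < p := by exact_mod_cast h
      refine div_pos ?_ hq1
      rw [sub_pos, div_lt_one hp0]; exact this
    · right; omega
  · rcases Nat.eq_zero_or_pos k with h | h
    · right; exact h
    · left
      have : (0 : ℝ) < k := by exact_mod_cast h
      exact div_pos (div_pos this hp0) hq.1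

/-- Markov's inequality for the likelihood ratio of the Bernoulli laws with parameters `k / p`
and `q`: an event on which this ratio is at least its value for `k` exceedances has
probability at most `exp (-p K(k / p, q))`. -/
lemma real_le_exp_neg_bernKL {p k : ℕ} (hp : 0 < p) (hk : k ≤ p) {q : ℝ}
    (hq : q ∈ Set.Ioo (0 : ℝ) 1) (ν : Fin p → Measure ℝ) [∀ j, IsProbabilityMeasure (ν j)] (z : ℝ)
    (hν : ∀ j, (ν j).real (Set.Ioi z) = q) (E : Set (Fin p → ℝ))
    (hE : ∀ y ∈ E, ((k / p : ℝ) / q) ^ k * ((1 - (k / p : ℝ)) / (1 - q)) ^ (p - k) ≤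
      ((k / p : ℝ) / q) ^ exceedCount z y *
        ((1 - (k / p : ℝ)) / (1 - q)) ^ (p - exceedCount z y)) :
    (Measure.pi ν).real E ≤ Real.exp (-(p * bernKL (k / p) q)) := by
  have hp0 : (0 : ℝ) < p := by exact_mod_cast hp
  have hkp : (k : ℝ) ≤ p := by exact_mod_cast hk
  have hq1 : 0 < 1 - q := by linarith [hq.2]
  have hq0 := hq.1
  have hx1 : 0 ≤ 1 - (k : ℝ) / p := by rw [sub_nonneg, div_le_one hp0]; exact hkp
  obtain ⟨hi, hint⟩ := integral_pow_exceedCount ν z ((k / p : ℝ) / q)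
    ((1 - (k / p : ℝ)) / (1 - q))
  have hone : ∏ j, ((k / p : ℝ) / q * (ν j).real (Set.Ioi z) +
      (1 - (k / p : ℝ)) / (1 - q) * (1 - (ν j).real (Set.Ioi z))) = 1 := by
    refine Finset.prod_eq_one fun j _ => ?_
    rw [hν]
    field_simp
    ring
  rw [hone] at hint
  have hM := mul_meas_ge_le_integral_of_nonneg (ae_of_all _ fun y => by positivity) hi
    (Real.exp (p * bernKL (k / p) q))
  rw [hint] at hM
  rw [Real.exp_neg, ← one_div, le_div_iff₀ (Real.exp_pos _), mul_comm]
  refine le_trans ?_ hM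
  gcongr
  · exact measure_ne_top _ _
  · intro y hy
    simp only [Set.mem_ofPred_eq]
    rw [exp_mul_bernKL hp hk hq]
    exact hE y hy

lemma real_le_exceedCount {p k : ℕ} (hp : 0 < p) (hk : k ≤ p) {q : ℝ}
    (hq : q ∈ Set.Ioo (0 : ℝ) 1) (ν : Fin p → Measure ℝ) [∀ j, IsProbabilityMeasure (ν j)] (z : ℝ)
    (hν : ∀ j, (ν j).real (Set.Ioi z) = q) (hqk : q ≤ k / p) :
    (Measure.pi ν).real {y | k ≤ exceedCount z y} ≤ Real.exp (-(p * bernKL (k / p) q)) := by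
  have hp0 : (0 : ℝ) < p := by exact_mod_cast hp
  have hkp : (k : ℝ) ≤ p := by exact_mod_cast hk
  have hq1 : 0 < 1 - q := by linarith [hq.2]
  have hq0 := hq.1
  have hx1 : 0 ≤ 1 - (k : ℝ) / p := by rw [sub_nonneg, div_le_one hp0]; exact hkp
  refine real_le_exp_neg_bernKL hp hk hq ν z hν _ fun y (hy : k ≤ _) => ?_
  refine mul_le_mul (pow_le_pow_right₀ ((one_le_div hq0).2 hqk) hy)
    (pow_le_pow_of_le_one (by positivity) ((div_le_one hq1).2 (by linarith)) (by omega))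
    (by positivity) (by positivity)

lemma real_exceedCount_le {p k : ℕ} (hp : 0 < p) (hk : k ≤ p) {q : ℝ}
    (hq : q ∈ Set.Ioo (0 : ℝ) 1) (ν : Fin p → Measure ℝ) [∀ j, IsProbabilityMeasure (ν j)] (z : ℝ)
    (hν : ∀ j, (ν j).real (Set.Ioi z) = q) (hqk : k / p ≤ q) :
    (Measure.pi ν).real {y | exceedCount z y ≤ k} ≤ Real.exp (-(p * bernKL (k / p) q)) := by
  have hp0 : (0 : ℝ) < p := by exact_mod_cast hp
  have hkp : (k : ℝ) ≤ p := by exact_mod_cast hk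
  have hq1 : 0 < 1 - q := by linarith [hq.2]
  have hq0 := hq.1
  have hx1 : 0 ≤ 1 - (k : ℝ) / p := by rw [sub_nonneg, div_le_one hp0]; exact hkp
  refine real_le_exp_neg_bernKL hp hk hq ν z hν _ fun y (hy : _ ≤ k) => ?_
  refine mul_le_mul (pow_le_pow_of_le_one (by positivity) ((div_le_one hq0).2 hqk) hy)
    (pow_le_pow_right₀ ((one_le_div hq1).2 (by linarith)) (by omega))
    (by positivity) (by positivity)

lemma exp_neg_le_quadratic {x : ℝ} (hx : 0 ≤ x) : Real.exp (-x) ≤ 1 - x + x ^ 2 / 2 := by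
  have h := Real.quadratic_le_exp_of_nonneg hx
  rw [Real.exp_neg, inv_le_iff_one_le_mul₀ (Real.exp_pos _)]
  have h1 : 0 < 1 - x + x ^ 2 / 2 := by nlinarith [sq_nonneg (x - 1)]
  have h2 : 0 ≤ x ^ 4 := by positivity
  nlinarith [mul_le_mul_of_nonneg_left h h1.le]

/-- A Chernoff bound for the lower tail of the number of exceedances. -/
lemma real_exceedCount_le_of_sum {p : ℕ} (ν : Fin p → Measure ℝ)
    [∀ j, IsProbabilityMeasure (ν j)] {z A D : ℝ} (hA : 0 < A) (hD : 0 ≤ D)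
    (hsum : A ≤ ∑ j, (ν j).real (Set.Ioi z)) :
    (Measure.pi ν).real {y | (exceedCount z y : ℝ) ≤ A - D / 2} ≤
      Real.exp (-(D ^ 2 / (8 * A))) := by
  set l := D / (2 * A) with hl
  have hl0 : 0 ≤ l := by positivity
  obtain ⟨hi, hint⟩ := integral_pow_exceedCount ν z (Real.exp (-l)) 1
  simp only [one_pow, mul_one, one_mul] at hi hint
  have hM := mul_meas_ge_le_integral_of_nonneg (ae_of_all _ fun y => by positivity) hi
    (Real.exp (-(l * (A - D / 2))))
  rw [hint] at hM
  have hle : ∏ j, (Real.exp (-l) * (ν j).real (Set.Ioi z) + (1 - (ν j).real (Set.Ioi z))) ≤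
      Real.exp (-(l - l ^ 2 / 2) * A) := by
    have hpos : 0 ≤ 1 - Real.exp (-l) := by
      rw [sub_nonneg]; exact Real.exp_le_one_iff.2 (by linarith)
    calc ∏ j, (Real.exp (-l) * (ν j).real (Set.Ioi z) + (1 - (ν j).real (Set.Ioi z)))
        ≤ ∏ j, Real.exp (-(1 - Real.exp (-l)) * (ν j).real (Set.Ioi z)) := by
          refine Finset.prod_le_prod (fun j _ => ?_) fun j _ => ?_
          · have h1 : (ν j).real (Set.Ioi z) ≤ 1 := measureReal_le_one
            have h2 : 0 ≤ (ν j).real (Set.Ioi z) := measureReal_nonneg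
            have := mul_nonneg (Real.exp_pos (-l)).le h2
            linarith
          · have := Real.add_one_le_exp (-(1 - Real.exp (-l)) * (ν j).real (Set.Ioi z))
            linarith
      _ = Real.exp (-(1 - Real.exp (-l)) * ∑ j, (ν j).real (Set.Ioi z)) := by
          rw [← Real.exp_sum, Finset.mul_sum]
      _ ≤ _ := by
          apply Real.exp_le_exp.2
          have h1 := exp_neg_le_quadratic hl0
          have h2 := mul_le_mul_of_nonneg_left hsum hpos
          have h3 : (l - l ^ 2 / 2) * A ≤ (1 - Real.exp (-l)) * A :=
            mul_le_mul_of_nonneg_right (by linarith) hA.le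
          linarith
  have hsub : (Measure.pi ν).real {y | (exceedCount z y : ℝ) ≤ A - D / 2} ≤
      (Measure.pi ν).real {y | Real.exp (-(l * (A - D / 2))) ≤
        Real.exp (-l) ^ exceedCount z y} := by
    refine measureReal_mono fun y (hy : (exceedCount z y : ℝ) ≤ _) => ?_
    simp only [Set.mem_ofPred_eq]
    rw [← Real.exp_nat_mul]
    apply Real.exp_le_exp.2
    nlinarith
  have h3 := (mul_le_mul_of_nonneg_left hsub (Real.exp_pos (-(l * (A - D / 2)))).le).trans
    (hM.trans hle)
  rw [mul_comm, ← le_div_iff₀ (Real.exp_pos _), ← Real.exp_sub] at h3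
  refine h3.trans (le_of_eq ?_)
  congr 1
  rw [hl]
  field_simp
  ring

/-! ### The rejection region of the penalised Berk-Jones test -/

lemma continuousAt_bernKL (x : ℝ) {q : ℝ} (hq : q ∈ Set.Ioo (0 : ℝ) 1) :
    ContinuousAt (fun r => bernKL x r) q := by
  have hq0 : q ≠ 0 := hq.1.ne'
  have hq1 : 1 - q ≠ 0 := by linarith [hq.2]
  unfold bernKL
  by_cases hx : x = 0
  · subst hx
    simp only [zero_div, Real.log_zero, mul_zero, sub_zero, zero_add, one_mul]
    exact (continuousAt_const.div (by fun_prop) hq1).log (div_ne_zero one_ne_zero hq1)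
  by_cases hx1 : x = 1
  · subst hx1
    simp only [sub_self, zero_div, Real.log_zero, mul_zero, add_zero, one_mul]
    exact (continuousAt_const.div (by fun_prop) hq0).log (div_ne_zero one_ne_zero hq0)
  · have hx1' : 1 - x ≠ 0 := sub_ne_zero.2 (Ne.symm hx1)
    exact (continuousAt_const.mul ((continuousAt_const.div (by fun_prop) hq0).log
      (div_ne_zero hx hq0))).add (continuousAt_const.mul
      ((continuousAt_const.div (by fun_prop) hq1).log (div_ne_zero hx1' hq1)))

lemma normalTailInv_anti {q r : ℝ} (hq : q ∈ Set.Ioo (0 : ℝ) 1) (hr : r ∈ Set.Ioo (0 : ℝ) 1)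
    (h : q ≤ r) : normalTailInv r ≤ normalTailInv q := by
  rw [← normalTail_strictAnti.le_iff_ge, normalTail_normalTailInv hq, normalTail_normalTailInv hr]
  exact h

/-- The exceedance count is left-continuous in the level, and the divergence is continuous, so
the supremum over the levels in the statistic may be restricted to rational levels. -/
lemma exists_rat_lt_bernKL {p n : ℕ} (X : Mat p n) (t : ℕ) {d q : ℝ}
    (hq : q ∈ Set.Ioo (0 : ℝ) 1) (h : d < p * bernKL (exceedFrac X t q) q) :
    ∃ r : ℚ, (r : ℝ) ∈ Set.Ioo (0 : ℝ) 1 ∧ d < p * bernKL (exceedFrac X t r) r := by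
  have h1 : ∀ᶠ r in 𝓝[<] q, d < p * bernKL (exceedFrac X t q) r :=
    ((continuousAt_const.mul (continuousAt_bernKL _ hq)).eventually_const_lt h).filter_mono
      nhdsWithin_le_nhds
  have h2 : ∀ᶠ r in 𝓝[<] q, ∀ j, normalTail (contrast X t j) < q →
      normalTail (contrast X t j) < r := by
    rw [eventually_all]
    intro j
    by_cases hj : normalTail (contrast X t j) < q
    · exact ((eventually_gt_nhds hj).filter_mono nhdsWithin_le_nhds).mono fun r hr _ => hr
    · exact Eventually.of_forall fun r h => absurd h hj
  have h3 : ∀ᶠ r in 𝓝[<] q, 0 < r :=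
    (eventually_gt_nhds hq.1).filter_mono nhdsWithin_le_nhds
  have h4 := (h1.and (h2.and h3))
  rw [eventually_iff, mem_nhdsLT_iff_exists_Ioo_subset] at h4
  obtain ⟨l, hl, hsub⟩ := h4
  obtain ⟨r, hr1, hr2⟩ := exists_rat_btwn (Set.mem_Iio.1 hl)
  obtain ⟨g1, g2, g3⟩ := hsub ⟨hr1, hr2⟩
  have hr : (r : ℝ) ∈ Set.Ioo (0 : ℝ) 1 := ⟨g3, hr2.trans hq.2⟩
  refine ⟨r, hr, ?_⟩
  have e : exceedFrac X t r = exceedFrac X t q := by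
    rw [exceedFrac_eq, exceedFrac_eq]
    unfold exceedCount
    simp only [normalTailInv_lt_iff hr, normalTailInv_lt_iff hq]
    congr 3
    ext j
    simp only [Finset.mem_filter, Finset.mem_univ, true_and]
    exact ⟨fun h => h.trans hr2, g2 j⟩
  rw [e]
  exact g1

lemma lt_pbjStat_iff {p n : ℕ} (X : Mat p n) (c : ℝ) :
    (c : EReal) < pbjStat X ↔ ∃ t ∈ grid n, ∃ r : ℚ, (r : ℝ) ∈ Set.Ioo (0 : ℝ) 1 ∧
      c + 2 * Real.log (grid n).card < p * bernKL (exceedFrac X t r) r := by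
  unfold pbjStat
  rw [EReal.lt_sub_iff_add_lt (Or.inl (EReal.coe_ne_bot _)) (Or.inl (EReal.coe_ne_top _)),
    ← EReal.coe_add]
  simp only [lt_iSup_iff, EReal.coe_lt_coe_iff]
  constructor
  · rintro ⟨t, ht, q, hq, h⟩
    obtain ⟨r, hr, h'⟩ := exists_rat_lt_bernKL X t hq h
    exact ⟨t, ht, r, hr, h'⟩
  · rintro ⟨t, ht, r, hr, h⟩
    exact ⟨t, ht, r, hr, h⟩

/-- The level of the test, with the penalty included. -/
def pbjThreshold (γ : ℝ) (p n : ℕ) : ℝ :=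
  2 * (2 + γ) * Real.log p + 2 * Real.log (grid n).card

/-- The rejection region of the test. -/
def rejectSet (γ : ℝ) (p n : ℕ) : Set (Mat p n) :=
  {X | ∃ t ∈ grid n, ∃ r : ℚ, (r : ℝ) ∈ Set.Ioo (0 : ℝ) 1 ∧
    pbjThreshold γ p n < p * bernKL (exceedFrac X t r) r}

lemma pbjTest_eq_indicator (γ : ℝ) {p n : ℕ} :
    (pbjTest γ : Mat p n → ℝ) = (rejectSet γ p n).indicator fun _ => 1 := by
  classical
  ext X
  unfold pbjTest
  rw [Set.indicator_apply]
  refine if_congr ?_ rfl rfl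
  rw [lt_pbjStat_iff]
  rfl

lemma measurable_exceedFrac {p n : ℕ} (t : ℕ) (q : ℝ) :
    Measurable fun X : Mat p n => exceedFrac X t q := by
  simp only [exceedFrac_eq]
  have h1 : Measurable fun X : Mat p n => contrast X t :=
    measurable_pi_lambda _ fun j => measurable_contrast t j
  have h2 : Measurable fun X : Mat p n => exceedCount (normalTailInv q) (contrast X t) :=
    (measurable_exceedCount _).comp h1
  exact (measurable_from_top (f := fun k : ℕ => (k : ℝ) / p)).comp h2

lemma measurableSet_rejectSet (γ : ℝ) (p n : ℕ) : MeasurableSet (rejectSet γ p n) := by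
  have e : rejectSet γ p n = ⋃ t ∈ grid n, ⋃ r : ℚ, ⋃ _ : (r : ℝ) ∈ Set.Ioo (0 : ℝ) 1,
      {X | pbjThreshold γ p n < p * bernKL (exceedFrac X t r) r} := by
    ext X
    simp only [rejectSet, Set.mem_iUnion, exists_prop]
    rfl
  rw [e]
  refine Finset.measurableSet_biUnion _ fun t _ => MeasurableSet.iUnion fun r =>
    MeasurableSet.iUnion fun _ => measurableSet_lt measurable_const ?_
  have := measurable_exceedFrac (p := p) (n := n) t r
  unfold bernKL
  fun_prop

lemma isTest_pbjTest (γ : ℝ) (p n : ℕ) : IsTest (pbjTest γ : Mat p n → ℝ) := by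
  rw [pbjTest_eq_indicator]
  refine ⟨measurable_const.indicator (measurableSet_rejectSet γ p n), fun X => ?_⟩
  by_cases h : X ∈ rejectSet γ p n <;> simp [h]

lemma integral_pbjTest (γ : ℝ) {p n : ℕ} (θ : Mat p n) :
    ∫ X, pbjTest γ X ∂obsLaw θ = (obsLaw θ).real (rejectSet γ p n) := by
  rw [pbjTest_eq_indicator, integral_indicator (measurableSet_rejectSet γ p n)]
  simp

lemma integral_one_sub_pbjTest (γ : ℝ) {p n : ℕ} (θ : Mat p n) :
    ∫ X, (1 - pbjTest γ X) ∂obsLaw θ = (obsLaw θ).real (rejectSet γ p n)ᶜ := by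
  rw [probReal_compl_eq_one_sub (measurableSet_rejectSet γ p n), ← integral_pbjTest,
    integral_sub (integrable_const _)]
  · simp
  · rw [pbjTest_eq_indicator]
    exact (integrable_const _).indicator (measurableSet_rejectSet γ p n)

/-! ### The Type I error -/

/-- Uniformly over the levels: for `k` exceedances the levels at which the divergence is large
form two families over which the exceedance events are monotone, so that the Chernoff bound for a
single level also holds for their unions. -/
lemma measure_exists_level_le {p k : ℕ} (hp : 0 < p) (hk : k ≤ p) (d : ℝ) :
    (Measure.pi fun _ : Fin p => gaussianReal 0 1)
      {y | ∃ r : ℚ, (r : ℝ) ∈ Set.Ioo (0 : ℝ) 1 ∧ exceedCount (normalTailInv r) y = k ∧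
        d < p * bernKL (k / p) r} ≤ 2 * ENNReal.ofReal (Real.exp (-d)) := by
  set μ := Measure.pi fun _ : Fin p => gaussianReal 0 1
  have hlevel : ∀ r : ℝ, r ∈ Set.Ioo (0 : ℝ) 1 → ∀ _ : Fin p,
      (gaussianReal 0 1).real (Set.Ioi (normalTailInv r)) = r := fun r hr _ => by
    rw [← normalTail_eq_real, normalTail_normalTailInv hr]
  set U : Set ℚ := {r | (r : ℝ) ∈ Set.Ioo (0 : ℝ) 1 ∧ (r : ℝ) ≤ k / p ∧ d < p * bernKL (k / p) r}
  set V : Set ℚ := {r | (r : ℝ) ∈ Set.Ioo (0 : ℝ) 1 ∧ k / p ≤ (r : ℝ) ∧ d < p * bernKL (k / p) r}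
  have hsub : {y : Fin p → ℝ | ∃ r : ℚ, (r : ℝ) ∈ Set.Ioo (0 : ℝ) 1 ∧
      exceedCount (normalTailInv r) y = k ∧ d < p * bernKL (k / p) r} ⊆
      (⋃ r ∈ U, {y | k ≤ exceedCount (normalTailInv r) y}) ∪
        ⋃ r ∈ V, {y | exceedCount (normalTailInv r) y ≤ k} := by
    rintro y ⟨r, hr, hy, hd⟩
    rcases le_total (r : ℝ) (k / p) with h | h
    · left
      exact Set.mem_biUnion (show r ∈ U from ⟨hr, h, hd⟩) hy.ge
    · right
      exact Set.mem_biUnion (show r ∈ V from ⟨hr, h, hd⟩) hy.le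
  have hofReal : ∀ E : Set (Fin p → ℝ), ∀ x : ℝ, d < x → μ.real E ≤ Real.exp (-x) →
      μ E ≤ ENNReal.ofReal (Real.exp (-d)) := by
    intro E x hx hE
    rw [← ofReal_measureReal (measure_ne_top _ _)]
    apply ENNReal.ofReal_le_ofReal
    exact hE.trans (Real.exp_le_exp.2 (by linarith))
  have hmono : ∀ r r' : ℚ, (r : ℝ) ∈ Set.Ioo (0 : ℝ) 1 → (r' : ℝ) ∈ Set.Ioo (0 : ℝ) 1 → r ≤ r' →
      ∀ y : Fin p → ℝ, exceedCount (normalTailInv r) y ≤ exceedCount (normalTailInv r') y :=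
    fun r r' hr hr' h y => exceedCount_anti (normalTailInv_anti hr hr' (by exact_mod_cast h)) y
  refine (measure_mono hsub).trans ((measure_union_le _ _).trans ?_)
  rw [two_mul]
  refine add_le_add ?_ ?_
  · rw [measure_biUnion_eq_iSup (Set.to_countable U)]
    · refine iSup₂_le fun r hr => hofReal _ _ hr.2.2 ?_
      exact real_le_exceedCount hp hk hr.1 _ _ (hlevel r hr.1) hr.2.1
    · intro r hr r' hr'
      rcases le_total r r' with h | h
      · exact ⟨r', hr', fun y (hy : k ≤ _) => hy.trans (hmono r r' hr.1 hr'.1 h y),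
          fun y hy => hy⟩
      · exact ⟨r, hr, fun y hy => hy,
          fun y (hy : k ≤ _) => hy.trans (hmono r' r hr'.1 hr.1 h y)⟩
  · rw [measure_biUnion_eq_iSup (Set.to_countable V)]
    · refine iSup₂_le fun r hr => hofReal _ _ hr.2.2 ?_
      exact real_exceedCount_le hp hk hr.1 _ _ (hlevel r hr.1) hr.2.1
    · intro r hr r' hr'
      rcases le_total r r' with h | h
      · exact ⟨r, hr, fun y hy => hy,
          fun y (hy : _ ≤ k) => (hmono r r' hr.1 hr'.1 h y).trans hy⟩
      · exact ⟨r', hr', fun y (hy : _ ≤ k) => (hmono r' r hr'.1 hr.1 h y).trans hy,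
          fun y hy => hy⟩

/-- A union bound over the grid and over the number of exceedances. -/
lemma typeI_le {γ : ℝ} {p n : ℕ} (hp : 0 < p) (hgrid : ∀ t ∈ grid n, 1 ≤ t ∧ t < n)
    {θ : Mat p n} (hθ : θ ∈ nullSpace p n) :
    ∫ X, pbjTest γ X ∂obsLaw θ ≤
      (grid n).card * ((p + 1) * (2 * Real.exp (-pbjThreshold γ p n))) := by
  obtain ⟨m, hm⟩ := hθ
  set d := pbjThreshold γ p n with hd
  rw [integral_pbjTest]
  set F : ℕ → Set (Fin p → ℝ) := fun k =>
    {y | ∃ r : ℚ, (r : ℝ) ∈ Set.Ioo (0 : ℝ) 1 ∧ exceedCount (normalTailInv r) y = k ∧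
        d < p * bernKL (k / p) r} with hF
  have hFm : ∀ k, MeasurableSet (F k) := by
    intro k
    have e : F k = ⋃ r : ℚ, {y | exceedCount (normalTailInv r) y = k} ∩
        {_y | (r : ℝ) ∈ Set.Ioo (0 : ℝ) 1 ∧ d < p * bernKL (k / p) r} := by
      ext y; simp [hF]; constructor <;> rintro ⟨r, h⟩ <;> exact ⟨r, by tauto⟩
    rw [e]
    exact MeasurableSet.iUnion fun r =>
      (measurable_exceedCount _ (measurableSet_singleton k)).inter (MeasurableSet.const _)
  have hsub : rejectSet γ p n ⊆
      ⋃ t ∈ grid n, ⋃ k ∈ Finset.range (p + 1), (fun X : Mat p n => contrast X t) ⁻¹' F k := by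
    rintro X ⟨t, ht, r, hr, h⟩
    simp only [Set.mem_iUnion]
    refine ⟨t, ht, exceedCount (normalTailInv r) (contrast X t), ?_, r, hr, rfl, ?_⟩
    · have := exceedCount_le (normalTailInv r) (contrast X t)
      simp; omega
    · rwa [exceedFrac_eq] at h
  have hE : ∀ t ∈ grid n, ∀ k ∈ Finset.range (p + 1),
      (obsLaw θ).real ((fun X : Mat p n => contrast X t) ⁻¹' F k) ≤ 2 * Real.exp (-d) := by
    intro t ht k hk
    obtain ⟨h1, h2⟩ := hgrid t ht
    rw [← map_measureReal_apply (measurable_pi_lambda _ fun j => measurable_contrast t j)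
      (hFm k), map_contrast_obsLaw θ h1 h2]
    have hz : ∀ j, contrast θ t j = 0 := fun j => contrast_of_rows_const h1 h2 θ j (m j) (hm j)
    simp only [hz]
    refine ENNReal.toReal_le_of_le_ofReal (by positivity) ?_
    rw [ENNReal.ofReal_mul (by norm_num), ENNReal.ofReal_ofNat]
    exact measure_exists_level_le hp (by simpa [Nat.lt_succ_iff] using hk) d
  calc (obsLaw θ).real (rejectSet γ p n)
      ≤ (obsLaw θ).real (⋃ t ∈ grid n, ⋃ k ∈ Finset.range (p + 1),
          (fun X : Mat p n => contrast X t) ⁻¹' F k) := measureReal_mono hsub (measure_ne_top _ _)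
    _ ≤ ∑ t ∈ grid n, (obsLaw θ).real (⋃ k ∈ Finset.range (p + 1),
          (fun X : Mat p n => contrast X t) ⁻¹' F k) := measureReal_biUnion_finset_le _ _
    _ ≤ ∑ t ∈ grid n, ∑ k ∈ Finset.range (p + 1), (obsLaw θ).real
          ((fun X : Mat p n => contrast X t) ⁻¹' F k) :=
        Finset.sum_le_sum fun t _ => measureReal_biUnion_finset_le _ _
    _ ≤ ∑ t ∈ grid n, ∑ k ∈ Finset.range (p + 1), 2 * Real.exp (-d) :=
        Finset.sum_le_sum fun t ht => Finset.sum_le_sum fun k hk => hE t ht k hk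
    _ = _ := by
      simp only [Finset.sum_const, Finset.card_range, nsmul_eq_mul]
      push_cast; ring

/-! ### The Type II error -/

/-- The Kullback-Leibler divergence between Poisson laws with means `x` and `q`; a convenient
lower bound for `bernKL x q`. -/
def poissonKL (x q : ℝ) : ℝ := x * Real.log (x / q) - x + q

lemma poissonKL_le_bernKL {x q : ℝ} (hx : x ≤ 1) (hq : q ∈ Set.Ioo (0 : ℝ) 1) :
    poissonKL x q ≤ bernKL x q := by
  have hq1 : 0 < 1 - q := by linarith [hq.2]
  unfold poissonKL bernKL
  suffices q - x ≤ (1 - x) * Real.log ((1 - x) / (1 - q)) by linarith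
  rcases hx.eq_or_lt with rfl | hx
  · simp; exact hq.2.le
  · have hx1 : 0 < 1 - x := by linarith
    have h := Real.one_sub_inv_le_log_of_pos (div_pos hx1 hq1)
    calc q - x = (1 - x) * (1 - ((1 - x) / (1 - q))⁻¹) := by field_simp; ring
      _ ≤ _ := by gcongr

lemma poissonKL_mono {x y q : ℝ} (hq : 0 < q) (hqx : q ≤ x) (hxy : x ≤ y) :
    poissonKL x q ≤ poissonKL y q := by
  have hx : 0 < x := hq.trans_le hqx
  have hy : 0 < y := hx.trans_le hxy
  have h1 : Real.log (y / q) = Real.log (y / x) + Real.log (x / q) := by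
    rw [← Real.log_mul (by positivity) (by positivity)]; congr 1; field_simp
  have h2 : y - x ≤ y * Real.log (y / x) := by
    have h := Real.one_sub_inv_le_log_of_pos (div_pos hy hx)
    calc y - x = y * (1 - (y / x)⁻¹) := by field_simp
      _ ≤ _ := by gcongr
  have h3 : 0 ≤ (y - x) * Real.log (x / q) :=
    mul_nonneg (by linarith) (Real.log_nonneg ((one_le_div hq).2 hqx))
  unfold poissonKL
  rw [h1]
  linarith

lemma sq_sub_div_le_poissonKL {x q : ℝ} (hq : 0 < q) (hqx : q ≤ x) :
    (x - q) ^ 2 / (4 * x) ≤ poissonKL x q := by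
  have hx : 0 < x := hq.trans_le hqx
  have hsx := Real.sqrt_pos.2 hx
  have hsq := Real.sqrt_pos.2 hq
  have ex := Real.sq_sqrt hx.le
  have eq := Real.sq_sqrt hq.le
  -- The divergence dominates the squared Hellinger distance `(√x - √q) ^ 2`.
  have h1 : (√x - √q) ^ 2 ≤ poissonKL x q := by
    have h := Real.one_sub_inv_le_log_of_pos (div_pos hsx hsq)
    have e : Real.log (x / q) = 2 * Real.log (√x / √q) := by
      rw [← Real.sqrt_div hx.le, Real.log_sqrt (by positivity)]; ring
    unfold poissonKL
    rw [e]
    have h2 : x * (2 * (1 - (√x / √q)⁻¹)) ≤ x * (2 * Real.log (√x / √q)) := by gcongr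
    have h3 : x * (2 * (1 - (√x / √q)⁻¹)) = 2 * x - 2 * (√x * √q) := by
      rw [inv_div]
      nth_rewrite 1 [← ex]
      field_simp
      linear_combination ex
    nlinarith
  refine le_trans ?_ h1
  have hle : √q ≤ √x := Real.sqrt_le_sqrt hqx
  rw [div_le_iff₀ (by positivity)]
  have e2 : (x - q) ^ 2 = (√x - √q) ^ 2 * (√x + √q) ^ 2 := by
    rw [← mul_pow]; congr 1; nlinarith
  rw [e2]
  refine mul_le_mul_of_nonneg_left ?_ (sq_nonneg _)
  nlinarith

/-- If at some time `t` of the grid the contrasts of at least `s` rows have mean at least `r`, and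
if the excess `D` in the expected number of exceedances of the level `z` is such that half of it
already makes the test reject, then the Type II error is exponentially small. -/
lemma typeII_le {γ : ℝ} {p n t s : ℕ} (hp : 0 < p) (htg : t ∈ grid n) (ht : 1 ≤ t) (htn : t < n)
    {θ : Mat p n} {S : Finset (Fin p)} (hS : s ≤ S.card) {r z q D A : ℝ} (hr : 0 ≤ r)
    (hθS : ∀ j ∈ S, r ≤ contrast θ t j) (hθ0 : ∀ j, j ∉ S → contrast θ t j = 0)
    (hq : q = normalTail z) (hD : D = s * (normalTail (z - r) - q)) (hA : A = p * q + D)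
    (hthr : pbjThreshold γ p n < p * poissonKL (q + D / (2 * p)) q) :
    ∫ X, (1 - pbjTest γ X) ∂obsLaw θ ≤ Real.exp (-(D ^ 2 / (8 * A))) := by
  have hp0 : (0 : ℝ) < p := by exact_mod_cast hp
  have hqm : q ∈ Set.Ioo (0 : ℝ) 1 := hq ▸ normalTail_mem_Ioo z
  have hd0 : 0 ≤ normalTail (z - r) - q := by
    rw [hq, sub_nonneg]; exact normalTail_strictAnti.antitone (by linarith)
  have hD0 : 0 ≤ D := by rw [hD]; positivity
  have hA0 : 0 < A := by rw [hA]; have := mul_pos hp0 hqm.1; linarith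
  have hm : Measurable fun X : Mat p n => contrast X t :=
    measurable_pi_lambda _ fun j => measurable_contrast t j
  rw [integral_one_sub_pbjTest]
  have hsub : (rejectSet γ p n)ᶜ ⊆
      (fun X : Mat p n => contrast X t) ⁻¹' {y | (exceedCount z y : ℝ) ≤ A - D / 2} := by
    intro X hX
    by_contra hc
    simp only [Set.mem_preimage, Set.mem_ofPred_eq, not_le] at hc
    apply hX
    have hzq : normalTailInv q = z := by rw [hq, normalTailInv_normalTail]
    have hle : (exceedCount z (contrast X t) : ℝ) / p ≤ 1 := by
      rw [div_le_one hp0]; exact_mod_cast exceedCount_le _ _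
    have hge : q + D / (2 * p) ≤ (exceedCount z (contrast X t) : ℝ) / p := by
      rw [le_div_iff₀ hp0]
      have : (q + D / (2 * p)) * p = p * q + D / 2 := by field_simp
      rw [this]; linarith
    have h : pbjThreshold γ p n < p * bernKL (exceedFrac X t q) q := by
      rw [exceedFrac_eq, hzq]
      refine hthr.trans_le (mul_le_mul_of_nonneg_left ?_ hp0.le)
      exact (poissonKL_mono hqm.1 (by have : 0 ≤ D / (2 * p) := by positivity
                                      linarith) hge).trans (poissonKL_le_bernKL hle hqm)
    obtain ⟨u, hu, hu'⟩ := exists_rat_lt_bernKL X t hqm h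
    exact ⟨t, htg, u, hu, hu'⟩
  refine (measureReal_mono hsub (measure_ne_top _ _)).trans ?_
  rw [← map_measureReal_apply hm ?_, map_contrast_obsLaw θ ht htn]
  · refine real_exceedCount_le_of_sum _ hA0 hD0 ?_
    simp only [gaussianReal_real_Ioi]
    calc A ≤ ∑ j, (q + if j ∈ S then normalTail (z - r) - q else 0) := by
          rw [Finset.sum_add_distrib, Finset.sum_ite_mem, Finset.univ_inter, Finset.sum_const,
            Finset.sum_const, Finset.card_univ, Fintype.card_fin, nsmul_eq_mul, nsmul_eq_mul, hA,
            hD]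
          have : (s : ℝ) ≤ S.card := by exact_mod_cast hS
          gcongr
      _ ≤ _ := by
          refine Finset.sum_le_sum fun j _ => ?_
          split_ifs with h
          · have := normalTail_strictAnti.antitone (show z - contrast θ t j ≤ z - r by
              linarith [hθS j h])
            linarith
          · rw [hθ0 j h, hq, sub_zero, add_zero]
  · exact measurableSet_le ((measurable_from_top (f := fun k : ℕ => (k : ℝ))).comp
      (measurable_exceedCount z)) measurable_const

/-! ### The grid -/

/-- The largest exponent in the grid. -/
def gridMax (n : ℕ) : ℕ := ⌊Real.logb (gridBase n) ((n : ℝ) / 2)⌋₊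

lemma mem_grid_iff {n t : ℕ} : t ∈ grid n ↔
    (∃ k ≤ gridMax n, ⌊gridBase n ^ k⌋₊ = t) ∨ ∃ k ≤ gridMax n, ⌊(n : ℝ) - gridBase n ^ k⌋₊ = t := by
  simp only [grid, gridMax, Finset.mem_union, Finset.mem_image, Finset.mem_range, Nat.lt_succ_iff]

lemma card_grid_le (n : ℕ) : (grid n).card ≤ 2 * (gridMax n + 1) := by
  unfold grid
  refine (Finset.card_union_le _ _).trans ?_
  have h1 := Finset.card_image_le (s := Finset.range (⌊Real.logb (gridBase n) ((n : ℝ) / 2)⌋₊ + 1))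
    (f := fun k => ⌊gridBase n ^ k⌋₊)
  have h2 := Finset.card_image_le (s := Finset.range (⌊Real.logb (gridBase n) ((n : ℝ) / 2)⌋₊ + 1))
    (f := fun k => ⌊(n : ℝ) - gridBase n ^ k⌋₊)
  rw [Finset.card_range] at h1 h2
  unfold gridMax
  omega

lemma one_le_card_grid (n : ℕ) : 1 ≤ (grid n).card :=
  Finset.card_pos.2 ⟨_, mem_grid_iff.2 (Or.inl ⟨0, Nat.zero_le _, rfl⟩)⟩

lemma one_lt_gridBase {n : ℕ} (hL : 4 ≤ Real.log (Real.log n)) : 1 < gridBase n := by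
  unfold gridBase
  have : 0 < 1 / Real.log (Real.log n) := by positivity
  linarith

lemma gridBase_pow_le {n : ℕ} (hn : 2 ≤ n) (hL : 4 ≤ Real.log (Real.log n)) {k : ℕ}
    (hk : k ≤ gridMax n) : gridBase n ^ k ≤ (n : ℝ) / 2 := by
  have hb := one_lt_gridBase hL
  have hn' : (2 : ℝ) ≤ n := by exact_mod_cast hn
  have h0 : 0 ≤ Real.logb (gridBase n) ((n : ℝ) / 2) :=
    Real.logb_nonneg hb (by linarith)
  have h1 : (k : ℝ) ≤ Real.logb (gridBase n) ((n : ℝ) / 2) :=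
    (Nat.cast_le.2 hk).trans (Nat.floor_le h0)
  rw [Real.le_logb_iff_rpow_le hb (by linarith), Real.rpow_natCast] at h1
  exact h1

lemma lt_gridBase_pow {n : ℕ} (hn : 2 ≤ n) (hL : 4 ≤ Real.log (Real.log n)) :
    (n : ℝ) / 2 < gridBase n ^ (gridMax n + 1) := by
  have hb := one_lt_gridBase hL
  have hn' : (2 : ℝ) ≤ n := by exact_mod_cast hn
  have h1 : Real.logb (gridBase n) ((n : ℝ) / 2) < (gridMax n + 1 : ℕ) := by
    push_cast; exact Nat.lt_floor_add_one _
  rw [Real.logb_lt_iff_lt_rpow hb (by linarith), Real.rpow_natCast] at h1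
  exact h1

lemma grid_bounds {n t : ℕ} (hn : 2 ≤ n) (hL : 4 ≤ Real.log (Real.log n)) (ht : t ∈ grid n) :
    1 ≤ t ∧ t < n := by
  have hb := one_lt_gridBase hL
  have hn' : (2 : ℝ) ≤ n := by exact_mod_cast hn
  rcases mem_grid_iff.1 ht with ⟨k, hk, rfl⟩ | ⟨k, hk, rfl⟩
  · have h1 := gridBase_pow_le hn hL hk
    have h2 : 1 ≤ gridBase n ^ k := one_le_pow₀ hb.le
    refine ⟨Nat.le_floor (by exact_mod_cast h2), ?_⟩
    rw [Nat.floor_lt (by linarith)]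
    linarith
  · have h1 := gridBase_pow_le hn hL hk
    have h2 : 1 ≤ gridBase n ^ k := one_le_pow₀ hb.le
    refine ⟨Nat.le_floor (by push_cast; linarith), ?_⟩
    rw [Nat.floor_lt (by linarith)]
    linarith

/-- Every changepoint `t₀` has a grid point `t ≥ t₀` whose odds `t / (n - t)` exceed those of `t₀` by at
most a factor close to one. -/
lemma exists_mem_grid {n t₀ : ℕ} (hn : 2 ≤ n) (hL : 4 ≤ Real.log (Real.log n)) (ht₀ : 1 ≤ t₀)
    (htn : t₀ < n) :
    ∃ t ∈ grid n, t₀ ≤ t ∧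
      (1 - 4 / Real.log (Real.log n)) * (t * ((n : ℝ) - t₀)) ≤ t₀ * ((n : ℝ) - t) := by
  have hb := one_lt_gridBase hL
  set b := gridBase n with hbdef
  set δ := 1 / Real.log (Real.log n) with hδ
  have hbδ : b = 1 + δ := rfl
  have hδ0 : 0 < δ := by linarith
  have hδ4 : δ ≤ 1 / 4 := by rw [hδ]; gcongr
  rw [show 4 / Real.log (Real.log n) = 4 * δ by rw [hδ]; ring]
  have hn' : (2 : ℝ) ≤ n := by exact_mod_cast hn
  have ht₀' : (1 : ℝ) ≤ t₀ := by exact_mod_cast ht₀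
  have htn' : (t₀ : ℝ) < n := by exact_mod_cast htn
  have hK := lt_gridBase_pow hn hL
  rw [← hbdef, pow_succ] at hK
  have hc : 0 ≤ 1 - 4 * δ := by linarith
  rcases le_or_gt (t₀ : ℝ) (n / 2) with hhalf | hhalf
  · by_cases hex : (t₀ : ℝ) ≤ b ^ gridMax n
    · -- The smallest power of the base which is at least `t₀`.
      classical
      have hex' : ∃ k, (t₀ : ℝ) ≤ b ^ k := ⟨_, hex⟩
      set k := Nat.find hex' with hk
      have hk1 : (t₀ : ℝ) ≤ b ^ k := Nat.find_spec hex'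
      have hk2 : k ≤ gridMax n := Nat.find_min' hex' hex
      refine ⟨⌊b ^ k⌋₊, mem_grid_iff.2 (Or.inl ⟨k, hk2, rfl⟩), Nat.le_floor hk1, ?_⟩
      have hk3 : b ^ k ≤ b * t₀ := by
        rcases Nat.eq_zero_or_pos k with h | h
        · rw [h, pow_zero]; nlinarith
        · have h1 := Nat.find_min hex' (show k - 1 < Nat.find hex' by omega)
          push Not at h1
          have h2 : b ^ k = b * b ^ (k - 1) := by
            rw [← pow_succ']; congr 1; omega
          rw [h2]
          gcongr
      have ht1 : (⌊b ^ k⌋₊ : ℝ) ≤ b * t₀ := (Nat.floor_le (by positivity)).trans hk3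
      set t := (⌊b ^ k⌋₊ : ℝ)
      have h1 : (1 - δ) * ((n : ℝ) - t₀) ≤ n - t := by nlinarith
      have h2 : (1 - 4 * δ) * b ≤ 1 - δ := by rw [hbδ]; nlinarith
      calc (1 - 4 * δ) * (t * ((n : ℝ) - t₀)) ≤ (1 - 4 * δ) * ((b * t₀) * ((n : ℝ) - t₀)) := by
            gcongr
        _ = ((1 - 4 * δ) * b) * (t₀ * ((n : ℝ) - t₀)) := by ring
        _ ≤ (1 - δ) * (t₀ * ((n : ℝ) - t₀)) := by
            gcongr
        _ = t₀ * ((1 - δ) * ((n : ℝ) - t₀)) := by ring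
        _ ≤ t₀ * ((n : ℝ) - t) := by gcongr
    · push Not at hex
      have hKle := gridBase_pow_le hn hL le_rfl
      rw [← hbdef] at hKle
      refine ⟨⌊(n : ℝ) - b ^ gridMax n⌋₊, mem_grid_iff.2 (Or.inr ⟨_, le_rfl, rfl⟩),
        Nat.le_floor (by linarith), ?_⟩
      have ht1 : (⌊(n : ℝ) - b ^ gridMax n⌋₊ : ℝ) ≤ n - b ^ gridMax n :=
        Nat.floor_le (by linarith)
      set t := (⌊(n : ℝ) - b ^ gridMax n⌋₊ : ℝ)
      set N := b ^ gridMax n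
      -- Both `t₀` and `n - t` are at least `N`, and `n < 2 * b * N`.
      have h1 : t ≤ (2 * b - 1) * N := by linarith
      have h2 : (n : ℝ) - t₀ ≤ (2 * b - 1) * N := by linarith
      have hN : 0 < N := by positivity
      have h3 : (1 - 4 * δ) * ((2 * b - 1) * (2 * b - 1)) ≤ 1 := by
        rw [hbδ]
        have : 0 ≤ δ ^ 3 := by positivity
        nlinarith [sq_nonneg δ]
      calc (1 - 4 * δ) * (t * ((n : ℝ) - t₀))
          ≤ (1 - 4 * δ) * (((2 * b - 1) * N) * ((2 * b - 1) * N)) := by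
            have h5 : t * ((n : ℝ) - t₀) ≤ ((2 * b - 1) * N) * ((2 * b - 1) * N) :=
              mul_le_mul h1 h2 (by linarith) (by have : 0 < 2 * b - 1 := by linarith
                                                 positivity)
            exact mul_le_mul_of_nonneg_left h5 hc
        _ = ((1 - 4 * δ) * ((2 * b - 1) * (2 * b - 1))) * (N * N) := by ring
        _ ≤ 1 * (N * N) := by gcongr
        _ ≤ t₀ * ((n : ℝ) - t) := by
            rw [one_mul]
            exact mul_le_mul hex.le (by linarith) hN.le (by linarith)
  · -- The largest power of the base which is at most `n - t₀`.
    classical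
    set m : ℝ := n - t₀ with hm
    have hm1 : 1 ≤ m := by
      have : t₀ + 1 ≤ n := htn
      have : (t₀ : ℝ) + 1 ≤ n := by exact_mod_cast this
      linarith
    set k := Nat.findGreatest (fun k => b ^ k ≤ m) (gridMax n) with hk
    have hk1 : b ^ k ≤ m :=
      Nat.findGreatest_spec (P := fun k => b ^ k ≤ m) (Nat.zero_le _) (by simpa using hm1)
    have hk2 : k ≤ gridMax n := Nat.findGreatest_le _
    have hk3 : m < b * b ^ k := by
      rcases hk2.lt_or_eq with h | h
      · have := Nat.findGreatest_is_greatest (P := fun k => b ^ k ≤ m) (Nat.lt_succ_self k) h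
        push Not at this
        rwa [Nat.succ_eq_add_one, pow_succ'] at this
      · rw [h]; linarith
    have hle : (t₀ : ℝ) ≤ (n : ℝ) - b ^ k := by linarith
    refine ⟨⌊(n : ℝ) - b ^ k⌋₊, mem_grid_iff.2 (Or.inr ⟨k, hk2, rfl⟩), Nat.le_floor hle, ?_⟩
    have ht1 : (⌊(n : ℝ) - b ^ k⌋₊ : ℝ) ≤ n - b ^ k := Nat.floor_le (by linarith)
    set t := (⌊(n : ℝ) - b ^ k⌋₊ : ℝ)
    set N := b ^ k
    have hN : 0 < N := by positivity
    have ht₀m : (t₀ : ℝ) = n - m := by rw [hm]; ring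
    have h1 : (1 - 4 * δ) * (b * (n - N)) ≤ t₀ := by
      have h2 : b * (n - N) ≤ b * n - m := by linarith
      have h3 : (1 - 4 * δ) * (b * (n - N)) ≤ (1 - 4 * δ) * (b * n - m) := by gcongr
      have h4 : δ * n ≤ δ * (2 * t₀) := by gcongr; linarith
      have h5 : (1 - 4 * δ) * (b * n - m) = t₀ - 4 * δ * t₀ + δ * n - 4 * (δ * δ) * n := by
        rw [hbδ, ht₀m]; ring
      have h6 : 0 ≤ 4 * (δ * δ) * n := by positivity
      have h7 : 0 ≤ δ * t₀ := by positivity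
      linarith
    calc (1 - 4 * δ) * (t * m) ≤ (1 - 4 * δ) * ((n - N) * (b * N)) := by
          gcongr
          · linarith
      _ = ((1 - 4 * δ) * (b * (n - N))) * N := by ring
      _ ≤ t₀ * ((n : ℝ) - t) := by
          refine mul_le_mul h1 (by linarith) hN.le (by linarith)

/-- For every mean matrix in the alternative, the contrasts at some grid point retain the fraction
`κ` of the signal. -/
lemma exists_grid_contrast_ge {p n s : ℕ} {ρ κ : ℝ} (hn : 2 ≤ n)
    (hL : 4 ≤ Real.log (Real.log n)) (hρ : 0 ≤ ρ) (hκ : 0 ≤ κ)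
    (hκL : κ ^ 2 ≤ 1 - 4 / Real.log (Real.log n)) {θ : Mat p n} (hθ : θ ∈ altSpace p n ρ s) :
    ∃ t ∈ grid n, ∃ S : Finset (Fin p), s ≤ S.card ∧ (∀ j ∈ S, κ * ρ ≤ contrast θ t j) ∧
      ∀ j, j ∉ S → contrast θ t j = 0 := by
  obtain ⟨S, μ₁, μ₂, t₀, hS, ht₀, ht₀n, hstep, hjump, hconst⟩ := hθ
  obtain ⟨t, htg, htt, hodds⟩ := exists_mem_grid hn hL ht₀ ht₀n
  obtain ⟨ht1, htn⟩ := grid_bounds hn hL htg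
  have hn0 : (0 : ℝ) < n := by exact_mod_cast (show 0 < n by omega)
  have ht' : (0 : ℝ) < t := by exact_mod_cast ht1
  have ht₀' : (0 : ℝ) < t₀ := by exact_mod_cast ht₀
  have hnt : (0 : ℝ) < n - t := by rw [sub_pos]; exact_mod_cast htn
  have hnt₀ : (0 : ℝ) < n - t₀ := by rw [sub_pos]; exact_mod_cast ht₀n
  refine ⟨t, htg, S, hS, fun j hj => ?_, fun j hj => ?_⟩
  · rw [contrast_of_step htt ht1 htn θ j (μ₁ j) (μ₂ j) (hstep j)]
    have hs0 : 0 < √((t₀ : ℝ) * ((n : ℝ) - t₀) / n) := Real.sqrt_pos.2 (by positivity)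
    have hd : 0 ≤ μ₁ j - μ₂ j := by
      by_contra h
      push Not at h
      have := mul_neg_of_pos_of_neg hs0 h
      linarith [hjump j hj]
    have hfac : κ * √((t₀ : ℝ) * ((n : ℝ) - t₀) / n) ≤
        √((t : ℝ) * ((n : ℝ) - t) / n) * (t₀ / t) := by
      refine le_of_sq_le_sq ?_ (by positivity)
      rw [mul_pow, mul_pow, Real.sq_sqrt (by positivity), Real.sq_sqrt (by positivity)]
      have h1 : κ ^ 2 * (t * ((n : ℝ) - t₀)) ≤ t₀ * ((n : ℝ) - t) :=
        le_trans (by gcongr) hodds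
      calc κ ^ 2 * ((t₀ : ℝ) * ((n : ℝ) - t₀) / n)
          = (κ ^ 2 * (t * ((n : ℝ) - t₀))) * (t₀ / (n * t)) := by field_simp
        _ ≤ (t₀ * ((n : ℝ) - t)) * (t₀ / (n * t)) := by gcongr
        _ = _ := by field_simp
    calc κ * ρ ≤ κ * (√((t₀ : ℝ) * ((n : ℝ) - t₀) / n) * (μ₁ j - μ₂ j)) := by
          gcongr; exact hjump j hj
      _ = (κ * √((t₀ : ℝ) * ((n : ℝ) - t₀) / n)) * (μ₁ j - μ₂ j) := by ring
      _ ≤ _ := by gcongr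
  · refine contrast_of_rows_const ht1 htn θ j (μ₁ j) fun i => ?_
    rw [hstep]
    split_ifs
    · rfl
    · exact (hconst j hj).symm

/-- The penalty is at most of order `log log n`. -/
lemma log_card_grid_le {n : ℕ} (hn : 2 ≤ n) (hL : 4 ≤ Real.log (Real.log n)) :
    Real.log (grid n).card ≤ 4 * Real.log (Real.log n) := by
  have hb := one_lt_gridBase hL
  set L := Real.log (Real.log n) with hLdef
  have hn' : (2 : ℝ) ≤ n := by exact_mod_cast hn
  have hl0 : 0 < Real.log n := Real.log_pos (by linarith)
  have hexp : Real.exp L = Real.log n := Real.exp_log hl0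
  have hδ : 1 / L ≤ 1 / 4 := by gcongr
  have hlogb : 1 / (2 * L) ≤ Real.log (gridBase n) := by
    have h := Real.one_sub_inv_le_log_of_pos (by linarith : 0 < gridBase n)
    refine le_trans ?_ h
    unfold gridBase
    rw [← hLdef]
    have h1 : (1 + 1 / L)⁻¹ = L / (L + 1) := by field_simp
    rw [h1, div_le_iff₀ (by positivity)]
    have h2 : (1 - L / (L + 1)) * (2 * L) = 2 * L / (L + 1) := by field_simp; ring
    rw [h2, le_div_iff₀ (by positivity)]
    linarith
  have hK : (gridMax n : ℝ) ≤ 2 * L * Real.exp L := by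
    have h0 : 0 ≤ Real.logb (gridBase n) ((n : ℝ) / 2) := Real.logb_nonneg hb (by linarith)
    refine (Nat.floor_le h0).trans ?_
    rw [Real.logb, div_le_iff₀ (Real.log_pos hb), hexp]
    have h1 : Real.log ((n : ℝ) / 2) ≤ Real.log n :=
      Real.log_le_log (by linarith) (by linarith)
    have h2 : 2 * L * Real.log n * (1 / (2 * L)) ≤ 2 * L * Real.log n * Real.log (gridBase n) := by
      gcongr
    have h3 : 2 * L * Real.log n * (1 / (2 * L)) = Real.log n := by field_simp
    linarith
  have hc : ((grid n).card : ℝ) ≤ Real.exp (4 * L) := by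
    have h1 : ((grid n).card : ℝ) ≤ 2 * (gridMax n + 1) := by exact_mod_cast card_grid_le n
    have h2 : L + 1 ≤ Real.exp L := Real.add_one_le_exp L
    have h3 : Real.exp (4 * L) = Real.exp L * Real.exp L * (Real.exp L * Real.exp L) := by
      rw [← Real.exp_add, ← Real.exp_add]; congr 1; ring
    rw [h3]
    set e := Real.exp L
    have he : 5 ≤ e := by linarith
    have h4 : 2 * (2 * L * e + 1) ≤ 4 * (e * e) := by nlinarith
    have h5 : 25 ≤ e * e := by nlinarith
    nlinarith
  have h1 : (0 : ℝ) < (grid n).card := by exact_mod_cast one_le_card_grid n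
  rw [Real.log_le_iff_le_exp h1]
  exact hc

/-! ### The detection boundary is attained -/

lemma Regime.eventually_le_log_log {a β : ℝ} {n s : ℕ → ℕ} (h : Regime a β n s) (ha : 0 < a)
    (C : ℝ) : ∀ᶠ p : ℕ in atTop, C ≤ Real.log (Real.log (n p)) ∧ 2 ≤ n p := by
  filter_upwards [h.eventually_log_log ha (show 0 < a / 2 by positivity),
    eventually_le_rpow (show 0 < a - a / 2 by linarith) C one_pos] with p hp hC
  exact ⟨by linarith [hp.1], hp.2.2.2.2⟩

lemma four_mul_log_le_pbjThreshold {γ : ℝ} (hγ : 0 < γ) {p : ℕ} (hp : 1 ≤ p) (n : ℕ) :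
    4 * Real.log p ≤ pbjThreshold γ p n := by
  have hl : 0 ≤ Real.log p := Real.log_nonneg (by exact_mod_cast hp)
  have hc : 0 ≤ Real.log (grid n).card := Real.log_nonneg (by exact_mod_cast one_le_card_grid n)
  unfold pbjThreshold
  nlinarith [mul_nonneg hγ.le hl]

lemma Regime.eventually_pbjThreshold_le {a β : ℝ} {n s : ℕ → ℕ} (h : Regime a β n s) (ha : 0 < a)
    (γ : ℝ) {η : ℝ} (hη : 0 < η) :
    ∀ᶠ p : ℕ in atTop, pbjThreshold γ p (n p) ≤ (p : ℝ) ^ (a + η) := by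
  filter_upwards [h.eventually_log_log ha (show 0 < η / 2 by positivity),
    h.eventually_le_log_log ha 4,
    eventually_mul_rpow_le (show a + η / 2 < a + η by linarith) 8
      (show (0 : ℝ) < 1 / 2 by norm_num),
    eventually_mul_log_le_rpow (show 0 < a + η by linarith) (2 * (2 + γ))
      (show (0 : ℝ) < 1 / 2 by norm_num)] with p h1 h2 h3 h4
  have := log_card_grid_le h2.2 h2.1
  unfold pbjThreshold
  linarith [h1.2.1]

/-- The Type I error of the test vanishes. -/
lemma eventually_typeI_le {a β γ : ℝ} {n s : ℕ → ℕ} (h : Regime a β n s) (ha : 0 < a)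
    (hγ : 0 < γ) :
    ∀ᶠ p : ℕ in atTop, ∀ θ ∈ nullSpace p (n p), ∫ X, pbjTest γ X ∂obsLaw θ ≤ 1 / p := by
  filter_upwards [h.eventually_le_log_log ha 4, eventually_ge_atTop 2] with p hL hp θ hθ
  have hp' : (2 : ℝ) ≤ p := by exact_mod_cast hp
  have hp0 : (0 : ℝ) < p := by linarith
  have hl : 0 ≤ Real.log p := Real.log_nonneg (by linarith)
  have hc1 : (1 : ℝ) ≤ (grid (n p)).card := by exact_mod_cast one_le_card_grid (n p)
  have hc : 0 ≤ Real.log (grid (n p)).card := Real.log_nonneg hc1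
  have he : Real.exp (-pbjThreshold γ p (n p)) ≤
      ((p : ℝ) ^ 4)⁻¹ * ((grid (n p)).card : ℝ)⁻¹ := by
    calc Real.exp (-pbjThreshold γ p (n p))
        ≤ Real.exp (-(4 * Real.log p) + -Real.log (grid (n p)).card) := by
          apply Real.exp_le_exp.2
          unfold pbjThreshold
          nlinarith [mul_nonneg hγ.le hl]
      _ = _ := by
          rw [Real.exp_add, Real.exp_neg, Real.exp_neg, Real.exp_log (by linarith),
            show 4 * Real.log p = (4 : ℕ) * Real.log p by norm_num, Real.exp_nat_mul,
            Real.exp_log hp0]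
  refine (typeI_le (by omega) (fun t ht => grid_bounds hL.2 hL.1 ht) hθ).trans ?_
  calc _ ≤ ((grid (n p)).card : ℝ) *
        (((p : ℝ) + 1) * (2 * (((p : ℝ) ^ 4)⁻¹ * ((grid (n p)).card : ℝ)⁻¹))) := by
        gcongr
    _ = 2 * (p + 1) / (p : ℝ) ^ 4 := by field_simp
    _ ≤ 1 / p := by
        rw [div_le_div_iff₀ (by positivity) hp0]
        have h4 : (4 : ℝ) ≤ p ^ 2 := by nlinarith
        calc 2 * ((p : ℝ) + 1) * p ≤ 4 * p ^ 2 := by nlinarith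
          _ ≤ p ^ 2 * p ^ 2 := by gcongr
          _ = 1 * p ^ 4 := by ring

/-- The Type II error vanishes if, when the rows with a change have contrasts at least `κ * ρ` at
a time of the grid, the levels `z` can be chosen so that the excess `D` in the number of
exceedances suffices for a rejection. The factor `κ < 1` is the price of searching over a grid. -/
lemma eventually_typeII_le {a β γ κ : ℝ} {n s : ℕ → ℕ} (h : Regime a β n s) (ha : 0 < a)
    (hκ0 : 0 ≤ κ) (hκ1 : κ < 1) {ρ : ℕ → ℝ} (hρ : ∀ p, 0 ≤ ρ p)
    (H : ∀ᶠ p : ℕ in atTop, ∃ z q D A : ℝ, q = normalTail z ∧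
      D = s p * (normalTail (z - κ * ρ p) - q) ∧ A = p * q + D ∧
      pbjThreshold γ p (n p) < p * poissonKL (q + D / (2 * p)) q ∧
      Real.log p ≤ D ^ 2 / (8 * A)) :
    ∀ᶠ p : ℕ in atTop, ∀ θ ∈ altSpace p (n p) (ρ p) (s p),
      ∫ X, (1 - pbjTest γ X) ∂obsLaw θ ≤ 1 / p := by
  have hκ2 : 0 < 1 - κ ^ 2 := by nlinarith
  filter_upwards [h.eventually_le_log_log ha 4, h.eventually_le_log_log ha (4 / (1 - κ ^ 2)),
    H, eventually_ge_atTop 1] with p hL hLκ ⟨z, q, D, A, hq, hD, hA, hthr, hlog⟩ hp θ hθ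
  have hp0 : (0 : ℝ) < p := by exact_mod_cast hp
  have hκL : κ ^ 2 ≤ 1 - 4 / Real.log (Real.log (n p)) := by
    have h1 : 0 < Real.log (Real.log (n p)) := by linarith [hL.1]
    have h2 := hLκ.1
    rw [div_le_iff₀ hκ2] at h2
    have : 4 / Real.log (Real.log (n p)) ≤ 1 - κ ^ 2 := by
      rw [div_le_iff₀ h1]; linarith
    linarith
  obtain ⟨t, ht, S, hS, hS1, hS0⟩ := exists_grid_contrast_ge hL.2 hL.1 (hρ p) hκ0 hκL hθ
  obtain ⟨ht1, htn⟩ := grid_bounds hL.2 hL.1 ht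
  refine (typeII_le (by omega) ht ht1 htn hS (mul_nonneg hκ0 (hρ p)) hS1 hS0 hq hD hA
    hthr).trans ?_
  rw [one_div, show (p : ℝ)⁻¹ = Real.exp (-Real.log p) by
    rw [Real.exp_neg, Real.exp_log hp0]]
  exact Real.exp_le_exp.2 (by linarith)

lemma sq_div_le_mul_poissonKL {p q D : ℝ} (hp : 0 < p) (hq : 0 < q) (hD : 0 ≤ D) :
    D ^ 2 / (16 * (p * q + D)) ≤ p * poissonKL (q + D / (2 * p)) q := by
  have hD2 : 0 ≤ D / (2 * p) := by positivity
  calc D ^ 2 / (16 * (p * q + D)) ≤ D ^ 2 / (16 * (p * q + D / 2)) := by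
        have : 0 < p * q := by positivity
        gcongr
        linarith
    _ = p * ((q + D / (2 * p) - q) ^ 2 / (4 * (q + D / (2 * p)))) := by field_simp; ring
    _ ≤ _ := by
        gcongr
        exact sq_sub_div_le_poissonKL hq (by linarith)

/-- A sufficient condition for the detection of an excess of at least `D₀` over an expected number
of at most `B` exceedances. -/
lemma rejection_of_le {T p q D D₀ B l : ℝ} (hp : 0 < p) (hq : 0 < q) (hT : 0 < T)
    (hlT : 4 * l ≤ T) (hD₀ : D₀ ≤ D) (hB : p * q ≤ B) (h1 : 34 * T * B ≤ D₀ ^ 2)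
    (h2 : 34 * T ≤ D₀) :
    T < p * poissonKL (q + D / (2 * p)) q ∧ l ≤ D ^ 2 / (8 * (p * q + D)) := by
  have hD0 : 0 < D := by linarith
  have hA : 0 < p * q + D := by positivity
  have hkey : 17 * T ≤ D ^ 2 / (p * q + D) := by
    rw [le_div_iff₀ hA]
    have e1 : 34 * T * (p * q) ≤ 34 * T * B := by gcongr
    have e2 : 34 * T * D ≤ D₀ * D := by gcongr
    have e3 : D₀ * D ≤ D * D := by gcongr
    have e4 : D₀ ^ 2 ≤ D ^ 2 := by gcongr; linarith
    nlinarith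
  constructor
  · refine lt_of_lt_of_le ?_ (sq_div_le_mul_poissonKL hp hq hD0.le)
    rw [show D ^ 2 / (16 * (p * q + D)) = D ^ 2 / (p * q + D) / 16 by field_simp]
    linarith
  · rw [show D ^ 2 / (8 * (p * q + D)) = D ^ 2 / (p * q + D) / 8 by field_simp]
    linarith

/-- The detection of excesses of polynomial order: the expected number of exceedances is at most
`p ^ b` in the absence of a change, and the change adds at least `c * p ^ d` exceedances. -/
lemma eventually_rejection {a β γ κ b c d : ℝ} {n s : ℕ → ℕ} (h : Regime a β n s) (ha : 0 < a)
    (hγ : 0 < γ) (hc : 0 < c) (hd : a < d) (hbd : a + b < 2 * d) {ρ z : ℕ → ℝ}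
    (hb : ∀ᶠ p : ℕ in atTop, p * normalTail (z p) ≤ (p : ℝ) ^ b)
    (hexc : ∀ᶠ p : ℕ in atTop,
      c * (p : ℝ) ^ d ≤ s p * (normalTail (z p - κ * ρ p) - normalTail (z p))) :
    ∀ᶠ p : ℕ in atTop, ∃ z q D A : ℝ, q = normalTail z ∧
      D = s p * (normalTail (z - κ * ρ p) - q) ∧ A = p * q + D ∧
      pbjThreshold γ p (n p) < p * poissonKL (q + D / (2 * p)) q ∧
      Real.log p ≤ D ^ 2 / (8 * A) := by
  obtain ⟨η, hη, hη1, hη2⟩ : ∃ η > 0, a + η < d ∧ a + η + b < 2 * d := by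
    refine ⟨min ((d - a) / 2) ((2 * d - a - b) / 2), ?_, ?_, ?_⟩
    · refine lt_min ?_ ?_ <;> linarith
    · linarith [min_le_left ((d - a) / 2) ((2 * d - a - b) / 2)]
    · linarith [min_le_right ((d - a) / 2) ((2 * d - a - b) / 2)]
  filter_upwards [hb, hexc, h.eventually_pbjThreshold_le ha γ hη, eventually_ge_atTop 2,
    eventually_mul_rpow_le hη1 34 hc, eventually_mul_rpow_le hη2 34 (show 0 < c ^ 2 by positivity)]
    with p hb hexc hT hp h1 h2
  have hp0 : (0 : ℝ) < p := by exact_mod_cast (show 0 < p by omega)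
  have hlp : 0 < Real.log p := Real.log_pos (by exact_mod_cast (show 1 < p by omega))
  have hlT := four_mul_log_le_pbjThreshold hγ (show 1 ≤ p by omega) (n p)
  refine ⟨z p, _, _, _, rfl, rfl, rfl, ?_⟩
  refine rejection_of_le hp0 (normalTail_mem_Ioo _).1 (by linarith) hlT hexc hb ?_ ?_
  · calc 34 * pbjThreshold γ p (n p) * (p : ℝ) ^ b
        ≤ 34 * (p : ℝ) ^ (a + η) * (p : ℝ) ^ b := by gcongr
      _ = 34 * (p : ℝ) ^ (a + η + b) := by rw [mul_assoc, ← Real.rpow_add hp0]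
      _ ≤ c ^ 2 * (p : ℝ) ^ (2 * d) := h2
      _ = (c * (p : ℝ) ^ d) ^ 2 := by
          rw [mul_pow, mul_comm 2 d, Real.rpow_mul hp0.le, Real.rpow_ofNat]
  · linarith

/-- Detection in the dense regime, at the level `z = 0`. -/
lemma eventually_rejection_dense {a β β₁ γ : ℝ} {n s : ℕ → ℕ} (h : Regime a β n s) (ha : 0 < a)
    (hγ : 0 < γ) (hβ₁ : 0 < β₁) (hlt : β < β₁) (h1 : a ≤ 1 - 2 * β₁) :
    ∀ᶠ p : ℕ in atTop, ∃ z q D A : ℝ, q = normalTail z ∧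
      D = s p * (normalTail (z - 1 / 2 * boundary a β₁ p) - q) ∧ A = p * q + D ∧
      pbjThreshold γ p (n p) < p * poissonKL (q + D / (2 * p)) q ∧
      Real.log p ≤ D ^ 2 / (8 * A) := by
  refine eventually_rejection (b := 1) (c := 1 / 24) (d := (1 + a) / 2 + (β₁ - β)) (z := fun _ => 0)
    h ha hγ (by norm_num) (by linarith) (by linarith) ?_ ?_
  · filter_upwards with p
    rw [Real.rpow_one]
    exact mul_le_of_le_one_right (by positivity) (normalTail_mem_Ioo 0).2.le
  · filter_upwards [eventually_ge_atTop 1, h.eventually_sparsity] with p hp hs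
    have hp' : (1 : ℝ) ≤ p := by exact_mod_cast hp
    have hp0 : (0 : ℝ) < p := by linarith
    have hρ : boundary a β₁ p = (p : ℝ) ^ ((a - (1 - 2 * β₁)) / 2) := by
      rw [boundary, boundarySq, if_pos h1, Real.sqrt_eq_rpow, ← Real.rpow_mul hp0.le]
      congr 1; ring
    rw [hρ]
    set r := (p : ℝ) ^ ((a - (1 - 2 * β₁)) / 2) with hr
    have hr0 : 0 < r := by positivity
    have hr1 : r ≤ 1 := Real.rpow_le_one_of_one_le_of_nonpos hp' (by linarith)
    have hdiff := normalTail_sub_ge (show (0 : ℝ) - 1 / 2 * r ≤ 0 by linarith) (w := 1)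
      (fun x hx => abs_le.2 ⟨by linarith [hx.1], by linarith [hx.2]⟩)
    have he : (1 : ℝ) / 2 ≤ Real.exp (-1 ^ 2 / 2) := by
      linarith [Real.add_one_le_exp (-1 ^ 2 / 2 : ℝ)]
    calc 1 / 24 * (p : ℝ) ^ ((1 + a) / 2 + (β₁ - β)) = (p : ℝ) ^ (1 - β) / 2 * (r / 12) := by
          rw [show (1 + a) / 2 + (β₁ - β) = (1 - β) + (a - (1 - 2 * β₁)) / 2 by ring,
            Real.rpow_add hp0, ← hr]
          ring
      _ ≤ s p * (normalTail (0 - 1 / 2 * r) - normalTail 0) := by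
          gcongr
          · exact hs.1
          · refine le_trans ?_ hdiff
            calc r / 12 = (0 - (0 - 1 / 2 * r)) * ((1 / 2) / 3) := by ring
              _ ≤ _ := by
                refine mul_le_mul_of_nonneg_left ?_ (by linarith)
                gcongr

/-- Detection in the two moderately sparse regimes, where the boundary equals
`(√u - √v) * √(2 * log p)`: the level is `z = √(2 * u * log p)`, and a row with a change exceeds it
with probability `p ^ (-v)`, up to a perturbation of `v`. -/
lemma eventually_rejection_sparse {a β β₁ γ u v : ℝ} {n s : ℕ → ℕ} (h : Regime a β n s)
    (ha : 0 < a) (hγ : 0 < γ) (hv : 0 ≤ v) (hvu : v < u) (h1 : a < 1 - 2 * β - 2 * v + u)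
    (h2 : a < 1 - β - v)
    (hρ : ∀ p : ℕ, 1 ≤ p → boundarySq a β₁ p = (√u - √v) ^ 2 * (2 * Real.log p)) :
    ∃ κ : ℝ, 0 ≤ κ ∧ κ < 1 ∧
      ∀ᶠ p : ℕ in atTop, ∃ z q D A : ℝ, q = normalTail z ∧
        D = s p * (normalTail (z - κ * boundary a β₁ p) - q) ∧ A = p * q + D ∧
        pbjThreshold γ p (n p) < p * poissonKL (q + D / (2 * p)) q ∧
        Real.log p ≤ D ^ 2 / (8 * A) := by
  obtain ⟨m, hm, hm1, hm2, hm3⟩ : ∃ m > 0, 2 * m < u - v ∧ 4 * m < 1 - 2 * β - 2 * v + u - a ∧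
      2 * m < 1 - β - v - a := by
    refine ⟨min (min ((u - v) / 4) ((1 - 2 * β - 2 * v + u - a) / 8)) ((1 - β - v - a) / 4),
      ?_, ?_, ?_, ?_⟩
    · refine lt_min (lt_min ?_ ?_) ?_ <;> linarith
    · linarith [(min_le_left (min ((u - v) / 4) ((1 - 2 * β - 2 * v + u - a) / 8))
        ((1 - β - v - a) / 4)).trans (min_le_left _ _)]
    · linarith [(min_le_left (min ((u - v) / 4) ((1 - 2 * β - 2 * v + u - a) / 8))
        ((1 - β - v - a) / 4)).trans (min_le_right _ _)]
    · linarith [min_le_right (min ((u - v) / 4) ((1 - 2 * β - 2 * v + u - a) / 8))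
        ((1 - β - v - a) / 4)]
  have huv : 0 < √u - √v := sub_pos.2 (Real.sqrt_lt_sqrt hv hvu)
  have hv' : √v < √(v + m) := Real.sqrt_lt_sqrt hv (by linarith)
  have hu' : √(v + m) < √u := Real.sqrt_lt_sqrt (by linarith) (by linarith)
  refine ⟨(√u - √(v + m)) / (√u - √v), div_nonneg (by linarith) huv.le,
    (div_lt_one huv).2 (by linarith), ?_⟩
  have hlog : Tendsto (fun p : ℕ => Real.log p) atTop atTop :=
    Real.tendsto_log_atTop.comp tendsto_natCast_atTop_atTop
  refine eventually_rejection (b := 1 - u) (c := 1 / 12) (d := 1 - β - v - 2 * m)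
    (z := fun p => √u * √(2 * Real.log p)) h ha hγ (by norm_num) (by linarith) (by linarith) ?_ ?_
  · filter_upwards [eventually_ge_atTop 1] with p hp
    have hp0 : (0 : ℝ) < p := by exact_mod_cast hp
    have hl : 0 ≤ Real.log p := Real.log_nonneg (by exact_mod_cast hp)
    calc (p : ℝ) * normalTail (√u * √(2 * Real.log p))
        ≤ p * Real.exp (-(√u * √(2 * Real.log p)) ^ 2 / 2) := by
          gcongr; exact normalTail_le_exp (by positivity)
      _ = (p : ℝ) ^ (1 - u) := by
          rw [mul_pow, Real.sq_sqrt (by linarith), Real.sq_sqrt (by linarith), sub_eq_add_neg,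
            Real.rpow_add hp0, Real.rpow_one, Real.rpow_def_of_pos hp0 (-u)]
          congr 2; ring
  · filter_upwards [eventually_ge_atTop 1, h.eventually_sparsity,
      hlog.eventually_ge_atTop (8 * (v + m) / m ^ 2), hlog.eventually_ge_atTop (1 / m),
      eventually_mul_rpow_le (show -u < -(v + 2 * m) by linarith) 1
        (show (0 : ℝ) < 1 / 6 by norm_num)] with p hp hs hl1 hl2 hpow
    have hp0 : (0 : ℝ) < p := by exact_mod_cast hp
    have hl : 0 ≤ Real.log p := Real.log_nonneg (by exact_mod_cast hp)
    rw [div_le_iff₀ (by positivity)] at hl1 hl2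
    have hρp : boundary a β₁ p = (√u - √v) * √(2 * Real.log p) := by
      rw [boundary, hρ p hp, Real.sqrt_mul (sq_nonneg _), Real.sqrt_sq huv.le]
    have hsub : √u * √(2 * Real.log p) - (√u - √(v + m)) / (√u - √v) * boundary a β₁ p =
        √(v + m) * √(2 * Real.log p) := by
      rw [hρp]; field_simp; ring
    rw [hsub]
    set y := √(v + m) * √(2 * Real.log p) with hy
    have hy0 : 0 ≤ y := by positivity
    have hy2 : y ^ 2 = 2 * (v + m) * Real.log p := by
      rw [hy, mul_pow, Real.sq_sqrt (by linarith), Real.sq_sqrt (by linarith)]; ring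
    have hyl : y ≤ m * Real.log p / 2 := by
      refine (le_abs_self y).trans (abs_le_of_sq_le_sq ?_ (by positivity))
      have := mul_le_mul_of_nonneg_right hl1 hl
      rw [hy2]
      linarith
    have hsig : (p : ℝ) ^ (-(v + 2 * m)) / 3 ≤ normalTail y := by
      refine le_trans ?_ (normalTail_ge hy0)
      rw [Real.rpow_def_of_pos hp0]
      gcongr
      nlinarith
    have hnoise : normalTail (√u * √(2 * Real.log p)) ≤ 1 / 6 * (p : ℝ) ^ (-(v + 2 * m)) := by
      calc normalTail (√u * √(2 * Real.log p))
          ≤ Real.exp (-(√u * √(2 * Real.log p)) ^ 2 / 2) := normalTail_le_exp (by positivity)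
        _ = 1 * (p : ℝ) ^ (-u) := by
          rw [mul_pow, Real.sq_sqrt (by linarith), Real.sq_sqrt (by linarith), one_mul,
            Real.rpow_def_of_pos hp0 (-u)]
          congr 1; ring
        _ ≤ _ := hpow
    calc 1 / 12 * (p : ℝ) ^ (1 - β - v - 2 * m)
        = (p : ℝ) ^ (1 - β) / 2 * ((p : ℝ) ^ (-(v + 2 * m)) / 6) := by
          rw [show 1 - β - v - 2 * m = (1 - β) + -(v + 2 * m) by ring, Real.rpow_add hp0]
          ring
      _ ≤ s p * (normalTail y - normalTail (√u * √(2 * Real.log p))) := by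
          gcongr
          · exact hs.1
          · linarith

/-- Detection in the sparsest regime, at half of the signal: at this level there are hardly any
exceedances in the absence of a change, and the large deviations of their number matter. -/
lemma eventually_rejection_very_sparse {a β β₁ γ : ℝ} {n s : ℕ → ℕ} (h : Regime a β n s)
    (ha : 0 < a) (hβ₁ : β₁ ∈ Set.Ioo (0 : ℝ) 1) (hlt : β < β₁) (h1 : 1 - β₁ < a) :
    ∀ᶠ p : ℕ in atTop, ∃ z q D A : ℝ, q = normalTail z ∧
      D = s p * (normalTail (z - 1 / 2 * boundary a β₁ p) - q) ∧ A = p * q + D ∧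
      pbjThreshold γ p (n p) < p * poissonKL (q + D / (2 * p)) q ∧
      Real.log p ≤ D ^ 2 / (8 * A) := by
  obtain ⟨hβ₁0, hβ₁1⟩ := hβ₁
  filter_upwards [h.eventually_pbjThreshold_le ha γ (show 0 < (β₁ - β) / 2 by linarith),
    h.eventually_sparsity, eventually_ge_atTop 3,
    eventually_mul_rpow_le (show a + (β₁ - β) / 2 < a + β₁ - β by linarith) 1
      (show (0 : ℝ) < 1 / 1000 by norm_num),
    eventually_mul_log_le_rpow (show 0 < a - (1 - β₁) by linarith) 32 one_pos,
    eventually_mul_log_le_rpow (show 0 < 1 - β by linarith) 16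
      (show (0 : ℝ) < 1 / 24 by norm_num)] with p hT hs hp hpow hlog1 hlog2
  have hp3 : (3 : ℝ) ≤ p := by exact_mod_cast hp
  have hp0 : (0 : ℝ) < p := by linarith
  have hl : 1 ≤ Real.log p := by
    rw [Real.le_log_iff_exp_le hp0]; linarith [Real.exp_one_lt_d9]
  have hρ2 : boundary a β₁ p ^ 2 = (p : ℝ) ^ (a - (1 - β₁)) := by
    rw [boundary_sq (by omega), boundarySq, if_neg (by linarith), if_neg (by linarith),
      if_neg (by linarith)]
  have hρ0 : 0 ≤ boundary a β₁ p := Real.sqrt_nonneg _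
  set ρ := boundary a β₁ p with hρ
  refine ⟨ρ / 2, _, _, _, rfl, rfl, rfl, ?_⟩
  rw [show ρ / 2 - 1 / 2 * ρ = 0 by ring]
  have hq := normalTail_mem_Ioo (ρ / 2)
  have hqexp : normalTail (ρ / 2) ≤ Real.exp (-(ρ ^ 2 / 8)) := by
    refine (normalTail_le_exp (by linarith)).trans (Real.exp_le_exp.2 (by linarith))
  set q := normalTail (ρ / 2) with hqdef
  have hlogq : Real.log q ≤ -(ρ ^ 2 / 8) := (Real.log_le_iff_le_exp hq.1).2 hqexp
  have hq12 : q ≤ 1 / 12 := by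
    have e1 : Real.exp (-(ρ ^ 2 / 8)) ≤ Real.exp (-4) := Real.exp_le_exp.2 (by linarith)
    have e2 : Real.exp (-4 : ℝ) ≤ 1 / 12 := by
      rw [Real.exp_neg, show (4 : ℝ) = (4 : ℕ) * 1 by norm_num, Real.exp_nat_mul, one_div]
      have : (2 : ℝ) ^ 4 ≤ Real.exp 1 ^ 4 := by
        gcongr; linarith [Real.add_one_le_exp (1 : ℝ)]
      gcongr
      linarith
    linarith
  have hpq : p * q ≤ 1 := by
    have e1 : Real.exp (-(ρ ^ 2 / 8)) ≤ Real.exp (-Real.log p) := Real.exp_le_exp.2 (by linarith)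
    rw [Real.exp_neg (Real.log p), Real.exp_log hp0] at e1
    calc (p : ℝ) * q ≤ p * (p : ℝ)⁻¹ := by gcongr; linarith
      _ = 1 := mul_inv_cancel₀ hp0.ne'
  have h0 : 1 / 6 ≤ normalTail 0 := by
    have e := normalTail_ge (le_refl (0 : ℝ))
    have := Real.add_one_le_exp (-(0 + 1) ^ 2 / 2 : ℝ)
    linarith
  have hD : (p : ℝ) ^ (1 - β) / 24 ≤ s p * (normalTail 0 - q) := by
    calc (p : ℝ) ^ (1 - β) / 24 = (p : ℝ) ^ (1 - β) / 2 * (1 / 12) := by ring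
      _ ≤ _ := by
        gcongr
        · exact hs.1
        · linarith
  set D := s p * (normalTail 0 - q)
  have hD16 : 16 * Real.log p ≤ D := by linarith
  have hDpos : 0 < D := by linarith
  have hpq0 : 0 < p * q := mul_pos hp0 hq.1
  constructor
  · have hx : 1 / p ≤ q + D / (2 * p) := by
      have : 1 / p ≤ D / (2 * p) := by
        rw [div_le_div_iff₀ hp0 (by positivity)]; nlinarith
      linarith [hq.1]
    have hx0 : 0 < q + D / (2 * p) := by have := hq.1; positivity
    have hlogx : ρ ^ 2 / 8 - Real.log p ≤ Real.log ((q + D / (2 * p)) / q) := by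
      rw [Real.log_div hx0.ne' hq.1.ne']
      have := Real.log_le_log (by positivity) hx
      rw [one_div, Real.log_inv] at this
      linarith
    calc pbjThreshold γ p (n p) ≤ 1 / 1000 * (p : ℝ) ^ (a + β₁ - β) := by linarith
      _ < 1 / 768 * (p : ℝ) ^ (a + β₁ - β) := by
          have : 0 < (p : ℝ) ^ (a + β₁ - β) := by positivity
          linarith
      _ = (p : ℝ) ^ (1 - β) / 24 / 2 * (ρ ^ 2 / 16) := by
          rw [hρ2, show a + β₁ - β = (1 - β) + (a - (1 - β₁)) by ring, Real.rpow_add hp0]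
          ring
      _ ≤ D / 2 * (Real.log ((q + D / (2 * p)) / q) - 1) := by
          gcongr
          linarith
      _ ≤ p * (q + D / (2 * p)) * (Real.log ((q + D / (2 * p)) / q) - 1) := by
          have e : p * (q + D / (2 * p)) = p * q + D / 2 := by field_simp
          rw [e]
          refine mul_le_mul_of_nonneg_right (by linarith) ?_
          linarith
      _ ≤ p * poissonKL (q + D / (2 * p)) q := by
          unfold poissonKL
          nlinarith
  · rw [le_div_iff₀ (by positivity)]
    nlinarith

lemma exists_eventually_rejection {a β β₁ γ : ℝ} {n s : ℕ → ℕ} (h : Regime a β n s)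
    (ha : 0 < a) (hγ : 0 < γ) (hβ₁ : β₁ ∈ Set.Ioo (0 : ℝ) 1) (hlt : β < β₁) :
    ∃ κ : ℝ, 0 ≤ κ ∧ κ < 1 ∧
      ∀ᶠ p : ℕ in atTop, ∃ z q D A : ℝ, q = normalTail z ∧
        D = s p * (normalTail (z - κ * boundary a β₁ p) - q) ∧ A = p * q + D ∧
        pbjThreshold γ p (n p) < p * poissonKL (q + D / (2 * p)) q ∧
        Real.log p ≤ D ^ 2 / (8 * A) := by
  by_cases h1 : a ≤ 1 - 2 * β₁
  · exact ⟨1 / 2, by norm_num, by norm_num,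
      eventually_rejection_dense h ha hγ hβ₁.1 hlt h1⟩
  push Not at h1
  by_cases h2 : a ≤ 1 - 4 * β₁ / 3
  · -- The most informative level is `√(2 * u * log p)` with `u = 4 * v`, twice the signal.
    set v := (a - (1 - 2 * β₁)) / 2 with hv
    have hv0 : 0 < v := by rw [hv]; linarith
    refine eventually_rejection_sparse (u := 4 * v) (v := v) h ha hγ hv0.le (by linarith)
      (by linarith) (by linarith) fun p hp => ?_
    rw [boundarySq, if_neg (not_le.2 h1), if_pos h2, Real.sqrt_mul (by norm_num),
      show √(4 : ℝ) = 2 by rw [Real.sqrt_eq_iff_mul_self_eq] <;> norm_num,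
      show 2 * √v - √v = √v by ring, Real.sq_sqrt hv0.le, hv]
    ring
  push Not at h2
  by_cases h3 : a ≤ 1 - β₁
  · refine eventually_rejection_sparse (u := 1 - a) (v := 1 - a - β₁) h ha hγ (by linarith)
      (by linarith [hβ₁.1]) (by linarith) (by linarith) fun p hp => ?_
    rw [boundarySq, if_neg (not_le.2 h1), if_neg (not_le.2 h2), if_pos h3]
    ring
  · exact ⟨1 / 2, by norm_num, by norm_num,
      eventually_rejection_very_sparse h ha hβ₁ hlt (not_le.1 h3)⟩

lemma tendsto_worstCaseError_pbjTest {a β β₁ γ : ℝ} {n s : ℕ → ℕ} (h : Regime a β n s)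
    (ha : 0 < a) (hγ : 0 < γ) (hβ₁ : β₁ ∈ Set.Ioo (0 : ℝ) 1) (hlt : β < β₁) :
    Tendsto (fun p : ℕ => worstCaseError (pbjTest γ : Mat p (n p) → ℝ) (boundary a β₁ p) (s p))
      atTop (𝓝 0) := by
  obtain ⟨κ, hκ0, hκ1, H⟩ := exists_eventually_rejection h ha hγ hβ₁ hlt
  have hlim : Tendsto (fun p : ℕ => 1 / (p : ℝ) + 1 / p) atTop (𝓝 0) := by
    have h0 : Tendsto (fun p : ℕ => 1 / (p : ℝ)) atTop (𝓝 0) := tendsto_one_div_atTop_nhds_zero_nat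
    simpa using h0.add h0
  refine tendsto_of_tendsto_of_tendsto_of_le_of_le' tendsto_const_nhds hlim
    (Eventually.of_forall fun p => worstCaseError_nonneg (isTest_pbjTest γ p (n p)) _ _) ?_
  filter_upwards [eventually_typeI_le h ha hγ, eventually_typeII_le (ρ := boundary a β₁) h ha hκ0
    hκ1 (fun p => Real.sqrt_nonneg _) H] with p hI hII
  exact add_le_add (Real.iSup_le (fun θ => hI θ.1 θ.2) (by positivity))
    (Real.iSup_le (fun θ => hII θ.1 θ.2) (by positivity))

lemma minimaxError_nonneg (p n : ℕ) (ρ : ℝ) (s : ℕ) : 0 ≤ minimaxError p n ρ s :=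
  Real.iInf_nonneg fun ψ => worstCaseError_nonneg ψ.2 ρ s

lemma minimaxError_le {p n : ℕ} {ψ : Mat p n → ℝ} (h : IsTest ψ) (ρ : ℝ) (s : ℕ) :
    minimaxError p n ρ s ≤ worstCaseError ψ ρ s :=
  ciInf_le ⟨0, by rintro _ ⟨ψ, rfl⟩; exact worstCaseError_nonneg ψ.2 ρ s⟩
    (⟨ψ, h⟩ : {ψ : Mat p n → ℝ // IsTest ψ})

end

end Changepoint

theorem theorem1 (a β₁ β : ℝ) (ha : 0 < a) (hβ₁ : β₁ ∈ Set.Ioo (0 : ℝ) 1)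
    (hβ : β ∈ Set.Ioo (0 : ℝ) 1) (n s : ℕ → ℕ) (hreg : Changepoint.Regime a β n s) :
    (β₁ < β →
      ¬ Tendsto
        (fun p : ℕ => Changepoint.minimaxError p (n p) (Changepoint.boundary a β₁ p) (s p))
        atTop (𝓝 0)) ∧
    (β < β₁ →
      Tendsto
        (fun p : ℕ => Changepoint.minimaxError p (n p) (Changepoint.boundary a β₁ p) (s p))
        atTop (𝓝 0) ∧
      ∀ γ : ℝ, 0 < γ →
        (∀ p : ℕ, Changepoint.IsTest (Changepoint.pbjTest γ : Changepoint.Mat p (n p) → ℝ)) ∧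
        Tendsto
          (fun p : ℕ => Changepoint.worstCaseError
            (Changepoint.pbjTest γ : Changepoint.Mat p (n p) → ℝ)
            (Changepoint.boundary a β₁ p) (s p))
          atTop (𝓝 0)) := by
  refine ⟨fun hlt hlim => ?_, fun hlt => ⟨?_, fun γ hγ => ⟨fun p => ?_, ?_⟩⟩⟩
  · obtain ⟨p, h1, h2⟩ := ((Changepoint.eventually_le_minimaxError ha hβ₁ hβ hreg hlt).and
      (hlim.eventually_lt_const (show (0 : ℝ) < 1 / 8 by norm_num))).exists
    linarith
  · exact squeeze_zero (fun p => Changepoint.minimaxError_nonneg _ _ _ _)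
      (fun p => Changepoint.minimaxError_le (Changepoint.isTest_pbjTest 1 p (n p)) _ _)
      (Changepoint.tendsto_worstCaseError_pbjTest hreg ha one_pos hβ₁ hlt)
  · exact Changepoint.isTest_pbjTest γ p (n p)
  · exact Changepoint.tendsto_worstCaseError_pbjTest hreg ha hγ hβ₁ hlt
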